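/- Matrices $(a_{ij})_{i,j\in\mathbb Z}$ act as operators on $l^2(\mathbb Z)$; $\mathcal S$ is the Fréchet algebra of matrices with $\sup_{i,j}|a_{ij}|(1+|i-j|)^N<\infty$ for all $N$. Setting. Let $M$ be a closed smooth manifold of dimension $n$ with a Riemannian metric $h$, let $g:M\to M$ be an isometric diffeomorphism and let $\partial g=({}^tdg)^{-1}$ be its action on $T^*M$. Let $\mathrm{Td}$ be a smooth $g$-invariant differential form on $M$ that represents the Todd class of the complexified cotangent bundle $T^*_{\mathbb C}M$. Write $(x,\xi,t,\tau)$ for the points of $T^*M\times\mathbb R^2$, and let $S(T^*M\times\mathbb R^2)=\{|\xi|^2+t^2+\tau^2=1\}$. Forms on this sphere bundle are regarded as forms on the complement of the zero section, induced by the radial projection. Let $\Omega(S(T^*M\times\mathbb R^2),\mathcal S)^{\mathbb Z}$ be the space of smooth $\mathcal S$-valued forms $\omega=(\omega_{ij})$ (sums of forms of all degrees) with $(\partial g\times\mathrm{id})^*\omega_{i,j}=\omega_{i+1,j+1}$, and put $$\tau(\omega)=\int_{S(T^*M\times\mathbb R^2)}[\omega_{00}\,\mathrm{Td}]_{top}.$$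 Let $M_{\mathbb Z}$ be the quotient of $M\times\mathbb R$ by the action of $\mathbb Z$ generated by $(x,t)\mapsto(g(x),t+1)$, with the metric $h+dt^2$. Its unit cosphere bundle is $S^*M_{\mathbb Z}=\{|\xi|^2+\tau^2=1\}/\mathbb Z$, of dimension $2n+1$, where $\mathbb Z$ is generated by $(x,\xi,t,\tau)\mapsto(\partial g(x,\xi),t+1,\tau)$. Let $\mathcal E$ be the flat bundle over $M_{\mathbb Z}$ with fiber $l^2(\mathbb Z)$, the quotient of $M\times\mathbb R\times l^2(\mathbb Z)$ by the action of $\mathbb Z$ generated by $(x,t,u)\mapsto(g(x),t+1,\mathcal T^{-1}u)$, $\mathcal Tu(k)=u(k+1)$. For $R\ge1$ let $\omega_R$ be the $\operatorname{End}\mathcal E$-valued form on $S^*M_{\mathbb Z}$ with the matrix entries $(h_R^*\alpha^i\omega_{ij})|_{S^*M_{\mathbb Z}}$, that is, the pullbacks of $\omega_{ij}$ under $(x,\xi,t,\tau)\mapsto(x,R\xi,t+i,R\tau)$. Let $\operatorname{tr}_{\mathcal E}$ be the trace of operators in $l^2(\mathbb Z)$ and $[\dots]_{top}$ the component of degree $2n+1$.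 Both $S(T^*M\times\mathbb R^2)$ and $S^*M_{\mathbb Z}$ are oriented by the outer normal and the canonical orientation of $T^*M\times\mathbb R^2=T^*(M\times\mathbb R)$. A family $a(R)$, $R\ge1$, of operators in $l^2(\mathbb Z)$ is of order $m\in\mathbb R$ if for each $s\in\mathbb R$ it is bounded from $l^2(\mathbb Z,\mu_{s,R})$ to $l^2(\mathbb Z,\mu_{s-m,R})$, uniformly in $R\ge1$, where $\mu_{s,R}(k)=(k^2+R^2)^s$. Lemma. 1. If $a(R):l^2(\mathbb Z)\to l^2(\mathbb Z)$ is a family of order $m<-1$, then $a(R)$ is of trace class for all $R\ge1$, and $\operatorname{tr}a(R)=O(R^{m+1})$: there is a constant $C$ with $|\operatorname{tr}a(R)|\le CR^{m+1}$ for all $R\ge1$. 2. Let $\omega\in\Omega(S(T^*M\times\mathbb R^2),\mathcal S)^{\mathbb Z}$ and $R\ge1$. Then $[\omega_R\,\mathrm{Td}]_{top}$ takes values in trace class operators on $S^*M_{\mathbb Z}$, its trace, computed on $S^*(M\times\mathbb R)$, is $\mathbb Z$-invariant and so is a form on $S^*M_{\mathbb Z}$, this form is integrable, and $$\int_{S^*M_{\mathbb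 Z}}\operatorname{tr}_{\mathcal E}\bigl[\omega_R\,\mathrm{Td}\bigr]_{top}=\tau(\omega).$$ -/

import Mathlib

open Bundle Manifold ContDiff Set

noncomputable section

namespace ShiftIndex

/-! ### Operator families on sequences and the trace -/

/-- The Hilbert space `l²(ℤ)`. -/
abbrev SeqSpace : Type := lp (fun _ : ℤ => ℂ) 2

/-- The squared norm of `u` in `l²(ℤ, μ_{s,R})`, where `μ_{s,R}(k) = (k² + R²)^s`, as an extended
nonnegative number: it is `∞` exactly if `u` does not lie in this space. -/
def weightedNormSq (s R : ℝ) (u : SeqSpace) : ENNReal :=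
  ∑' k : ℤ, ENNReal.ofReal (‖u k‖ ^ 2 * ((k : ℝ) ^ 2 + R ^ 2) ^ s)

/-- The family `a(R)`, `R ≥ 1`, of linear operators in `l²(ℤ)` is of order `m`: for each fixed `s` it
is bounded from `l²(ℤ, μ_{s,R})` to `l²(ℤ, μ_{s-m,R})`, uniformly in `R ≥ 1`. -/
def IsFamilyOfOrder (m : ℝ) (a : ℝ → SeqSpace →ₗ[ℂ] SeqSpace) : Prop :=
  ∀ s : ℝ, ∃ C : ℝ, 0 < C ∧ ∀ R : ℝ, 1 ≤ R → ∀ u : SeqSpace,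
    weightedNormSq (s - m) R (a R u) ≤ ENNReal.ofReal C * weightedNormSq s R u

/-- `T` is of trace class: it is a sum `∑ ⟨x_k, ·⟩ y_k` of operators of rank one with
`∑ ‖x_k‖ ‖y_k‖ < ∞`. (Such an operator is automatically bounded.) -/
def IsTraceClass (T : SeqSpace →ₗ[ℂ] SeqSpace) : Prop :=
  ∃ x y : ℕ → SeqSpace, Summable (fun k => ‖x k‖ * ‖y k‖) ∧
    ∀ u : SeqSpace, HasSum (fun k => inner ℂ (x k) u • y k) (T u)

/-- The matrix of an operator in the standard orthonormal basis `e_k`. -/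
def matrixOf (T : SeqSpace →ₗ[ℂ] SeqSpace) : Matrix ℤ ℤ ℂ :=
  fun i j => T (lp.single 2 j (1 : ℂ)) i

/-- The sum of the diagonal entries of a matrix. -/
def matrixTrace (A : Matrix ℤ ℤ ℂ) : ℂ := ∑' k : ℤ, A k k

/-- The trace of a trace class operator in `l²(ℤ)`. -/
def opTrace (T : SeqSpace →ₗ[ℂ] SeqSpace) : ℂ := matrixTrace (matrixOf T)

/-! ### Differential forms

A complex differential form (a sum of homogeneous forms of all degrees) on a manifold `N` assigns to
`p : N` an element of the complex exterior algebra of the complexified cotangent space at `p`. -/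

/-- The exterior algebra of the complexification `Hom_ℝ(V, ℂ)` of the dual of `V`. -/
abbrev FormAlg (V : Type*) [AddCommGroup V] [Module ℝ V] [TopologicalSpace V] : Type _ :=
  ExteriorAlgebra ℂ (V →L[ℝ] ℂ)

/-- `ξ ↦ ξ ∘ A` on complexified covectors. -/
def precomp {V W : Type*} [AddCommGroup V] [Module ℝ V] [TopologicalSpace V]
    [AddCommGroup W] [Module ℝ W] [TopologicalSpace W] (A : V →L[ℝ] W) :
    (W →L[ℝ] ℂ) →ₗ[ℂ] (V →L[ℝ] ℂ) where
  toFun ξ := ξ.comp A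
  map_add' _ _ := rfl
  map_smul' _ _ := rfl

/-- The value on the vectors `v 0, …, v (k-1)` of the component of degree `k`; it is normalized by
`(ξ_0 ∧ … ∧ ξ_{k-1})(v_0, …, v_{k-1}) = det (ξ_i (v_j))`. -/
def formEval {V : Type*} [AddCommGroup V] [Module ℝ V] [TopologicalSpace V] {k : ℕ}
    (v : Fin k → V) : FormAlg V →ₗ[ℂ] ℂ :=
  ExteriorAlgebra.liftAlternating (Pi.single k
    ((Matrix.detRowAlternating (n := Fin k) (R := ℂ)).compLinearMap
      (LinearMap.pi fun j =>
        { toFun := fun ξ : V →L[ℝ] ℂ => ξ (v j)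
          map_add' := fun _ _ => rfl
          map_smul' := fun _ _ => rfl })))

section Pullback

variable {E₁ H₁ N₁ E₂ H₂ N₂ : Type*} [NormedAddCommGroup E₁] [NormedSpace ℝ E₁]
  [TopologicalSpace H₁] [TopologicalSpace N₁] [ChartedSpace H₁ N₁]
  [NormedAddCommGroup E₂] [NormedSpace ℝ E₂]
  [TopologicalSpace H₂] [TopologicalSpace N₂] [ChartedSpace H₂ N₂]

/-- The pullback `f^* w` of a differential form. -/
def formPullback (I₁ : ModelWithCorners ℝ E₁ H₁) (I₂ : ModelWithCorners ℝ E₂ H₂) (f : N₁ → N₂)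
    (w : ∀ q : N₂, FormAlg (TangentSpace I₂ q)) (p : N₁) : FormAlg (TangentSpace I₁ p) :=
  ExteriorAlgebra.map (precomp (mfderiv I₁ I₂ f p)) (w (f p))

end Pullback

/-! ### The geometric setting

`M` is a closed manifold of dimension `n`, with a Riemannian metric `h` and an isometry `g`. -/

/-- The model space of `M`. -/
abbrev Euc (n : ℕ) : Type := EuclideanSpace ℝ (Fin n)

section Geometry

variable {n : ℕ} {M : Type*} [TopologicalSpace M] [ChartedSpace (Euc n) M] [IsManifold (𝓡 n) ∞ M]

/-- Smooth Riemannian metrics on `M`. -/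
abbrev Metric (n : ℕ) (M : Type*) [TopologicalSpace M] [ChartedSpace (Euc n) M]
    [IsManifold (𝓡 n) ∞ M] : Type _ :=
  ContMDiffRiemannianMetric (𝓡 n) ∞ (Euc n) (fun x : M => TangentSpace (𝓡 n) x)

/-- The diffeomorphism `g` preserves the metric `h`. -/
def Preserves (g : M ≃ₘ^∞⟮𝓡 n, 𝓡 n⟯ M) (h : Metric n M) : Prop :=
  ∀ (x : M) (v w : TangentSpace (𝓡 n) x),
    h.inner (g x) (mfderiv (𝓡 n) (𝓡 n) g x v) (mfderiv (𝓡 n) (𝓡 n) g x w) = h.inner x v w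

/-- The cotangent bundle `T*M`; its points are pairs `⟨x, ξ⟩`. -/
abbrev Cotangent (n : ℕ) (M : Type*) [TopologicalSpace M] [ChartedSpace (Euc n) M]
    [IsManifold (𝓡 n) ∞ M] : Type _ :=
  TotalSpace (Euc n →L[ℝ] ℝ) (fun x : M => TangentSpace (𝓡 n) x →L[ℝ] ℝ)

/-- The manifold `T*M × ℝ²`, that is `T*(M × ℝ)`; its points are `(⟨x, ξ⟩, t, τ)`. -/
abbrev Ambient (n : ℕ) (M : Type*) [TopologicalSpace M] [ChartedSpace (Euc n) M]
    [IsManifold (𝓡 n) ∞ M] : Type _ :=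
  Cotangent n M × ℝ × ℝ

/-- The model with corners (without boundary) of `T*M × ℝ²`. -/
abbrev ambientModel (n : ℕ) :=
  ((𝓡 n).prod 𝓘(ℝ, Euc n →L[ℝ] ℝ)).prod (𝓘(ℝ, ℝ).prod 𝓘(ℝ, ℝ))

/-- The squared length `|ξ|²` of a covector at `x` in the dual metric: `|ξ|² = ξ(v)`, where `v` is the
vector with `h(v, ·) = ξ`. -/
def covectorNormSq (h : Metric n M) (p : Cotangent n M) : ℝ :=
  p.2 ((h.inner p.1).inverse p.2)

/-- The action `∂g = (ᵗdg)⁻¹` of `g` on `T*M`. -/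
def codifferential (g : M ≃ₘ^∞⟮𝓡 n, 𝓡 n⟯ M) (p : Cotangent n M) : Cotangent n M :=
  ⟨g p.1, p.2.comp (mfderiv (𝓡 n) (𝓡 n) g p.1).inverse⟩

/-- `∂g` acting on `T*M × ℝ²`, trivially in the variables `t, τ`. -/
def codifferentialAmbient (g : M ≃ₘ^∞⟮𝓡 n, 𝓡 n⟯ M) (q : Ambient n M) : Ambient n M :=
  (codifferential g q.1, q.2)

/-- The generator `(x, ξ, t, τ) ↦ (∂g(x, ξ), t + 1, τ)` of the action of `ℤ` on
`T*(M × ℝ) = T*M × ℝ²` whose quotient is `T*M_ℤ`. -/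
def deck (g : M ≃ₘ^∞⟮𝓡 n, 𝓡 n⟯ M) (q : Ambient n M) : Ambient n M :=
  (codifferential g q.1, q.2.1 + 1, q.2.2)

/-- The radius `(|ξ|² + t² + τ²)^{1/2}`; the unit level set is `S(T*M × ℝ²)`. -/
def sphereRadius (h : Metric n M) (q : Ambient n M) : ℝ :=
  √(covectorNormSq h q.1 + q.2.1 ^ 2 + q.2.2 ^ 2)

/-- The radial projection onto `S(T*M × ℝ²)`. -/
def sphereProj (h : Metric n M) (q : Ambient n M) : Ambient n M :=
  (⟨q.1.1, (sphereRadius h q)⁻¹ • q.1.2⟩, (sphereRadius h q)⁻¹ * q.2.1, (sphereRadius h q)⁻¹ * q.2.2)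

/-- The length `(|ξ|² + τ²)^{1/2}` of the covector `(ξ, τ)` at the point `(x, t)` of `M × ℝ` in the
metric `h + dt²`; the unit level set is the cosphere bundle `S*(M × ℝ)`. -/
def cosphereRadius (h : Metric n M) (q : Ambient n M) : ℝ :=
  √(covectorNormSq h q.1 + q.2.2 ^ 2)

/-- The projection `(x, ξ, t, τ) ↦ (x, ξ/r, t, τ/r)`, `r = (|ξ|² + τ²)^{1/2}`, onto `S*(M × ℝ)`. -/
def cosphereProj (h : Metric n M) (q : Ambient n M) : Ambient n M :=
  (⟨q.1.1, (cosphereRadius h q)⁻¹ • q.1.2⟩, q.2.1, (cosphereRadius h q)⁻¹ * q.2.2)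

/-- The mapping `(x, ξ, t, τ) ↦ (x, Rξ, t + i, Rτ)`: first `h_R`, then the `i`-th power of
`(x, ξ, t, τ) ↦ (x, ξ, t + 1, τ)`. -/
def scaleShift (R : ℝ) (i : ℤ) (q : Ambient n M) : Ambient n M :=
  (⟨q.1.1, R • q.1.2⟩, q.2.1 + i, R * q.2.2)

/-! ### Canonical coordinates -/

/-- The space of coordinates `(x, ξ, t, τ)` on `T*M × ℝ²`. -/
abbrev Coord (n : ℕ) : Type := Euc n × Euc n × ℝ × ℝ

/-- The canonical parametrization of `T*M × ℝ²` over the chart `φ` of `M` at `a`: the coordinates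
`(x, ξ, t, τ)` give the covector `∑ ξ_k dφ^k` at the point `φ⁻¹(x)`. -/
def param (a : M) (z : Coord n) : Ambient n M :=
  (⟨(extChartAt (𝓡 n) a).symm z.1,
    (innerSL ℝ z.2.1).comp
      (mfderiv (𝓡 n) 𝓘(ℝ, Euc n) (extChartAt (𝓡 n) a) ((extChartAt (𝓡 n) a).symm z.1))⟩,
    z.2.2.1, z.2.2.2)

/-- The vectors `∂/∂x¹, ∂/∂ξ₁, …, ∂/∂xⁿ, ∂/∂ξₙ, ∂/∂t, ∂/∂τ`, in this order. They define the
canonical orientation of `T*M × ℝ² = T*(M × ℝ)`, which does not depend on the chart of `M`. -/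
def frame (n : ℕ) (k : Fin (2 * n + 2)) : Coord n :=
  if hk : k.val / 2 < n then
    if k.val % 2 = 0 then (EuclideanSpace.single ⟨k.val / 2, hk⟩ 1, 0, 0, 0)
    else (0, EuclideanSpace.single ⟨k.val / 2, hk⟩ 1, 0, 0)
  else if k.val % 2 = 0 then (0, 0, 1, 0) else (0, 0, 0, 1)

/-! ### Forms on `S(T*M × ℝ²)` with values in the algebra `𝒮`

Forms on the sphere bundle are treated as forms on the complement of the zero section of `T*M × ℝ²`
which are induced by the radial projection. -/

/-- A form on `T*M × ℝ²` whose values are infinite matrices. -/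
abbrev MatrixForm (n : ℕ) (M : Type*) [TopologicalSpace M] [ChartedSpace (Euc n) M]
    [IsManifold (𝓡 n) ∞ M] : Type _ :=
  ∀ q : Ambient n M, Matrix ℤ ℤ (FormAlg (TangentSpace (ambientModel n) q))

/-- A function `f` on an open set `D` is a smooth function with values in the Fréchet algebra `𝒮` of
matrices `(a_ij)` such that all seminorms `sup_ij |a_ij| (1 + |i - j|)^N` are finite: the coefficients
are smooth, and each seminorm of each derivative is bounded on each compact subset of `D`. -/
def SmoothRapid {Z : Type*} [NormedAddCommGroup Z] [NormedSpace ℝ Z] (D : Set Z)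
    (f : Z → Matrix ℤ ℤ ℂ) : Prop :=
  (∀ i j, ContDiffOn ℝ ∞ (fun z => f z i j) D) ∧
  ∀ K : Set Z, K ⊆ D → IsCompact K → ∀ r N : ℕ, ∃ C : ℝ, ∀ z ∈ K, ∀ i j : ℤ,
    ‖iteratedFDeriv ℝ r (fun z => f z i j) z‖ * (1 + |(i : ℝ) - j|) ^ N ≤ C

/-- `w` is an element of `Ω(S(T*M × ℝ²), 𝒮)^ℤ`. -/
structure IsInvariantSphereForm (h : Metric n M) (g : M ≃ₘ^∞⟮𝓡 n, 𝓡 n⟯ M)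
    (w : MatrixForm n M) : Prop where
  /-- In canonical coordinates, the coefficients of `w` are smooth `𝒮`-valued functions outside the
  zero section. -/
  smooth : ∀ (a : M) (k : ℕ) (v : Fin k → Coord n),
    SmoothRapid {z : Coord n | z.1 ∈ (extChartAt (𝓡 n) a).target ∧ z.2 ≠ 0}
      (fun z i j => formEval v
        (formPullback 𝓘(ℝ, Coord n) (ambientModel n) (param a) (fun q => w q i j) z))
  /-- `w` is induced by a form on the sphere bundle. -/
  radial : ∀ q : Ambient n M, sphereRadius h q ≠ 0 → ∀ i j : ℤ,
    formPullback (ambientModel n) (ambientModel n) (sphereProj h) (fun q => w q i j) q = w q i j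
  /-- `w` is `ℤ`-invariant: `(∂g)^* w_{i,j} = w_{i+1,j+1}`. -/
  invariant : ∀ q : Ambient n M, sphereRadius h q ≠ 0 → ∀ i j : ℤ,
    formPullback (ambientModel n) (ambientModel n) (codifferentialAmbient g)
      (fun q => w q i j) q = w q (i + 1) (j + 1)

/-! ### The Todd class -/

/-- Differential forms on `M`. -/
abbrev BaseForm (n : ℕ) (M : Type*) [TopologicalSpace M] [ChartedSpace (Euc n) M] : Type _ :=
  ∀ x : M, FormAlg (TangentSpace (𝓡 n) x)

/-- A form on `M` in the chart at `a`. -/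
def inChart (θ : BaseForm n M) (a : M) : ∀ y : Euc n, FormAlg (TangentSpace 𝓘(ℝ, Euc n) y) :=
  formPullback 𝓘(ℝ, Euc n) (𝓡 n) (extChartAt (𝓡 n) a).symm θ

/-- Smoothness of a form on `M`. -/
def IsSmoothForm (θ : BaseForm n M) : Prop :=
  ∀ (a : M) (k : ℕ) (v : Fin k → Euc n),
    ContDiffOn ℝ ∞ (fun y => formEval (V := Euc n) v (inChart θ a y)) (extChartAt (𝓡 n) a).target

/-- `η = dβ` for some smooth form `β`; the exterior derivative is evaluated in charts, on constant
vector fields. -/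
def IsExactForm (η : BaseForm n M) : Prop :=
  ∃ β : BaseForm n M, IsSmoothForm β ∧
    ∀ (a : M), ∀ y ∈ (extChartAt (𝓡 n) a).target,
      formEval (V := Euc n) (![] : Fin 0 → Euc n) (inChart η a y) = 0 ∧
      ∀ (k : ℕ) (v : Fin (k + 1) → Euc n),
        formEval (V := Euc n) v (inChart η a y) =
          ∑ l : Fin (k + 1), (-1 : ℂ) ^ (l : ℕ) *
            fderiv ℝ (fun y' => formEval (V := Euc n) (fun m => v (l.succAbove m))
              (inChart β a y')) y (v l)

/-- The partial derivative of a function on `ℝⁿ`. -/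
def partialDeriv (i : Fin n) (f : Euc n → ℝ) (y : Euc n) : ℝ :=
  fderiv ℝ f y (EuclideanSpace.single i 1)

/-- The matrix of the metric in the chart at `a`. -/
def metricMatrix (h : Metric n M) (a : M) (y : Euc n) : Matrix (Fin n) (Fin n) ℝ := fun i j =>
  h.inner ((extChartAt (𝓡 n) a).symm y)
    (mfderiv 𝓘(ℝ, Euc n) (𝓡 n) (extChartAt (𝓡 n) a).symm y
      (EuclideanSpace.single i (1 : ℝ) : Euc n))
    (mfderiv 𝓘(ℝ, Euc n) (𝓡 n) (extChartAt (𝓡 n) a).symm y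
      (EuclideanSpace.single j (1 : ℝ) : Euc n))

/-- The Christoffel symbol `Γ^k_{ij}` of the Levi-Civita connection in the chart at `a`. -/
def christoffel (h : Metric n M) (a : M) (k i j : Fin n) (y : Euc n) : ℝ :=
  (1 / 2) * ∑ l, (metricMatrix h a y)⁻¹ k l *
    (partialDeriv i (fun y => metricMatrix h a y j l) y
      + partialDeriv j (fun y => metricMatrix h a y i l) y
      - partialDeriv l (fun y => metricMatrix h a y i j) y)

/-- The coefficient `R^k_{l i j}` of the curvature: `R(∂_i, ∂_j) ∂_l = ∑_k R^k_{l i j} ∂_k`. -/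
def riemannCoeff (h : Metric n M) (a : M) (k l i j : Fin n) (y : Euc n) : ℝ :=
  partialDeriv i (christoffel h a k j l) y - partialDeriv j (christoffel h a k i l) y
    + ∑ m, (christoffel h a k i m y * christoffel h a m j l y
      - christoffel h a k j m y * christoffel h a m i l y)

/-- The coordinate covector `dx^i` at `x`, in the chart at `x`. -/
def coordCovector (x : M) (i : Fin n) : FormAlg (TangentSpace (𝓡 n) x) :=
  ExteriorAlgebra.ι ℂ (Complex.ofRealCLM.comp
    ((EuclideanSpace.proj i : Euc n →L[ℝ] ℝ).comp
      (mfderiv (𝓡 n) 𝓘(ℝ, Euc n) (extChartAt (𝓡 n) x) x)))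

/-- The curvature matrix (with entries forms of degree two) at `x` of the connection on `T*M` which is
dual to the Levi-Civita connection: it is minus the transpose of the matrix
`(1/2) ∑_{i,j} R^k_{l i j} dx^i ∧ dx^j`. -/
def cotangentCurvature (h : Metric n M) (x : M) :
    Matrix (Fin n) (Fin n) (FormAlg (TangentSpace (𝓡 n) x)) := fun l k =>
  -((1 / 2 : ℂ) • ∑ i, ∑ j,
    ((riemannCoeff h x k l i j (extChartAt (𝓡 n) x x) : ℝ) : ℂ) •
      (coordCovector x i * coordCovector x j))

/-- The Chern–Weil form `det (Y / (1 - e^{-Y}))`, `Y = (i / 2π) F`, of the Todd class of the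
complexified cotangent bundle, where `F` is the curvature. It is written as
`exp (-∑_{k ≥ 1} B_k / (k · k!) · tr Y^k)` with the Bernoulli numbers `B_k` (`B_1 = -1/2`), which is the
expansion of `log (y / (1 - e^{-y}))`; both series terminate for reasons of degree. -/
def toddChernWeil (h : Metric n M) : BaseForm n M := fun x =>
  ∑ m ∈ Finset.range (n + 1), ((m.factorial : ℂ)⁻¹) •
    (∑ k ∈ Finset.Icc 1 n,
      (-((bernoulli k : ℚ) : ℂ) / ((k : ℂ) * (k.factorial : ℂ)) *
        (Complex.I / (2 * (Real.pi : ℂ))) ^ k) •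
        Matrix.trace (cotangentCurvature h x ^ k)) ^ m

/-- `θ` is a smooth form on `M` that represents the Todd class of the complexified cotangent bundle and
is invariant under `g`. -/
structure IsToddForm (h : Metric n M) (g : M ≃ₘ^∞⟮𝓡 n, 𝓡 n⟯ M) (θ : BaseForm n M) : Prop where
  smooth : IsSmoothForm θ
  represents : IsExactForm (fun x => θ x - toddChernWeil h x)
  invariant : ∀ x : M, formPullback (𝓡 n) (𝓡 n) g θ x = θ x

/-- A form on `M`, lifted to `T*M × ℝ²`. -/
def liftBase (θ : BaseForm n M) (q : Ambient n M) : FormAlg (TangentSpace (ambientModel n) q) :=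
  formPullback (ambientModel n) (𝓡 n) (fun q : Ambient n M => q.1.1) θ q

/-! ### Integration over hypersurfaces -/

/-- A form of degree `2n + 1` on `T*M × ℝ²`, given by its values on tuples of tangent vectors. -/
abbrev HypersurfaceForm (n : ℕ) (M : Type*) [TopologicalSpace M] [ChartedSpace (Euc n) M]
    [IsManifold (𝓡 n) ∞ M] : Type _ :=
  ∀ q : Ambient n M, (Fin (2 * n + 1) → TangentSpace (ambientModel n) q) → ℂ

section Integration

variable [CompactSpace M] [T2Space M]

variable (n M) in
/-- A smooth partition of unity on `M` subordinate to the charts. -/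
def chartPartition : SmoothPartitionOfUnity M (𝓡 n) M univ :=
  (SmoothPartitionOfUnity.exists_isSubordinate_chartAt_source (𝓡 n) M).choose

/-- The density, in the canonical coordinates over the chart at `a`, of the form
`χ_a · dρ ∧ p^* η` of degree `2n + 2`, where `χ_a` belongs to the partition of unity. -/
def collarDensity (ρ : Ambient n M → ℝ) (p : Ambient n M → Ambient n M) (η : HypersurfaceForm n M)
    (a : M) (z : Coord n) : ℂ :=
  (chartPartition n M a ((extChartAt (𝓡 n) a).symm z.1) : ℂ) *
    ∑ k : Fin (2 * n + 2), (-1 : ℂ) ^ (k : ℕ) *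
      (fderiv ℝ (fun z => ρ (param a z)) z (frame n k) : ℂ) *
      η (p (param a z)) (fun l =>
        mfderiv 𝓘(ℝ, Coord n) (ambientModel n) (fun z => p (param a z)) z
          (frame n (k.succAbove l)))

/-- The part of the collar `1 < ρ < 2` with `t ∈ J`, in the canonical coordinates over the chart
at `a`. -/
def collar (ρ : Ambient n M → ℝ) (J : Set ℝ) (a : M) : Set (Coord n) :=
  {z | z.1 ∈ (extChartAt (𝓡 n) a).target ∧ z.2.2.1 ∈ J ∧ ρ (param a z) ∈ Ioo 1 2}

/-- The integral of `η` over the part of the hypersurface `S = {ρ = 1}` with `t ∈ J`, where `p` is the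
projection onto `S` along rays on which `ρ` grows, and `S` is oriented by its outer normal (put first)
and the canonical orientation of `T*M × ℝ²`. The mapping `q ↦ (ρ(q), p(q))` identifies the collar
`{1 < ρ < 2}` with `(1, 2) × S`, so that the integral of `η` over `S` is the integral of
`dρ ∧ p^* η` over the collar. The latter is computed in canonical coordinates with the partition of
unity. -/
def hypersurfaceIntegral (ρ : Ambient n M → ℝ) (p : Ambient n M → Ambient n M) (J : Set ℝ)
    (η : HypersurfaceForm n M) : ℂ :=
  ∑ᶠ a : M, ∫ z in collar ρ J a, collarDensity ρ p η a z

/-- The integral above converges absolutely. -/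
def HypersurfaceIntegrable (ρ : Ambient n M → ℝ) (p : Ambient n M → Ambient n M) (J : Set ℝ)
    (η : HypersurfaceForm n M) : Prop :=
  ∀ a : M, MeasureTheory.IntegrableOn (collarDensity ρ p η a) (collar ρ J a)

/-- The integral over the sphere bundle `S(T*M × ℝ²)`. -/
def sphereIntegral (h : Metric n M) (η : HypersurfaceForm n M) : ℂ :=
  hypersurfaceIntegral (sphereRadius h) (sphereProj h) univ η

/-- The integral over `S*M_ℤ = S*(M × ℝ)/ℤ` of a form which is given by its lift to `S*(M × ℝ)`. The
points of `S*(M × ℝ)` with `0 ≤ t < 1` are a fundamental domain for the action of `ℤ`. -/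
def mappingTorusIntegral (h : Metric n M) (η : HypersurfaceForm n M) : ℂ :=
  hypersurfaceIntegral (cosphereRadius h) (cosphereProj h) (Ico 0 1) η

/-- The integral over `S*M_ℤ` converges absolutely. -/
def MappingTorusIntegrable (h : Metric n M) (η : HypersurfaceForm n M) : Prop :=
  HypersurfaceIntegrable (cosphereRadius h) (cosphereProj h) (Ico 0 1) η

/-- The functional `τ(w) = ∫_{S(T*M × ℝ²)} [w_{00} Td]_top`. -/
def cycleTrace (h : Metric n M) (θ : BaseForm n M) (w : MatrixForm n M) : ℂ :=
  sphereIntegral h (fun q v => formEval v (w q 0 0 * liftBase θ q))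

end Integration

/-! ### The family `w_R` -/

/-- The lift to `T*(M × ℝ)` of the `End 𝓔`-valued form `w_R = {h_R^* α^i w_{ij}}`. (The pullback along
`scaleShift R i` is `h_R^* α^i`.) -/
def familyForm (R : ℝ) (w : MatrixForm n M) : MatrixForm n M := fun q i j =>
  formPullback (ambientModel n) (ambientModel n) (scaleShift R i) (fun q => w q i j) q

/-- The matrix of the values of the component of degree `2n + 1` of `w_R Td`. -/
def topMatrix (R : ℝ) (w : MatrixForm n M) (θ : BaseForm n M) (q : Ambient n M)
    (v : Fin (2 * n + 1) → TangentSpace (ambientModel n) q) : Matrix ℤ ℤ ℂ := fun i j =>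
  formEval v (familyForm R w q i j * liftBase θ q)

/-- The form `tr_𝓔 [w_R Td]_top`. -/
def traceForm (R : ℝ) (w : MatrixForm n M) (θ : BaseForm n M) : HypersurfaceForm n M := fun q v =>
  matrixTrace (topMatrix R w θ q v)

end Geometry

end ShiftIndex

end

open ShiftIndex

/-! Part 1. Order m, used with s = 0 only, says that the k-th coordinate functional of a(R) has norm
at most √C (k² + R²)^{m/2}. For m < -1 these norms are summable, so a(R) is an absolutely convergent
sum of operators of rank one, and |tr a(R)| is at most the sum of the norms. Comparison with an
integral bounds this sum by a multiple of R^{m+1} (`isTraceClass_and_opTrace_le`).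

Part 2, trace class. As |i| → ∞, the radial projection of (x, Rξ, t + i, Rτ) tends to a pole ξ = τ =
0 of the sphere. A form induced from the sphere bundle has the same pullback under two mappings with
the same radial projection (`pull_prodForm_congr`), so t + i may be normalized to ±1 by a fiberwise
rescaling. With ε = |t + i|⁻¹, the differential then sends a vector to X + εY ± ε²Z, where X is a
vector along the n-dimensional base. If n ≥ 1, a form of degree 2n + 1 vanishes as soon as 2n of its
arguments are of type X, so every surviving term contains ε². If n = 0, then X = 0, and tangency to
the cosphere bundle gives Y = 0. Hence row i is O(i⁻²), together with decay off the diagonal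
(`exists_summable_bound`), and the matrix is that of a trace class operator
(`exists_isTraceClass_of_matrix`).

Part 2, invariance. The deck transformation followed by the i-th shift is the (i+1)-st shift
followed by ∂g (`scaleShift_deck`). By invariance of w and Td it therefore moves the diagonal
entries by one place, which does not change the trace (`traceForm_deck`).

Part 2, integral. The trace is the sum over i of the pullbacks of w_{ii} Td under the i-th shift.
Since ∂g preserves lengths, fixes t and commutes with scaling and shift, the integral over 0 ≤ t < 1
of the i-th term is unchanged if w_{ii} is replaced by w_{00} (`integral_cosDensity_eq`). The i-th
shift, followed by radial projection, maps the part 0 ≤ t < 1 of the cosphere bundle bijectively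
onto the sector i ≤ R t / |(ξ, τ)| < i + 1 of the sphere bundle (`image_sphereMap`,
`integral_sphereMap`). The sectors are disjoint and cover all but a null set (`hasSum_of_sectors`),
so the terms add up to τ(w). The same computation with norms justifies the exchange of sum and
integral.

Integrals over hypersurfaces are integrals over collars 1 < ρ < 2 in canonical coordinates. The
mappings above are therefore extended to collars so that they respect the radii. Top forms and
Lebesgue measure then transform by the same determinant, which is 1 for ∂g (`det_fderiv_transC`) and
positive for the mapping to the sphere (`hasFDerivAt_sphereMap`). -/

noncomputable section

namespace ShiftIndex

set_option linter.unusedSectionVars false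

/-! ### Algebra of forms -/

section Algebra

variable {U V W : Type*} [AddCommGroup U] [Module ℝ U] [TopologicalSpace U]
  [AddCommGroup V] [Module ℝ V] [TopologicalSpace V]
  [AddCommGroup W] [Module ℝ W] [TopologicalSpace W]

/-- Pullback of forms under a linear map. -/
def pull (A : V →L[ℝ] W) : FormAlg W →ₐ[ℂ] FormAlg V := ExteriorAlgebra.map (precomp A)

theorem pull_comp (B : V →L[ℝ] W) (A : U →L[ℝ] V) (α : FormAlg W) :
    pull (B.comp A) α = pull A (pull B α) := by
  have h := ExteriorAlgebra.map_comp_map (precomp B) (precomp A)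
  exact (AlgHom.congr_fun h α).symm

theorem pull_ι (A : V →L[ℝ] W) (ξ : W →L[ℝ] ℂ) :
    pull A (ExteriorAlgebra.ι ℂ ξ) = ExteriorAlgebra.ι ℂ (ξ.comp A) :=
  ExteriorAlgebra.map_apply_ι _ _

/-- The alternating map `(ξ_i) ↦ det (ξ_i (v_j))`. -/
def evalAlt {k : ℕ} (v : Fin k → V) : (V →L[ℝ] ℂ) [⋀^Fin k]→ₗ[ℂ] ℂ :=
  (Matrix.detRowAlternating (n := Fin k) (R := ℂ)).compLinearMap
      (LinearMap.pi fun j =>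
        { toFun := fun ξ : V →L[ℝ] ℂ => ξ (v j)
          map_add' := fun _ _ => rfl
          map_smul' := fun _ _ => rfl })

theorem evalAlt_apply {k : ℕ} (v : Fin k → V) (ξ : Fin k → (V →L[ℝ] ℂ)) :
    evalAlt v ξ = Matrix.det (Matrix.of fun i j => ξ i (v j)) := rfl

theorem formEval_eq {k : ℕ} (v : Fin k → V) :
    formEval v = ExteriorAlgebra.liftAlternating (Pi.single k (evalAlt v)) := rfl

theorem formEval_ιMulti {k : ℕ} (v : Fin k → V) (ξ : Fin k → (V →L[ℝ] ℂ)) :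
    formEval v (ExteriorAlgebra.ιMulti ℂ k ξ) = Matrix.det (Matrix.of fun i j => ξ i (v j)) := by
  rw [formEval_eq, ExteriorAlgebra.liftAlternating_apply_ιMulti, Pi.single_eq_same, evalAlt_apply]

theorem formEval_ιMulti_of_ne {k m : ℕ} (hm : m ≠ k) (v : Fin k → V)
    (ξ : Fin m → (V →L[ℝ] ℂ)) : formEval v (ExteriorAlgebra.ιMulti ℂ m ξ) = 0 := by
  rw [formEval_eq, ExteriorAlgebra.liftAlternating_apply_ιMulti, Pi.single_eq_of_ne hm]
  rfl

/-- Both sides are linear in α, so it suffices to compare them on products of covectors, where they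
are the same determinant. -/
theorem formEval_pull {k : ℕ} (A : V →L[ℝ] W) (v : Fin k → V) (α : FormAlg W) :
    formEval v (pull A α) = formEval (fun i => A (v i)) α := by
  have : (formEval v).comp (pull A).toLinearMap = formEval (fun i => A (v i)) := by
    refine ExteriorAlgebra.lhom_ext fun m => ?_
    ext ξ
    simp only [LinearMap.compAlternatingMap_apply, LinearMap.comp_apply, AlgHom.toLinearMap_apply]
    rw [pull, ExteriorAlgebra.map_apply_ιMulti]
    by_cases hm : m = k
    · subst hm
      rw [formEval_ιMulti, formEval_ιMulti]; rfl
    · rw [formEval_ιMulti_of_ne hm, formEval_ιMulti_of_ne hm]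
  exact LinearMap.congr_fun this α

/-- Evaluation of a fixed form as an alternating map of the vectors. -/
def formAlt {k : ℕ} (α : FormAlg V) : V [⋀^Fin k]→ₗ[ℝ] ℂ where
  toFun v := formEval v α
  map_update_add' := by
    intro inst v i x y
    obtain rfl : inst = instDecidableEqFin k := Subsingleton.elim _ _
    have : evalAlt (Function.update v i (x + y))
        = evalAlt (Function.update v i x) + evalAlt (Function.update v i y) := by
      ext ξ
      simp only [AlternatingMap.add_apply, evalAlt_apply]
      -- Replacing the vector v i changes only the i-th column of the matrix, in which the
      -- determinant is linear.
      have key : ∀ z, (Matrix.of fun a b => ξ a (Function.update v i z b))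
          = (Matrix.of fun a b => ξ a (v b)).updateCol i (fun a => ξ a z) := by
        intro z; ext a b
        by_cases hb : b = i
        · subst hb; simp
        · simp [hb]
      rw [key, key, key, ← Matrix.det_updateCol_add]
      congr 2; ext a; simp
    simp only [formEval_eq, this, Pi.single_add, map_add, LinearMap.add_apply]
  map_update_smul' := by
    intro inst v i c x
    obtain rfl : inst = instDecidableEqFin k := Subsingleton.elim _ _
    have : evalAlt (Function.update v i (c • x)) = (c : ℂ) • evalAlt (Function.update v i x) := by
      ext ξ
      simp only [AlternatingMap.smul_apply, evalAlt_apply]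
      have key : ∀ z, (Matrix.of fun a b => ξ a (Function.update v i z b))
          = (Matrix.of fun a b => ξ a (v b)).updateCol i (fun a => ξ a z) := by
        intro z; ext a b
        by_cases hb : b = i
        · subst hb; simp
        · simp [hb]
      rw [key, key, smul_eq_mul, ← Matrix.det_updateCol_smul]
      congr 2; ext a; simp
    simp only [formEval_eq, this, Pi.single_smul, map_smul, LinearMap.smul_apply]
    rfl
  map_eq_zero_of_eq' := by
    intro v i j hij hne
    have : evalAlt v = 0 := by
      ext ξ
      rw [evalAlt_apply]
      exact Matrix.det_zero_of_column_eq hne (fun a => by simp [hij])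
    simp [formEval_eq, this]

theorem formAlt_apply {k : ℕ} (α : FormAlg V) (v : Fin k → V) : formAlt α v = formEval v α := rfl

/-- Expansion of the exterior product with a covector. -/
theorem formEval_ι_mul {k : ℕ} (v : Fin (k + 1) → V) (ξ : V →L[ℝ] ℂ) (α : FormAlg V) :
    formEval v (ExteriorAlgebra.ι ℂ ξ * α) =
      ∑ i : Fin (k + 1), (-1 : ℂ) ^ (i : ℕ) * ξ (v i) * formEval (fun l => v (i.succAbove l)) α := by
  have : (formEval v).comp (LinearMap.mulLeft ℂ (ExteriorAlgebra.ι ℂ ξ)) =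
      ∑ i : Fin (k + 1), ((-1 : ℂ) ^ (i : ℕ) * ξ (v i)) •
        formEval (fun l => v (i.succAbove l)) := by
    refine ExteriorAlgebra.lhom_ext fun m => ?_
    ext η
    have h1 : ExteriorAlgebra.ι ℂ ξ * ExteriorAlgebra.ιMulti ℂ m η
        = ExteriorAlgebra.ιMulti ℂ (m + 1) (Matrix.vecCons ξ η) := by
      rw [ExteriorAlgebra.ιMulti_succ_apply]; simp
    simp only [LinearMap.compAlternatingMap_apply, LinearMap.comp_apply, LinearMap.mulLeft_apply, h1,
      LinearMap.sum_apply, LinearMap.smul_apply, smul_eq_mul]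
    by_cases hm : m = k
    · subst hm
      -- Laplace expansion along the row of ξ.
      rw [formEval_ιMulti, Matrix.det_succ_row_zero]
      refine Finset.sum_congr rfl fun i _ => ?_
      rw [formEval_ιMulti]; rfl
    · rw [formEval_ιMulti_of_ne (by omega)]
      refine (Finset.sum_eq_zero fun i _ => ?_).symm
      rw [formEval_ιMulti_of_ne hm, mul_zero]
  have h2 := LinearMap.congr_fun this α
  simpa [LinearMap.sum_apply] using h2

end Algebra

/-! ### Forms of top degree and expansions in a dual basis -/

section TopDegree

variable {V : Type*} [NormedAddCommGroup V] [NormedSpace ℝ V] [FiniteDimensional ℝ V]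

/-- A form of top degree is multiplied by the determinant under an endomorphism. -/
theorem formEval_pull_top {k : ℕ} (hk : Module.finrank ℝ V = k) (A : V →L[ℝ] V) (v : Fin k → V)
    (α : FormAlg V) : formEval v (pull A α) = (A.det : ℂ) * formEval v α := by
  let e : Module.Basis (Fin k) ℝ V := Module.finBasisOfFinrankEq ℝ V hk
  -- An alternating map of top degree is determined by its value on a basis; on permutations of the
  -- basis both sides change by the sign.
  have key : ∀ u : Fin k → V, formEval u α = ((e.det u : ℝ) : ℂ) * formEval e α := by
    intro u
    have h : (formAlt α : V [⋀^Fin k]→ₗ[ℝ] ℂ) = (e.det).smulRight (formEval e α : ℂ) := by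
      refine Module.Basis.ext_alternating e fun w hw => ?_
      let σ : Equiv.Perm (Fin k) := Equiv.ofBijective w (Finite.injective_iff_bijective.mp hw)
      change (formAlt α : V [⋀^Fin k]→ₗ[ℝ] ℂ) (e ∘ σ) = e.det (e ∘ σ) • (formEval e α : ℂ)
      rw [AlternatingMap.map_perm, AlternatingMap.map_perm, Module.Basis.det_self, formAlt_apply]
      simp
    have := congrArg (fun f => f u) h
    simpa [formAlt_apply] using this
  rw [formEval_pull, key, key v]
  have h2 := e.det_comp (A : V →ₗ[ℝ] V) v
  have h3 : e.det (fun i => A (v i)) = A.det * e.det v := h2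
  rw [h3]; push_cast; ring

/-- The basis of complexified covectors dual to a basis. -/
def dualBasis {d : ℕ} (b : Module.Basis (Fin d) ℝ V) : Module.Basis (Fin d) ℂ (V →L[ℝ] ℂ) :=
  Module.Basis.ofEquivFun
    { toFun := fun ξ i => ξ (b i)
      map_add' := fun _ _ => rfl
      map_smul' := fun _ _ => rfl
      invFun := fun c => LinearMap.toContinuousLinearMap (b.constr ℝ c)
      left_inv := by
        intro ξ
        apply ContinuousLinearMap.coe_injective
        refine b.ext fun i => ?_
        simp
      right_inv := by
        intro c; ext i; simp }

theorem dualBasis_apply {d : ℕ} (b : Module.Basis (Fin d) ℝ V) (i j : Fin d) :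
    dualBasis b i (b j) = if j = i then 1 else 0 := by
  have h := (dualBasis b).repr_self i
  have h2 : (dualBasis b).equivFun (dualBasis b i) j = dualBasis b i (b j) := rfl
  rw [← h2, Module.Basis.equivFun_self]
  exact if_congr eq_comm rfl rfl

/-- Every form is a combination of finitely many fixed forms, whose coefficients are values of the
form on fixed tuples of vectors. -/
theorem exists_expansion (V : Type*) [NormedAddCommGroup V] [NormedSpace ℝ V]
    [FiniteDimensional ℝ V] :
    ∃ (ι : Type) (_ : Fintype ι) (k : ι → ℕ) (v : ∀ s, Fin (k s) → V) (β : ι → FormAlg V),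
      ∀ α : FormAlg V, α = ∑ s, formEval (v s) α • β s := by
  let b := Module.finBasis ℝ V
  let d := Module.finrank ℝ V
  refine ⟨Finset (Fin d), inferInstance, fun s => s.card,
    fun s i => b (s.orderEmbOfFin rfl i), fun s => (dualBasis b).ExteriorAlgebra s, fun α => ?_⟩
  let B := (dualBasis b).ExteriorAlgebra
  have hB : ∀ t : Finset (Fin d), B t =
      ExteriorAlgebra.ιMulti ℂ t.card (fun i => dualBasis b (t.orderEmbOfFin rfl i)) := by
    intro t
    rw [show B t = _ from ExteriorAlgebra.basis_apply _ t]
    rfl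
  -- Biorthogonality of the monomials in the dual covectors and the increasing tuples of basis
  -- vectors; it makes the coefficients in the basis values of the form.
  have key : ∀ s t : Finset (Fin d), formEval (fun i => b (s.orderEmbOfFin rfl i)) (B t)
      = if t = s then 1 else 0 := by
    intro s t
    rw [hB]
    by_cases hc : t.card = s.card
    swap
    · rw [formEval_ιMulti_of_ne hc, if_neg]
      rintro rfl; exact hc rfl
    -- Reindexing by the equality of cardinalities, so that the degree of the monomial is literally
    -- that of the evaluation.
    have hB' : ExteriorAlgebra.ιMulti ℂ t.card (fun i => dualBasis b (t.orderEmbOfFin rfl i))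
        = ExteriorAlgebra.ιMulti ℂ s.card (fun i => dualBasis b (t.orderEmbOfFin hc i)) := by
      generalize s.card = m at hc
      subst hc; rfl
    rw [hB', formEval_ιMulti]
    simp only [dualBasis_apply]
    split_ifs with h
    · subst h
      rw [show (Matrix.of fun i j : Fin t.card =>
        if t.orderEmbOfFin rfl j = t.orderEmbOfFin hc i then (1 : ℂ) else 0) = 1 from ?_]
      · exact Matrix.det_one
      · ext i j
        simp [Matrix.one_apply, eq_comm]
    -- Different sets of equal size: the basis vector of an index in s but not in t is annihilated
    -- by all covectors of t and gives a zero column.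
    · obtain ⟨x, hxs, hxt⟩ : ∃ x, x ∈ s ∧ x ∉ t := by
        by_contra! hcon
        exact h (Finset.eq_of_subset_of_card_le hcon hc.le).symm
      obtain ⟨k, rfl⟩ : x ∈ Set.range (s.orderEmbOfFin rfl) := by
        rw [Finset.range_orderEmbOfFin]; exact hxs
      refine Matrix.det_eq_zero_of_column_eq_zero k fun i => ?_
      rw [Matrix.of_apply, if_neg]
      intro hcon
      exact hxt (hcon ▸ Finset.orderEmbOfFin_mem t hc i)
  have : (LinearMap.id : FormAlg V →ₗ[ℂ] FormAlg V) =
      ∑ s : Finset (Fin d), (formEval (fun i => b (s.orderEmbOfFin rfl i))).smulRight (B s) := by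
    refine B.ext fun t => ?_
    simp only [LinearMap.id_apply, LinearMap.sum_apply, LinearMap.smulRight_apply, key]
    simp
  have h2 := LinearMap.congr_fun this α
  simpa [LinearMap.sum_apply] using h2

/-- The values of a product of forms are combinations of products of values of the factors. -/
theorem exists_formEval_mul (V : Type*) [NormedAddCommGroup V] [NormedSpace ℝ V]
    [FiniteDimensional ℝ V] :
    ∃ (ι : Type) (_ : Fintype ι) (k : ι → ℕ) (v : ∀ s, Fin (k s) → V),
      ∀ (m : ℕ) (u : Fin m → V), ∃ c : ι → ι → ℂ, ∀ α β : FormAlg V,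
        formEval u (α * β) = ∑ s, ∑ t, c s t * (formEval (v s) α * formEval (v t) β) := by
  obtain ⟨ι, _, k, v, b, hb⟩ := exists_expansion V
  refine ⟨ι, inferInstance, k, v, fun m u => ⟨fun s t => formEval u (b s * b t), fun α β => ?_⟩⟩
  conv_lhs => rw [hb α, hb β]
  simp only [Finset.sum_mul, Finset.mul_sum, map_sum, smul_mul_assoc, mul_smul_comm, map_smul,
    smul_eq_mul]
  rw [Finset.sum_comm]
  refine Finset.sum_congr rfl fun s _ => Finset.sum_congr rfl fun t _ => by ring

end TopDegree

/-! ### Trace class operators on sequences -/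

theorem norm_sq_eq_tsum (u : SeqSpace) : ‖u‖ ^ 2 = ∑' k : ℤ, ‖u k‖ ^ 2 := by
  have h := lp.norm_rpow_eq_tsum (p := 2) (by norm_num) u
  simpa using h

theorem summable_norm_sq (u : SeqSpace) : Summable fun k : ℤ => ‖u k‖ ^ 2 := by
  have h := (lp.memℓp u).summable (by norm_num)
  simpa using h

/-- An operator is of trace class if the norms of its coordinate functionals are summable. -/
theorem isTraceClass_of_rows (T : SeqSpace →ₗ[ℂ] SeqSpace) (f : ℤ → (SeqSpace →L[ℂ] ℂ))
    (hf : Summable fun k => ‖f k‖) (hT : ∀ u k, T u k = f k u) : IsTraceClass T := by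
  let e := Equiv.intEquivNat.symm
  -- The decomposition T = ∑ ⟨f_k, ·⟩ e_k with Riesz representatives of the coordinate functionals,
  -- enumerated by ℕ.
  refine ⟨fun k => (InnerProductSpace.toDual ℂ SeqSpace).symm (f (e k)),
    fun k => lp.single 2 (e k) (1 : ℂ), ?_, fun u => ?_⟩
  · have : ∀ k : ℕ, ‖(InnerProductSpace.toDual ℂ SeqSpace).symm (f (e k))‖ *
        ‖(lp.single 2 (e k) (1 : ℂ) : SeqSpace)‖ = ‖f (e k)‖ := by
      intro k
      rw [LinearIsometryEquiv.norm_map, lp.norm_single (by norm_num), norm_one, mul_one]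
    simp only [this]
    exact (e.summable_iff (f := fun k => ‖f k‖)).mpr hf
  · have h := lp.hasSum_single (p := 2) (by norm_num) (T u)
    have h2 := (e.hasSum_iff (f := fun i => (lp.single 2 i (T u i) : SeqSpace))).mpr h
    refine h2.congr_fun ?_
    intro k
    simp only [Function.comp, InnerProductSpace.toDual_symm_apply, hT]
    rw [← lp.single_smul]
    simp

theorem norm_matrixOf_le (T : SeqSpace →ₗ[ℂ] SeqSpace) (f : ℤ → (SeqSpace →L[ℂ] ℂ))
    (hT : ∀ u k, T u k = f k u) (i j : ℤ) : ‖matrixOf T i j‖ ≤ ‖f i‖ := by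
  rw [matrixOf, hT]
  refine ((f i).le_opNorm _).trans ?_
  rw [lp.norm_single (by norm_num), norm_one, mul_one]

theorem summable_one_add_abs_sub (i : ℤ) :
    Summable fun j : ℤ => ((1 + |(i : ℝ) - j|)⁻¹) ^ 2 := by
  have h := (Real.summable_one_div_int_add_rpow (-(i : ℝ)) 2).mpr (by norm_num)
  refine h.of_norm_bounded_eventually ?_
  -- The index j = i is excluded: the majorant 1/|j - i|² has the default value 0 there.
  have hfin : {j : ℤ | j = i}.Finite := Set.finite_singleton i
  filter_upwards [hfin.compl_mem_cofinite] with j hj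
  have hji : (j : ℝ) - i ≠ 0 := by
    rw [sub_ne_zero]; exact_mod_cast hj
  have h1 : 0 < |(i : ℝ) - j| := by rw [abs_sub_comm]; exact abs_pos.mpr hji
  rw [Real.norm_of_nonneg (by positivity), one_div, ← sub_eq_add_neg, abs_sub_comm (j : ℝ) i]
  rw [Real.rpow_two, inv_pow]
  gcongr
  linarith

theorem tsum_one_add_abs_sub (i : ℤ) :
    ∑' j : ℤ, ((1 + |(i : ℝ) - j|)⁻¹) ^ 2 = ∑' j : ℤ, ((1 + |(j : ℝ)|)⁻¹) ^ 2 := by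
  rw [← (Equiv.subLeft i).tsum_eq]
  simp

/-- A matrix with rapid decay off the diagonal and summable decay of the rows is the matrix of
a trace class operator. -/
theorem exists_isTraceClass_of_matrix (A : Matrix ℤ ℤ ℂ) (m : ℤ → ℝ) (hm : Summable m)
    (h : ∀ i j : ℤ, ‖A i j‖ * (1 + |(i : ℝ) - j|) ≤ m i) :
    ∃ T : SeqSpace →ₗ[ℂ] SeqSpace, IsTraceClass T ∧ matrixOf T = A := by
  have hm0 : ∀ i, 0 ≤ m i := fun i => le_trans (by positivity) (h i i)
  have hA : ∀ i j : ℤ, ‖A i j‖ ^ 2 ≤ m i ^ 2 * ((1 + |(i : ℝ) - j|)⁻¹) ^ 2 := by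
    intro i j
    have hp : 0 < 1 + |(i : ℝ) - j| := by positivity
    have : ‖A i j‖ ≤ m i * (1 + |(i : ℝ) - j|)⁻¹ := by
      rw [← div_eq_mul_inv, le_div_iff₀ hp]; exact h i j
    rw [← mul_pow]
    gcongr
  have hsum : ∀ i, Summable fun j => ‖A i j‖ ^ 2 := fun i =>
    Summable.of_nonneg_of_le (fun j => by positivity) (hA i)
      ((summable_one_add_abs_sub i).mul_left _)
  -- The rows are conjugated because the inner product is conjugate linear in its first argument.
  let r : ℤ → SeqSpace := fun i => ⟨fun j => (starRingEnd ℂ) (A i j), by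
    refine memℓp_gen ?_
    simpa using hsum i⟩
  set S := ∑' j : ℤ, ((1 + |(j : ℝ)|)⁻¹) ^ 2
  have hS : 0 ≤ S := tsum_nonneg fun j => by positivity
  -- The weights of every row have the same sum of squares S, by translation; so the row norms are
  -- summable along with m.
  have hr : ∀ i, ‖r i‖ ≤ m i * √S := by
    intro i
    have : ‖r i‖ ^ 2 ≤ (m i * √S) ^ 2 := by
      rw [norm_sq_eq_tsum, mul_pow, Real.sq_sqrt hS,
        show S = _ from (tsum_one_add_abs_sub i).symm, ← tsum_mul_left]
      refine Summable.tsum_le_tsum (fun j => ?_) (summable_norm_sq _)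
        ((summable_one_add_abs_sub i).mul_left _)
      simpa [r] using hA i j
    exact (pow_le_pow_iff_left₀ (norm_nonneg _) (mul_nonneg (hm0 i) (Real.sqrt_nonneg _))
      two_ne_zero).mp this
  let f : ℤ → (SeqSpace →L[ℂ] ℂ) := fun i => innerSL ℂ (r i)
  have hf : Summable fun i => ‖f i‖ := by
    refine Summable.of_nonneg_of_le (fun _ => norm_nonneg _) (fun i => ?_) (hm.mul_right (√S))
    simpa [f, innerSL_apply_norm] using hr i
  let g : ℤ → (SeqSpace →L[ℂ] SeqSpace) := fun i => (f i).smulRight (lp.single 2 i (1 : ℂ))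
  have hg : Summable g := by
    refine Summable.of_norm_bounded hf (fun i => ?_)
    simp only [g]
    rw [ContinuousLinearMap.norm_smulRight_apply, lp.norm_single (by norm_num), norm_one, mul_one]
  let T : SeqSpace →L[ℂ] SeqSpace := ∑' i, g i
  have hT : ∀ u k, T u k = f k u := by
    intro u k
    have h1 : HasSum (fun i => g i u) (T u) :=
      hg.hasSum.mapL (ContinuousLinearMap.apply ℂ SeqSpace u)
    have h2 : HasSum (fun i => g i u k) (T u k) :=
      h1.mapL (lp.evalCLM ℂ (fun _ : ℤ => ℂ) 2 k)
    refine h2.unique ?_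
    have h3 : ∀ i, i ≠ k → g i u k = 0 := by
      intro i hi
      simp [g, hi.symm]
    have h4 := hasSum_single k h3
    simpa [g] using h4
  refine ⟨T, isTraceClass_of_rows T f hf hT, ?_⟩
  ext i j
  simp only [matrixOf, ContinuousLinearMap.coe_coe]
  rw [hT]
  simp [f, r, lp.inner_single_right]

/-! ### Families of operators of negative order -/

/-- The terms with i ≥ 1 are bounded by the integral of x^m from R on, which gives the factor
1/(-m-1). The term i = 0 is R^m, at most R^{m+1} because R ≥ 1, and gives the summand 1. -/
theorem sum_range_add_rpow_le {m R : ℝ} (hm : m < -1) (hR : 1 ≤ R) (N : ℕ) :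
    ∑ i ∈ Finset.range N, ((i : ℝ) + R) ^ m ≤ (1 + 1 / (-m - 1)) * R ^ (m + 1) := by
  have hR0 : 0 < R := by linarith
  have hRm : R ^ m ≤ R ^ (m + 1) := Real.rpow_le_rpow_of_exponent_le hR (by linarith)
  have hanti : AntitoneOn (fun x : ℝ => x ^ m) (Icc R (R + N)) := by
    intro x hx y hy hxy
    exact Real.rpow_le_rpow_of_nonpos (hR0.trans_le hx.1) hxy (by linarith)
  have h1 := hanti.sum_le_integral
  rw [integral_rpow (Or.inr ⟨by linarith, by
    rw [Set.uIcc_of_le (by linarith [Nat.cast_nonneg (α := ℝ) N])]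
    intro h; linarith [h.1]⟩)] at h1
  have h2 : ((R + N) ^ (m + 1) - R ^ (m + 1)) / (m + 1) ≤ 1 / (-m - 1) * R ^ (m + 1) := by
    have h3 : 0 ≤ (R + N) ^ (m + 1) := by positivity
    rw [show ((R + N) ^ (m + 1) - R ^ (m + 1)) / (m + 1)
      = 1 / (-m - 1) * (R ^ (m + 1) - (R + N) ^ (m + 1)) by
        have : m + 1 ≠ 0 := by linarith
        have : -m - 1 ≠ 0 := by linarith
        field_simp; ring]
    have : 0 ≤ 1 / (-m - 1) := by apply one_div_nonneg.mpr; linarith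
    gcongr
    linarith
  have h4 : ∑ i ∈ Finset.range N, ((i : ℝ) + R) ^ m
      ≤ ∑ i ∈ Finset.range (N + 1), ((i : ℝ) + R) ^ m :=
    Finset.sum_le_sum_of_subset_of_nonneg (Finset.range_mono (by omega))
      (fun _ _ _ => by positivity)
  rw [Finset.sum_range_succ'] at h4
  have h5 : ∑ i ∈ Finset.range N, (((i + 1 : ℕ) : ℝ) + R) ^ m
      = ∑ i ∈ Finset.range N, (R + ((i + 1 : ℕ) : ℝ)) ^ m :=
    Finset.sum_congr rfl fun _ _ => by rw [add_comm]
  rw [h5] at h4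
  simp only [Nat.cast_zero, zero_add] at h4
  nlinarith

/-- This is (x + R)² ≤ 2(x² + R²), raised to the negative power m/2. -/
theorem weight_le {m R : ℝ} (hm : m < -1) (hR : 1 ≤ R) {x y : ℝ} (hx : 0 ≤ x) (hxy : x ≤ |y|) :
    (y ^ 2 + R ^ 2) ^ (m / 2) ≤ 2 ^ (-m / 2) * (x + R) ^ m := by
  have h1 : (x + R) ^ 2 / 2 ≤ y ^ 2 + R ^ 2 := by
    have : x ^ 2 ≤ y ^ 2 := by rw [← sq_abs y]; gcongr
    nlinarith [sq_nonneg (x - R)]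
  have h0 : 0 < x + R := by linarith
  calc (y ^ 2 + R ^ 2) ^ (m / 2) ≤ ((x + R) ^ 2 / 2) ^ (m / 2) :=
        Real.rpow_le_rpow_of_nonpos (by positivity) h1 (by linarith)
    _ = 2 ^ (-m / 2) * (x + R) ^ m := by
        rw [Real.div_rpow (by positivity) (by norm_num), ← Real.rpow_natCast (x + R) 2,
          ← Real.rpow_mul h0.le, neg_div, Real.rpow_neg (by norm_num), div_eq_inv_mul]
        congr 2
        push_cast; ring

/-- The integers are split into n and -(n + 1) with n ≥ 0. Both halves are dominated by the same
series of powers of n + R, hence the factor 2 in K. -/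
theorem summable_weight_and_tsum_le {m : ℝ} (hm : m < -1) :
    ∃ K : ℝ, 0 ≤ K ∧ ∀ R : ℝ, 1 ≤ R → Summable (fun k : ℤ => ((k : ℝ) ^ 2 + R ^ 2) ^ (m / 2)) ∧
      ∑' k : ℤ, ((k : ℝ) ^ 2 + R ^ 2) ^ (m / 2) ≤ K * R ^ (m + 1) := by
  set c : ℝ := 2 ^ (-m / 2)
  have hc : 0 ≤ c := by positivity
  have hd : 0 ≤ 1 + 1 / (-m - 1) := by
    have : 0 ≤ 1 / (-m - 1) := by apply one_div_nonneg.mpr; linarith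
    linarith
  refine ⟨2 * (c * (1 + 1 / (-m - 1))), by positivity, fun R hR => ?_⟩
  have hR0 : 0 < R := by linarith
  have hb1 : ∀ n : ℕ, (((n : ℤ) : ℝ) ^ 2 + R ^ 2) ^ (m / 2) ≤ c * ((n : ℝ) + R) ^ m := by
    intro n
    have h1 : (n : ℝ) ≤ |((n : ℤ) : ℝ)| := by simp
    exact weight_le hm hR (Nat.cast_nonneg n) h1
  have hb2 : ∀ n : ℕ, (((-((n : ℤ) + 1) : ℤ) : ℝ) ^ 2 + R ^ 2) ^ (m / 2)
      ≤ c * ((n : ℝ) + R) ^ m := by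
    intro n
    have h1 : (n : ℝ) ≤ |((-((n : ℤ) + 1) : ℤ) : ℝ)| := by
      have h2 : ((-((n : ℤ) + 1) : ℤ) : ℝ) = -((n : ℝ) + 1) := by push_cast; ring
      rw [h2, abs_neg, abs_of_nonneg (by positivity)]; linarith
    exact weight_le hm hR (Nat.cast_nonneg n) h1
  have hg0 : ∀ n : ℕ, 0 ≤ ((n : ℝ) + R) ^ m := fun n => by positivity
  have hg : Summable fun n : ℕ => ((n : ℝ) + R) ^ m :=
    summable_of_sum_range_le hg0 (sum_range_add_rpow_le hm hR)
  have hgt : ∑' n : ℕ, c * ((n : ℝ) + R) ^ m ≤ c * ((1 + 1 / (-m - 1)) * R ^ (m + 1)) := by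
    rw [tsum_mul_left]
    exact mul_le_mul_of_nonneg_left
      (Real.tsum_le_of_sum_range_le hg0 (sum_range_add_rpow_le hm hR)) hc
  have hpos : ∀ y : ℝ, 0 ≤ (y ^ 2 + R ^ 2) ^ (m / 2) := fun y => by positivity
  have hs1 : Summable fun n : ℕ => (((n : ℤ) : ℝ) ^ 2 + R ^ 2) ^ (m / 2) :=
    Summable.of_nonneg_of_le (fun n => hpos _) hb1 (hg.mul_left c)
  have hs2 : Summable fun n : ℕ => (((-((n : ℤ) + 1) : ℤ) : ℝ) ^ 2 + R ^ 2) ^ (m / 2) :=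
    Summable.of_nonneg_of_le (fun n => hpos _) hb2 (hg.mul_left c)
  let F : ℤ → ℝ := fun k => ((k : ℝ) ^ 2 + R ^ 2) ^ (m / 2)
  change Summable F ∧ ∑' k, F k ≤ _
  refine ⟨Summable.of_nat_of_neg_add_one (f := F) hs1 hs2, ?_⟩
  rw [tsum_of_nat_of_neg_add_one (f := F) hs1 hs2]
  have h1 := (Summable.tsum_le_tsum hb1 hs1 (hg.mul_left c)).trans hgt
  have h2 := (Summable.tsum_le_tsum hb2 hs2 (hg.mul_left c)).trans hgt
  linarith

theorem weightedNormSq_zero {R : ℝ} (u : SeqSpace) :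
    weightedNormSq 0 R u = ENNReal.ofReal (‖u‖ ^ 2) := by
  rw [weightedNormSq, norm_sq_eq_tsum,
    ENNReal.ofReal_tsum_of_nonneg (fun _ => by positivity) (summable_norm_sq u)]
  simp

/-- With s = 0 the source is l² itself, and a single coordinate is bounded by one term of the
weighted norm of the image. -/
theorem IsFamilyOfOrder.norm_apply_le {m : ℝ} {a : ℝ → SeqSpace →ₗ[ℂ] SeqSpace}
    (ha : IsFamilyOfOrder m a) : ∃ C : ℝ, 0 ≤ C ∧ ∀ R : ℝ, 1 ≤ R → ∀ (u : SeqSpace) (k : ℤ),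
      ‖a R u k‖ ≤ C * ((k : ℝ) ^ 2 + R ^ 2) ^ (m / 2) * ‖u‖ := by
  obtain ⟨C, hC, h⟩ := ha 0
  refine ⟨√C, Real.sqrt_nonneg _, fun R hR u k => ?_⟩
  have h1 := h R hR u
  rw [weightedNormSq_zero, ← ENNReal.ofReal_mul hC.le] at h1
  have h2 := (ENNReal.le_tsum (f := fun k : ℤ =>
    ENNReal.ofReal (‖a R u k‖ ^ 2 * ((k : ℝ) ^ 2 + R ^ 2) ^ (0 - m))) k).trans h1
  rw [ENNReal.ofReal_le_ofReal_iff (by positivity)] at h2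
  have hp : 0 < (k : ℝ) ^ 2 + R ^ 2 := by nlinarith
  have h3 : ‖a R u k‖ ^ 2 ≤ (√C * ((k : ℝ) ^ 2 + R ^ 2) ^ (m / 2) * ‖u‖) ^ 2 := by
    rw [mul_pow, mul_pow, Real.sq_sqrt hC.le, ← Real.rpow_natCast (_ ^ (m / 2)) 2,
      ← Real.rpow_mul hp.le]
    have h4 : (((k : ℝ) ^ 2 + R ^ 2) ^ (0 - m)) * ((k : ℝ) ^ 2 + R ^ 2) ^ m = 1 := by
      rw [← Real.rpow_add hp]; simp
    have h5 : m / 2 * ((2 : ℕ) : ℝ) = m := by push_cast; ring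
    rw [h5]
    calc ‖a R u k‖ ^ 2 = ‖a R u k‖ ^ 2 * ((k : ℝ) ^ 2 + R ^ 2) ^ (0 - m)
          * ((k : ℝ) ^ 2 + R ^ 2) ^ m := by rw [mul_assoc, h4, mul_one]
      _ ≤ C * ‖u‖ ^ 2 * ((k : ℝ) ^ 2 + R ^ 2) ^ m := by gcongr
      _ = _ := by ring
  exact (pow_le_pow_iff_left₀ (norm_nonneg _) (by positivity) two_ne_zero).mp h3

theorem isTraceClass_and_opTrace_le {m : ℝ} (a : ℝ → SeqSpace →ₗ[ℂ] SeqSpace) (hm : m < -1)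
    (ha : IsFamilyOfOrder m a) :
    (∀ R : ℝ, 1 ≤ R → IsTraceClass (a R)) ∧
      ∃ C : ℝ, ∀ R : ℝ, 1 ≤ R → ‖opTrace (a R)‖ ≤ C * R ^ (m + 1) := by
  obtain ⟨C, hC, h⟩ := ha.norm_apply_le
  obtain ⟨K, hK, hw⟩ := summable_weight_and_tsum_le hm
  have hrow : ∀ R : ℝ, 1 ≤ R → ∃ f : ℤ → (SeqSpace →L[ℂ] ℂ),
      (∀ k, ‖f k‖ ≤ C * ((k : ℝ) ^ 2 + R ^ 2) ^ (m / 2)) ∧ ∀ u k, a R u k = f k u := by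
    intro R hR
    refine ⟨fun k => LinearMap.mkContinuous
      ((lp.evalCLM ℂ (fun _ : ℤ => ℂ) 2 k).toLinearMap ∘ₗ a R)
      (C * ((k : ℝ) ^ 2 + R ^ 2) ^ (m / 2)) (fun u => h R hR u k), fun k => ?_, fun u k => rfl⟩
    exact LinearMap.mkContinuous_norm_le _ (by positivity) _
  refine ⟨fun R hR => ?_, C * K, fun R hR => ?_⟩
  · obtain ⟨f, hf, hf2⟩ := hrow R hR
    exact isTraceClass_of_rows _ f (Summable.of_nonneg_of_le (fun _ => norm_nonneg _) hf
      ((hw R hR).1.mul_left C)) hf2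
  · obtain ⟨f, hf, hf2⟩ := hrow R hR
    have h1 : ‖opTrace (a R)‖ ≤ C * ∑' k : ℤ, ((k : ℝ) ^ 2 + R ^ 2) ^ (m / 2) :=
      tsum_of_norm_bounded ((hw R hR).1.hasSum.mul_left C)
        (fun k => (norm_matrixOf_le _ f hf2 k k).trans (hf k))
    refine h1.trans ?_
    rw [mul_assoc]
    exact mul_le_mul_of_nonneg_left (hw R hR).2 hC

/-! ### Canonical coordinates on the cotangent bundle -/

section Coordinates

variable {n : ℕ} {M : Type*} [TopologicalSpace M] [ChartedSpace (Euc n) M] [IsManifold (𝓡 n) ∞ M]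

/-- The trivialization of the cotangent bundle over the chart at `a`. -/
abbrev cotTriv (a : M) : Trivialization (Euc n →L[ℝ] ℝ)
    (TotalSpace.proj : Cotangent n M → M) :=
  trivializationAt (Euc n →L[ℝ] ℝ) (fun x : M => TangentSpace (𝓡 n) x →L[ℝ] ℝ) a

/-- The derivative of the chart at `a`, as an isomorphism. -/
def chartDeriv (a : M) {x : M} (hx : x ∈ (chartAt (Euc n) a).source) :
    TangentSpace (𝓡 n) x ≃L[ℝ] Euc n :=
  (trivializationAt (Euc n) (TangentSpace (𝓡 n) : M → Type _) a).continuousLinearEquivAt ℝ x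
    (by simpa using hx)

theorem coe_chartDeriv (a : M) {x : M} (hx : x ∈ (chartAt (Euc n) a).source) :
    (chartDeriv a hx : TangentSpace (𝓡 n) x →L[ℝ] Euc n) =
      mfderiv (𝓡 n) 𝓘(ℝ, Euc n) (extChartAt (𝓡 n) a) x := by
  rw [← TangentBundle.continuousLinearMapAt_trivializationAt hx]
  ext1 v
  exact congrFun (Trivialization.coe_continuousLinearEquivAt_eq (R := ℝ)
    (trivializationAt (Euc n) (TangentSpace (𝓡 n) : M → Type _) a) (by simpa using hx)) v

/-- A bundle of homomorphisms is trivialized by the trivializations of source and target. The target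
is a trivial line bundle, so only the inverse chart derivative remains. -/
theorem cotTriv_apply (a : M) (p : Cotangent n M) (hx : p.1 ∈ (chartAt (Euc n) a).source) :
    cotTriv a p = (p.1, p.2.comp ((chartDeriv a hx).symm : Euc n →L[ℝ] TangentSpace (𝓡 n) p.1)) := by
  rw [hom_trivializationAt_apply]
  refine Prod.ext rfl ?_
  ext v
  rw [ContinuousLinearMap.inCoordinates]
  simp only [ContinuousLinearMap.comp_apply]
  have h := Bundle.Trivial.continuousLinearMapAt_trivialization ℝ M ℝ p.1
  have h2 : (chartDeriv a hx).symm v =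
      (trivializationAt (Euc n) (TangentSpace (𝓡 n) : M → Type _) a).symmL ℝ p.1 v :=
    congrFun (Trivialization.symm_continuousLinearEquivAt_eq (R := ℝ)
      (trivializationAt (Euc n) (TangentSpace (𝓡 n) : M → Type _) a) (by simpa using hx)) v
  change _ = p.2 ((chartDeriv a hx).symm v)
  rw [h2]
  exact DFunLike.congr_fun h _

theorem mem_source_symm {a : M} {y : Euc n} (hy : y ∈ (extChartAt (𝓡 n) a).target) :
    (extChartAt (𝓡 n) a).symm y ∈ (chartAt (Euc n) a).source := by
  have := (extChartAt (𝓡 n) a).map_target hy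
  rwa [extChartAt_source] at this

/-- The chart derivative in `param` cancels the inverse one in the trivialization. This ties the
canonical coordinates to the smooth structure of the bundle. -/
theorem cotTriv_param (a : M) (z : Coord n) (hz : z.1 ∈ (extChartAt (𝓡 n) a).target) :
    cotTriv a (param a z).1 = ((extChartAt (𝓡 n) a).symm z.1, innerSL ℝ z.2.1) := by
  have hx := mem_source_symm hz
  rw [cotTriv_apply a _ hx]
  refine Prod.ext rfl ?_
  change ((innerSL ℝ z.2.1).comp
      (mfderiv (𝓡 n) 𝓘(ℝ, Euc n) (extChartAt (𝓡 n) a) ((extChartAt (𝓡 n) a).symm z.1))).comp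
      ((chartDeriv a hx).symm : Euc n →L[ℝ] TangentSpace (𝓡 n) _) = _
  rw [← coe_chartDeriv a hx]
  ext v
  change innerSL ℝ z.2.1 (chartDeriv a hx ((chartDeriv a hx).symm v)) = _
  rw [ContinuousLinearEquiv.apply_symm_apply]

/-- The coordinates over the chart at `a`, inverse to `param a`. -/
def coords (a : M) (q : Ambient n M) : Coord n :=
  (extChartAt (𝓡 n) a q.1.1, (InnerProductSpace.toDual ℝ (Euc n)).symm (cotTriv a q.1).2, q.2)

theorem coords_param (a : M) (z : Coord n) (hz : z.1 ∈ (extChartAt (𝓡 n) a).target) :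
    coords a (param a z) = z := by
  rw [coords, cotTriv_param a z hz]
  refine Prod.ext ((extChartAt (𝓡 n) a).right_inv hz) (Prod.ext ?_ rfl)
  exact (InnerProductSpace.toDual ℝ (Euc n)).symm_apply_apply z.2.1

theorem mem_cotTriv_target (a : M) {p : M × (Euc n →L[ℝ] ℝ)}
    (hp : p.1 ∈ (chartAt (Euc n) a).source) : p ∈ (cotTriv a).target := by
  rw [Trivialization.mem_target]
  simp only [hom_trivializationAt_baseSet]
  exact ⟨by simpa using hp, trivial⟩

theorem mem_cotTriv_source (a : M) {p : Cotangent n M}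
    (hp : p.1 ∈ (chartAt (Euc n) a).source) : p ∈ (cotTriv a).source := by
  rw [Trivialization.mem_source]
  simp only [hom_trivializationAt_baseSet]
  exact ⟨by simpa using hp, trivial⟩

theorem param_coords (a : M) (q : Ambient n M) (hq : q.1.1 ∈ (chartAt (Euc n) a).source) :
    param a (coords a q) = q := by
  have hz : (coords a q).1 ∈ (extChartAt (𝓡 n) a).target :=
    (extChartAt (𝓡 n) a).map_source (by rwa [extChartAt_source])
  have h1 : (extChartAt (𝓡 n) a).symm (coords a q).1 = q.1.1 :=
    (extChartAt (𝓡 n) a).left_inv (by rwa [extChartAt_source])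
  refine Prod.ext ?_ rfl
  have hs1 := mem_cotTriv_source a (p := (param a (coords a q)).1) (mem_source_symm hz)
  have hs2 := mem_cotTriv_source a hq
  refine (cotTriv a).injOn hs1 hs2 ?_
  refine (cotTriv_param a _ hz).trans ?_
  refine Prod.ext h1 ?_
  exact (InnerProductSpace.toDual ℝ (Euc n)).apply_symm_apply _

theorem isOpen_source (a : M) : IsOpen (chartAt (Euc n) a).source := (chartAt (Euc n) a).open_source

theorem cotTriv_symm (a : M) (z : Coord n) (hz : z.1 ∈ (extChartAt (𝓡 n) a).target) :
    (param a z).1 = (cotTriv a).toOpenPartialHomeomorph.symm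
      ((extChartAt (𝓡 n) a).symm z.1, innerSL ℝ z.2.1) := by
  rw [← cotTriv_param a z hz]
  exact ((cotTriv a).toOpenPartialHomeomorph.left_inv
    (mem_cotTriv_source a (mem_source_symm hz))).symm

theorem mdifferentiableAt_chart_symm (a : M) {y : Euc n} (hy : y ∈ (extChartAt (𝓡 n) a).target) :
    MDifferentiableAt 𝓘(ℝ, Euc n) (𝓡 n) (extChartAt (𝓡 n) a).symm y :=
  ((contMDiffOn_extChartAt_symm (n := ∞) a).contMDiffAt
    ((isOpen_extChartAt_target a).mem_nhds hy)).mdifferentiableAt (by simp)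

theorem mdifferentiableAt_param (a : M) (z : Coord n) (hz : z.1 ∈ (extChartAt (𝓡 n) a).target) :
    MDifferentiableAt 𝓘(ℝ, Coord n) (ambientModel n) (param a) z := by
  have hx := mem_source_symm hz
  have h1 : MDifferentiableAt 𝓘(ℝ, Coord n) (𝓡 n)
      (fun z : Coord n => (extChartAt (𝓡 n) a).symm z.1) z :=
    (mdifferentiableAt_chart_symm a hz).comp z
      (differentiableAt_fst (𝕜 := ℝ)).mdifferentiableAt
  have h2 : MDifferentiableAt 𝓘(ℝ, Coord n) 𝓘(ℝ, Euc n →L[ℝ] ℝ)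
      (fun z : Coord n => innerSL ℝ z.2.1) z := by
    apply DifferentiableAt.mdifferentiableAt
    exact (innerSL ℝ).differentiableAt.comp z (by fun_prop)
  have h3 := h1.prodMk h2
  have h4 : MDifferentiableAt ((𝓡 n).prod 𝓘(ℝ, Euc n →L[ℝ] ℝ)) ((𝓡 n).prod 𝓘(ℝ, Euc n →L[ℝ] ℝ))
      (cotTriv a).toOpenPartialHomeomorph.symm
      ((extChartAt (𝓡 n) a).symm z.1, innerSL ℝ z.2.1) :=
    ((Trivialization.contMDiffOn_symm (n := ∞) (IB := 𝓡 n) (cotTriv a)).contMDiffAt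
      ((cotTriv a).open_target.mem_nhds (mem_cotTriv_target a hx))).mdifferentiableAt (by simp)
  have h5 := h4.comp z h3
  have h6 : MDifferentiableAt 𝓘(ℝ, Coord n) (𝓘(ℝ, ℝ).prod 𝓘(ℝ, ℝ))
      (fun z : Coord n => (z.2.2.1, z.2.2.2)) z := by
    apply MDifferentiableAt.prodMk <;> apply DifferentiableAt.mdifferentiableAt <;> fun_prop
  refine (h5.prodMk h6).congr_of_eventuallyEq ?_
  filter_upwards [((isOpen_extChartAt_target a).preimage continuous_fst).mem_nhds hz] with z' hz'
  exact Prod.ext (cotTriv_symm a z' hz') rfl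

theorem mdifferentiableAt_base (q : Ambient n M) :
    MDifferentiableAt (ambientModel n) (𝓡 n) (fun q : Ambient n M => q.1.1) q :=
  (mdifferentiableAt_proj (fun x : M => TangentSpace (𝓡 n) x →L[ℝ] ℝ)).comp q
    mdifferentiableAt_fst

theorem mdifferentiableAt_coords (a : M) (q : Ambient n M)
    (hq : q.1.1 ∈ (chartAt (Euc n) a).source) :
    MDifferentiableAt (ambientModel n) 𝓘(ℝ, Coord n) (coords a) q := by
  have h1 : MDifferentiableAt (ambientModel n) 𝓘(ℝ, Euc n)
      (fun q : Ambient n M => extChartAt (𝓡 n) a q.1.1) q :=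
    (mdifferentiableAt_extChartAt hq).comp q (mdifferentiableAt_base q)
  have h2 : MDifferentiableAt ((𝓡 n).prod 𝓘(ℝ, Euc n →L[ℝ] ℝ)) ((𝓡 n).prod 𝓘(ℝ, Euc n →L[ℝ] ℝ))
      (cotTriv a) q.1 :=
    ((Trivialization.contMDiffOn (n := ∞) (IB := 𝓡 n) (cotTriv a)).contMDiffAt
      ((cotTriv a).open_source.mem_nhds (mem_cotTriv_source a hq))).mdifferentiableAt (by simp)
  have h3 : MDifferentiableAt (ambientModel n) 𝓘(ℝ, Euc n →L[ℝ] ℝ)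
      (fun q : Ambient n M => (cotTriv a q.1).2) q :=
    mdifferentiableAt_snd.comp q (h2.comp q mdifferentiableAt_fst)
  have h4 : MDifferentiableAt (ambientModel n) 𝓘(ℝ, Euc n)
      (fun q : Ambient n M => (InnerProductSpace.toDual ℝ (Euc n)).symm (cotTriv a q.1).2) q := by
    have : MDifferentiableAt 𝓘(ℝ, Euc n →L[ℝ] ℝ) 𝓘(ℝ, Euc n)
        (InnerProductSpace.toDual ℝ (Euc n)).symm (cotTriv a q.1).2 := by
      apply DifferentiableAt.mdifferentiableAt
      exact (InnerProductSpace.toDual ℝ (Euc n)).symm.differentiable _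
    exact this.comp q h3
  have h5 : MDifferentiableAt (ambientModel n) (𝓘(ℝ, ℝ).prod 𝓘(ℝ, ℝ))
      (fun q : Ambient n M => q.2) q := mdifferentiableAt_snd
  have h6 := h1.prodMk_space (h4.prodMk_space
    ((mdifferentiableAt_fst.comp q h5).prodMk_space (mdifferentiableAt_snd.comp q h5)))
  exact h6

end Coordinates

/-! ### Pullbacks in coordinates -/

section Pullbacks

variable {E₁ H₁ N₁ E₂ H₂ N₂ E₃ H₃ N₃ : Type*} [NormedAddCommGroup E₁] [NormedSpace ℝ E₁]
  [TopologicalSpace H₁] [TopologicalSpace N₁] [ChartedSpace H₁ N₁]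
  [NormedAddCommGroup E₂] [NormedSpace ℝ E₂]
  [TopologicalSpace H₂] [TopologicalSpace N₂] [ChartedSpace H₂ N₂]
  [NormedAddCommGroup E₃] [NormedSpace ℝ E₃]
  [TopologicalSpace H₃] [TopologicalSpace N₃] [ChartedSpace H₃ N₃]
  {I₁ : ModelWithCorners ℝ E₁ H₁} {I₂ : ModelWithCorners ℝ E₂ H₂} {I₃ : ModelWithCorners ℝ E₃ H₃}

theorem formPullback_eq_pull (f : N₁ → N₂) (w : ∀ q : N₂, FormAlg (TangentSpace I₂ q)) (p : N₁) :
    formPullback I₁ I₂ f w p = pull (mfderiv I₁ I₂ f p) (w (f p)) := rfl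

theorem formPullback_mul (f : N₁ → N₂) (w w' : ∀ q : N₂, FormAlg (TangentSpace I₂ q)) (p : N₁) :
    formPullback I₁ I₂ f (fun q => w q * w' q) p =
      formPullback I₁ I₂ f w p * formPullback I₁ I₂ f w' p :=
  map_mul (pull (mfderiv I₁ I₂ f p)) _ _

theorem formPullback_congr {f f' : N₁ → N₂} {p : N₁} (h : f =ᶠ[nhds p] f')
    (w : ∀ q : N₂, FormAlg (TangentSpace I₂ q)) :
    formPullback I₁ I₂ f w p = formPullback I₁ I₂ f' w p := by
  have h1 : (mfderiv I₁ I₂ f p : E₁ →L[ℝ] E₂) = mfderiv I₁ I₂ f' p := h.mfderiv_eq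
  have h2 : f p = f' p := h.eq_of_nhds
  -- Every tangent space is the model space by definition; as a function into a fixed type the form
  -- can be rewritten at an equal point.
  let w' : N₂ → FormAlg E₂ := w
  change pull (V := E₁) (W := E₂) (mfderiv I₁ I₂ f p : E₁ →L[ℝ] E₂) (w' (f p)) =
    pull (V := E₁) (W := E₂) (mfderiv I₁ I₂ f' p : E₁ →L[ℝ] E₂) (w' (f' p))
  rw [h1, h2]

theorem formPullback_comp {g : N₂ → N₃} {f : N₁ → N₂} {p : N₁}
    (hg : MDifferentiableAt I₂ I₃ g (f p)) (hf : MDifferentiableAt I₁ I₂ f p)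
    (w : ∀ q : N₃, FormAlg (TangentSpace I₃ q)) :
    formPullback I₁ I₃ (fun x => g (f x)) w p =
      formPullback I₁ I₂ f (formPullback I₂ I₃ g w) p := by
  have h : mfderiv I₁ I₃ (fun x => g (f x)) p = (mfderiv I₂ I₃ g (f p)).comp (mfderiv I₁ I₂ f p) :=
    mfderiv_comp p hg hf
  rw [formPullback_eq_pull, h]
  exact pull_comp (U := TangentSpace I₁ p) (V := TangentSpace I₂ (f p))
    (W := TangentSpace I₃ (g (f p))) _ _ _

/-- The value of a pullback at a point only depends on the value of the form there. -/
theorem formPullback_congr_form (f : N₁ → N₂) {w w' : ∀ q : N₂, FormAlg (TangentSpace I₂ q)}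
    {p : N₁} (h : w (f p) = w' (f p)) : formPullback I₁ I₂ f w p = formPullback I₁ I₂ f w' p := by
  rw [formPullback_eq_pull, formPullback_eq_pull, h]

theorem formPullback_eq_pull_fderiv (f : E₁ → E₂) (w : E₂ → FormAlg E₂) (p : E₁) :
    formPullback 𝓘(ℝ, E₁) 𝓘(ℝ, E₂) f w p = pull (fderiv ℝ f p) (w (f p)) :=
  congrArg (fun A : E₁ →L[ℝ] E₂ => pull (V := E₁) (W := E₂) A (w (f p))) mfderiv_eq_fderiv

end Pullbacks

/-! ### Forms and mappings in canonical coordinates -/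

section Coordinates

variable {n : ℕ} {M : Type*} [TopologicalSpace M] [ChartedSpace (Euc n) M] [IsManifold (𝓡 n) ∞ M]

/-- Differential forms on `T*M × ℝ²`. -/
abbrev AmbientForm (n : ℕ) (M : Type*) [TopologicalSpace M] [ChartedSpace (Euc n) M]
    [IsManifold (𝓡 n) ∞ M] : Type _ :=
  ∀ q : Ambient n M, FormAlg (TangentSpace (ambientModel n) q)

/-- A form on `T*M × ℝ²` in the canonical coordinates over the chart at `a`. -/
def coordForm (a : M) (θ : AmbientForm n M) (z : Coord n) : FormAlg (Coord n) :=
  formPullback 𝓘(ℝ, Coord n) (ambientModel n) (param a) θ z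

/-- The coordinates with base point in the chart domain. -/
def coordDomain (n : ℕ) {M : Type*} [TopologicalSpace M] [ChartedSpace (Euc n) M] (a : M) :
    Set (Coord n) := {z | z.1 ∈ (extChartAt (𝓡 n) a).target}

theorem isOpen_coordDomain (a : M) : IsOpen (coordDomain n a) :=
  (isOpen_extChartAt_target a).preimage continuous_fst

theorem coordForm_mul (a : M) (θ θ' : AmbientForm n M) (z : Coord n) :
    coordForm a (fun q => θ q * θ' q) z = coordForm a θ z * coordForm a θ' z :=
  formPullback_mul _ _ _ _

theorem mem_source_param {a : M} {z : Coord n} (hz : z ∈ coordDomain n a) :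
    (param a z).1.1 ∈ (chartAt (Euc n) a).source := mem_source_symm hz

section Representation

variable {a b : M} {F : Ambient n M → Ambient n M} {f : Coord n → Coord n} {z : Coord n}

/-- A mapping which is differentiable in the canonical coordinates is differentiable. -/
theorem mdifferentiableAt_of_coord (hz : z ∈ coordDomain n a) (hfz : f z ∈ coordDomain n b)
    (hF : ∀ᶠ z' in nhds z, F (param a z') = param b (f z')) (hf : DifferentiableAt ℝ f z) :
    MDifferentiableAt (ambientModel n) (ambientModel n) F (param a z) := by
  have hc : MDifferentiableAt (ambientModel n) 𝓘(ℝ, Coord n) (coords a) (param a z) :=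
    mdifferentiableAt_coords a _ (mem_source_param hz)
  have hcz : coords a (param a z) = z := coords_param a z hz
  have h1 : MDifferentiableAt (ambientModel n) 𝓘(ℝ, Coord n) (fun q => f (coords a q))
      (param a z) := by
    have h0 : MDifferentiableAt 𝓘(ℝ, Coord n) 𝓘(ℝ, Coord n) f (coords a (param a z)) := by
      rw [hcz]; exact hf.mdifferentiableAt
    exact h0.comp (param a z) hc
  have h2 : MDifferentiableAt (ambientModel n) (ambientModel n)
      (fun q => param b (f (coords a q))) (param a z) := by
    have h0 : MDifferentiableAt 𝓘(ℝ, Coord n) (ambientModel n) (param b)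
        (f (coords a (param a z))) := by
      rw [hcz]; exact mdifferentiableAt_param b _ hfz
    exact h0.comp (param a z) h1
  refine h2.congr_of_eventuallyEq ?_
  have h3 : ∀ᶠ q in nhds (param a z), F (param a (coords a q)) = param b (f (coords a q)) := by
    have := hc.continuousAt
    rw [ContinuousAt, hcz] at this
    exact this.eventually hF
  have h4 : ∀ᶠ q : Ambient n M in nhds (param a z), q.1.1 ∈ (chartAt (Euc n) a).source :=
    (mdifferentiableAt_base (param a z)).continuousAt.eventually
      ((isOpen_source a).mem_nhds (mem_source_param hz))
  filter_upwards [h3, h4] with q hq hq2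
  rwa [param_coords a q hq2] at hq

/-- The pullback of a form, computed in the canonical coordinates. -/
theorem coordForm_formPullback (hz : z ∈ coordDomain n a) (hfz : f z ∈ coordDomain n b)
    (hF : ∀ᶠ z' in nhds z, F (param a z') = param b (f z')) (hf : DifferentiableAt ℝ f z)
    (θ : AmbientForm n M) :
    coordForm a (formPullback (ambientModel n) (ambientModel n) F θ) z =
      pull (fderiv ℝ f z) (coordForm b θ (f z)) := by
  rw [coordForm, ← formPullback_comp (mdifferentiableAt_of_coord hz hfz hF hf)
    (mdifferentiableAt_param a z hz), formPullback_congr hF,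
    formPullback_comp (I₂ := 𝓘(ℝ, Coord n)) (mdifferentiableAt_param b _ hfz) hf.mdifferentiableAt]
  exact formPullback_eq_pull_fderiv f (coordForm b θ) z

end Representation

/-- Every tangent vector is the image of a coordinate vector. -/
theorem exists_mfderiv_param_eq (a : M) {z : Coord n} (hz : z ∈ coordDomain n a)
    (v : TangentSpace (ambientModel n) (param a z)) :
    ∃ u : Coord n, mfderiv 𝓘(ℝ, Coord n) (ambientModel n) (param a) z u = v := by
  have hc : MDifferentiableAt (ambientModel n) 𝓘(ℝ, Coord n) (coords a) (param a z) :=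
    mdifferentiableAt_coords a _ (mem_source_param hz)
  have hcz : coords a (param a z) = z := coords_param a z hz
  have hp : MDifferentiableAt 𝓘(ℝ, Coord n) (ambientModel n) (param a)
      (coords a (param a z)) := by rw [hcz]; exact mdifferentiableAt_param a z hz
  have h1 := mfderiv_comp (param a z) hp hc
  have h2 : (param a ∘ coords a) =ᶠ[nhds (param a z)] id := by
    have h4 : ∀ᶠ q : Ambient n M in nhds (param a z), q.1.1 ∈ (chartAt (Euc n) a).source :=
      (mdifferentiableAt_base (param a z)).continuousAt.eventually
        ((isOpen_source a).mem_nhds (mem_source_param hz))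
    filter_upwards [h4] with q hq using param_coords a q hq
  refine ⟨mfderiv (ambientModel n) 𝓘(ℝ, Coord n) (coords a) (param a z) v, ?_⟩
  have h3 : (mfderiv (ambientModel n) (ambientModel n) (param a ∘ coords a) (param a z) v :
      (Euc n × (Euc n →L[ℝ] ℝ)) × ℝ × ℝ) = v := by
    rw [h2.mfderiv_eq, mfderiv_id]; rfl
  rw [h1] at h3
  -- The chain rule produces the derivative at `coords a (param a z)`, with values in another
  -- tangent space; the comparison with the one at z takes place in the model space.
  have h4 : ∀ z' : Coord n, z' = z → ∀ u : Coord n,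
      (mfderiv 𝓘(ℝ, Coord n) (ambientModel n) (param a) z' u :
        (Euc n × (Euc n →L[ℝ] ℝ)) × ℝ × ℝ) =
      (mfderiv 𝓘(ℝ, Coord n) (ambientModel n) (param a) z u :
        (Euc n × (Euc n →L[ℝ] ℝ)) × ℝ × ℝ) := by
    rintro z' rfl u; rfl
  exact (h4 _ hcz _).symm.trans h3

/-- A form lifted from `M`, in coordinates. -/
theorem coordForm_liftBase (a : M) (θ : BaseForm n M) {z : Coord n} (hz : z ∈ coordDomain n a) :
    coordForm a (liftBase θ) z =
      pull (ContinuousLinearMap.fst ℝ (Euc n) (Euc n × ℝ × ℝ)) (inChart θ a z.1) := by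
  have h1 : coordForm a (liftBase θ) z = formPullback 𝓘(ℝ, Coord n) (𝓡 n)
      (fun z : Coord n => (extChartAt (𝓡 n) a).symm z.1) θ z :=
    (formPullback_comp (mdifferentiableAt_base _) (mdifferentiableAt_param a z hz) θ).symm
  rw [h1, formPullback_comp (I₂ := 𝓘(ℝ, Euc n)) (mdifferentiableAt_chart_symm a hz)
    (differentiableAt_fst (𝕜 := ℝ)).mdifferentiableAt θ]
  refine (formPullback_eq_pull_fderiv (fun z : Coord n => z.1) (inChart θ a) z).trans ?_
  rw [fderiv_fst]

end Coordinates

/-! ### The dual metric -/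

section DualMetric

/-- A positive definite form defines an isomorphism to the dual space. -/
theorem exists_equiv_of_pos {V : Type*} [NormedAddCommGroup V] [NormedSpace ℝ V]
    [FiniteDimensional ℝ V] (B : V →L[ℝ] V →L[ℝ] ℝ) (hB : ∀ v, v ≠ 0 → 0 < B v v) :
    ∃ e : V ≃L[ℝ] (V →L[ℝ] ℝ), (e : V →L[ℝ] (V →L[ℝ] ℝ)) = B := by
  have hinj : Function.Injective (B : V →ₗ[ℝ] (V →L[ℝ] ℝ)) := by
    rw [← LinearMap.ker_eq_bot, LinearMap.ker_eq_bot']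
    intro v hv
    by_contra hne
    have h1 := hB v hne
    have h2 : B v v = 0 := by
      have : B v = 0 := hv
      simp [this]
    linarith
  have hdim : Module.finrank ℝ V = Module.finrank ℝ (V →L[ℝ] ℝ) := by
    rw [← (LinearMap.toContinuousLinearMap (𝕜 := ℝ) (E := V) (F' := ℝ)).finrank_eq]
    exact (Subspace.dual_finrank_eq (K := ℝ) (V := V)).symm
  refine ⟨(LinearEquiv.ofInjectiveOfFinrankEq _ hinj hdim).toContinuousLinearEquiv, ?_⟩
  ext v w
  rfl

variable {n : ℕ} {M : Type*} [TopologicalSpace M] [ChartedSpace (Euc n) M] [IsManifold (𝓡 n) ∞ M]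

theorem exists_metric_equiv (h : Metric n M) (x : M) :
    ∃ e : Euc n ≃L[ℝ] (Euc n →L[ℝ] ℝ), (e : Euc n →L[ℝ] (Euc n →L[ℝ] ℝ)) = h.inner x :=
  exists_equiv_of_pos (V := Euc n) (h.inner x) (h.pos x)

/-- Eliminates the inverse of the metric: the properties of the dual norm follow from those of h at
the dual vector. -/
theorem covectorNormSq_of_eq (h : Metric n M) (p : Cotangent n M) (v : TangentSpace (𝓡 n) p.1)
    (hv : h.inner p.1 v = p.2) : covectorNormSq h p = h.inner p.1 v v := by
  obtain ⟨e, he⟩ := exists_metric_equiv h p.1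
  have h1 : (h.inner p.1).inverse = (e.symm : (Euc n →L[ℝ] ℝ) →L[ℝ] Euc n) := by
    rw [← ContinuousLinearMap.inverse_equiv e, he]; rfl
  rw [covectorNormSq, h1, ← hv]
  have h3 : ((e.symm : (Euc n →L[ℝ] ℝ) →L[ℝ] Euc n) (h.inner p.1 v)) = v := by
    rw [← he]; exact e.symm_apply_apply v
  exact congrArg (h.inner p.1 v) h3

theorem exists_metric_eq (h : Metric n M) (p : Cotangent n M) :
    ∃ v : TangentSpace (𝓡 n) p.1, h.inner p.1 v = p.2 := by
  obtain ⟨e, he⟩ := exists_metric_equiv h p.1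
  refine ⟨e.symm p.2, ?_⟩
  rw [← he]
  exact e.apply_symm_apply p.2

theorem covectorNormSq_nonneg (h : Metric n M) (p : Cotangent n M) : 0 ≤ covectorNormSq h p := by
  obtain ⟨v, hv⟩ := exists_metric_eq h p
  rw [covectorNormSq_of_eq h p v hv]
  by_cases h0 : v = 0
  · simp [h0]
  · exact (h.pos p.1 v h0).le

theorem covectorNormSq_eq_zero (h : Metric n M) (p : Cotangent n M) :
    covectorNormSq h p = 0 ↔ p.2 = 0 := by
  obtain ⟨v, hv⟩ := exists_metric_eq h p
  rw [covectorNormSq_of_eq h p v hv]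
  constructor
  · intro h1
    have : v = 0 := by
      by_contra h0
      exact (h.pos p.1 v h0).ne' h1
    rw [← hv, this, map_zero]
  · intro h1
    have : v = 0 := by
      by_contra h0
      have h2 := h.pos p.1 v h0
      rw [hv, h1] at h2
      simp at h2
    simp [this]

theorem covectorNormSq_smul (h : Metric n M) (x : M) (ξ : TangentSpace (𝓡 n) x →L[ℝ] ℝ) (c : ℝ) :
    covectorNormSq h ⟨x, c • ξ⟩ = c ^ 2 * covectorNormSq h ⟨x, ξ⟩ := by
  simp only [covectorNormSq, map_smul, smul_apply, smul_eq_mul]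
  ring

/-- If v is the vector dual to ξ, then dg(v) is dual to ∂g(ξ), since g is an isometry; and dg
preserves the length of v. -/
theorem covectorNormSq_codifferential (h : Metric n M) (g : M ≃ₘ^∞⟮𝓡 n, 𝓡 n⟯ M)
    (hg : Preserves g h) (p : Cotangent n M) :
    covectorNormSq h (codifferential g p) = covectorNormSq h p := by
  obtain ⟨v, hv⟩ := exists_metric_eq h p
  rw [covectorNormSq_of_eq h p v hv, ← hg p.1 v v]
  refine covectorNormSq_of_eq h (codifferential g p) (mfderiv (𝓡 n) (𝓡 n) g p.1 v) ?_
  let e := g.mfderivToContinuousLinearEquiv (by simp) p.1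
  have he : (e : TangentSpace (𝓡 n) p.1 →L[ℝ] TangentSpace (𝓡 n) (g p.1)) =
    mfderiv (𝓡 n) (𝓡 n) g p.1 := g.mfderivToContinuousLinearEquiv_coe (by simp)
  change _ = p.2.comp (mfderiv (𝓡 n) (𝓡 n) g p.1).inverse
  rw [← he, ContinuousLinearMap.inverse_equiv]
  ext w
  obtain ⟨u, rfl⟩ := e.surjective w
  have h1 := hg p.1 v u
  rw [← he] at h1
  rw [← hv]
  refine h1.trans ?_
  exact (congrArg (h.inner p.1 v) (e.symm_apply_apply u)).symm

/-- The squared length of covectors, in the canonical coordinates. -/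
def normSqCoord (h : Metric n M) (a : M) (z : Coord n) : ℝ := covectorNormSq h (param a z).1

/-- The metric in the chart at `a`. -/
def gram (h : Metric n M) (a : M) (y : Euc n) : Euc n →L[ℝ] Euc n →L[ℝ] ℝ :=
  (trivializationAt (Euc n →L[ℝ] Euc n →L[ℝ] ℝ)
    (fun x : M => TangentSpace (𝓡 n) x →L[ℝ] TangentSpace (𝓡 n) x →L[ℝ] ℝ) a
    ⟨(extChartAt (𝓡 n) a).symm y, h.inner _⟩).2

theorem gram_apply (h : Metric n M) (a : M) {y : Euc n} (hy : y ∈ (extChartAt (𝓡 n) a).target)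
    (u v : Euc n) : gram h a y u v =
      h.inner ((extChartAt (𝓡 n) a).symm y) ((chartDeriv a (mem_source_symm hy)).symm u)
        ((chartDeriv a (mem_source_symm hy)).symm v) := by
  have hx := mem_source_symm hy
  set x := (extChartAt (𝓡 n) a).symm y
  have h2 : ∀ v, (chartDeriv a hx).symm v =
      (trivializationAt (Euc n) (TangentSpace (𝓡 n) : M → Type _) a).symmL ℝ x v := fun v =>
    congrFun (Trivialization.symm_continuousLinearEquivAt_eq (R := ℝ)
      (trivializationAt (Euc n) (TangentSpace (𝓡 n) : M → Type _) a) (by simpa using hx)) v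
  have h3 : gram h a y u = ((cotTriv a).continuousLinearMapAt ℝ x
      (h.inner x ((trivializationAt (Euc n) (TangentSpace (𝓡 n) : M → Type _) a).symmL ℝ x u))) :=
    rfl
  rw [h3, ← h2, Trivialization.continuousLinearMapAt_apply, Trivialization.coe_linearMapAt_of_mem]
  · have h4 := cotTriv_apply a ⟨x, h.inner x ((chartDeriv a hx).symm u)⟩ hx
    have h5 := congrArg (fun q => q.2 v) h4
    exact h5
  · simp only [hom_trivializationAt_baseSet]
    exact ⟨by simpa using hx, trivial⟩

set_option synthInstance.maxHeartbeats 400000 in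
theorem contDiffOn_gram (h : Metric n M) (a : M) :
    ContDiffOn ℝ ∞ (gram h a) (extChartAt (𝓡 n) a).target := by
  let e := trivializationAt (Euc n →L[ℝ] Euc n →L[ℝ] ℝ)
    (fun x : M => TangentSpace (𝓡 n) x →L[ℝ] TangentSpace (𝓡 n) x →L[ℝ] ℝ) a
  have h1 : ContMDiffOn 𝓘(ℝ, Euc n) ((𝓡 n).prod 𝓘(ℝ, Euc n →L[ℝ] Euc n →L[ℝ] ℝ)) ∞
      (fun y => TotalSpace.mk' (Euc n →L[ℝ] Euc n →L[ℝ] ℝ)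
        (E := fun x : M => TangentSpace (𝓡 n) x →L[ℝ] TangentSpace (𝓡 n) x →L[ℝ] ℝ)
        ((extChartAt (𝓡 n) a).symm y) (h.inner ((extChartAt (𝓡 n) a).symm y)))
      (extChartAt (𝓡 n) a).target :=
    h.contMDiff.comp_contMDiffOn (contMDiffOn_extChartAt_symm a)
  have h2 := (Trivialization.contMDiffOn (n := ∞) (IB := 𝓡 n) e).comp h1 (by
    intro y hy
    have hx := mem_source_symm hy
    rw [mem_preimage, Trivialization.mem_source]
    simp only [e, hom_trivializationAt_baseSet]
    exact ⟨by simpa using hx, by simpa using hx, trivial⟩)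
  have h3 := contMDiff_snd.comp_contMDiffOn h2
  exact h3.contDiffOn

theorem gram_pos (h : Metric n M) (a : M) {y : Euc n} (hy : y ∈ (extChartAt (𝓡 n) a).target)
    (u : Euc n) (hu : u ≠ 0) : 0 < gram h a y u u := by
  rw [gram_apply h a hy]
  refine h.pos _ _ fun h0 => hu ?_
  exact (LinearEquiv.map_eq_zero_iff (chartDeriv a (mem_source_symm hy)).symm.toLinearEquiv).mp h0

/-- The chart derivative takes the h-dual of the covector to its dual for the metric in coordinates.
All objects on the right live on fixed spaces, so smoothness can be read off. -/
theorem normSqCoord_eq (h : Metric n M) (a : M) {z : Coord n} (hz : z ∈ coordDomain n a) :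
    normSqCoord h a z = innerSL ℝ z.2.1 ((gram h a z.1).inverse (innerSL ℝ z.2.1)) := by
  obtain ⟨e, he⟩ := exists_equiv_of_pos (gram h a z.1) (gram_pos h a hz)
  rw [← he, ContinuousLinearMap.inverse_equiv]
  have hx := mem_source_symm hz
  set w := e.symm (innerSL ℝ z.2.1)
  have hw : gram h a z.1 w = innerSL ℝ z.2.1 := by
    rw [← he]; exact e.apply_symm_apply _
  have h1 : h.inner ((extChartAt (𝓡 n) a).symm z.1) ((chartDeriv a hx).symm w) =
      (param a z).1.2 := by
    ext v
    change _ = innerSL ℝ z.2.1 (mfderiv (𝓡 n) 𝓘(ℝ, Euc n) (extChartAt (𝓡 n) a)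
      ((extChartAt (𝓡 n) a).symm z.1) v)
    rw [← coe_chartDeriv a hx, ← hw]
    change _ = gram h a z.1 w (chartDeriv a hx v)
    rw [gram_apply h a hz]
    exact (congrArg (h.inner _ _) ((chartDeriv a hx).symm_apply_apply v)).symm
  rw [normSqCoord, covectorNormSq_of_eq h _ _ h1]
  change h.inner _ _ _ = innerSL ℝ z.2.1 w
  rw [← hw, gram_apply h a hz]
  rfl

set_option synthInstance.maxHeartbeats 400000 in
theorem contDiffOn_normSqCoord (h : Metric n M) (a : M) :
    ContDiffOn ℝ ∞ (normSqCoord h a) (coordDomain n a) := by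
  have h1 : ContDiffOn ℝ ∞ (fun z : Coord n =>
      innerSL ℝ z.2.1 ((gram h a z.1).inverse (innerSL ℝ z.2.1))) (coordDomain n a) := by
    have hi : ContDiff ℝ ∞ (fun z : Coord n => innerSL ℝ z.2.1) :=
      (innerSL ℝ).contDiff.comp (contDiff_fst.comp contDiff_snd)
    have hg : ContDiffOn ℝ ∞ (fun z : Coord n => (gram h a z.1).inverse) (coordDomain n a) := by
      intro z hz
      obtain ⟨e, he⟩ := exists_equiv_of_pos (gram h a z.1) (gram_pos h a hz)
      have h2 : ContDiffWithinAt ℝ ∞ (fun z : Coord n => gram h a z.1) (coordDomain n a) z :=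
        ((contDiffOn_gram h a).comp contDiff_fst.contDiffOn (fun z hz => hz)) z hz
      -- Inversion of operators is smooth at invertible ones, and positivity makes the metric
      -- invertible.
      have h3 : ContDiffAt ℝ ∞ ContinuousLinearMap.inverse (gram h a z.1) := by
        rw [← he]; exact contDiffAt_map_inverse e
      exact h3.comp_contDiffWithinAt z h2
    exact hi.contDiffOn.clm_apply (hg.clm_apply hi.contDiffOn)
  exact h1.congr fun z hz => normSqCoord_eq h a hz

theorem param_snd_eq_zero (a : M) {z : Coord n} (hz : z ∈ coordDomain n a) :
    (param a z).1.2 = 0 ↔ z.2.1 = 0 := by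
  have hx := mem_source_symm hz
  have h0 : (param a z).1.2 = (innerSL ℝ z.2.1).comp
      (chartDeriv a hx : TangentSpace (𝓡 n) ((extChartAt (𝓡 n) a).symm z.1) →L[ℝ] Euc n) := by
    rw [coe_chartDeriv]; rfl
  constructor
  · intro h1
    rw [h0] at h1
    have h2 := DFunLike.congr_fun h1 ((chartDeriv a hx).symm z.2.1)
    have h3 : innerSL ℝ z.2.1 z.2.1 = 0 := by
      refine Eq.trans ?_ h2
      exact (congrArg (innerSL ℝ z.2.1) ((chartDeriv a hx).apply_symm_apply z.2.1)).symm
    simpa using h3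
  · intro h1
    rw [h0, h1, map_zero]; rfl

theorem normSqCoord_nonneg (h : Metric n M) (a : M) (z : Coord n) : 0 ≤ normSqCoord h a z :=
  covectorNormSq_nonneg h _

theorem normSqCoord_eq_zero (h : Metric n M) {a : M} {z : Coord n} (hz : z ∈ coordDomain n a) :
    normSqCoord h a z = 0 ↔ z.2.1 = 0 := by
  rw [normSqCoord, covectorNormSq_eq_zero, param_snd_eq_zero a hz]

theorem param_smul (a : M) (y ξ : Euc n) (c : ℝ) (s : ℝ × ℝ) :
    (param a (y, c • ξ, s)).1 = ⟨(param a (y, ξ, s)).1.1, c • (param a (y, ξ, s)).1.2⟩ := by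
  simp only [param, map_smul]
  rfl

theorem normSqCoord_smul (h : Metric n M) (a : M) (y ξ : Euc n) (c : ℝ) (s s' : ℝ × ℝ) :
    normSqCoord h a (y, c • ξ, s) = c ^ 2 * normSqCoord h a (y, ξ, s') := by
  rw [normSqCoord, param_smul, covectorNormSq_smul]
  rfl

end DualMetric

/-! ### Radii and projections in coordinates -/

section Radial

variable {n : ℕ} {M : Type*} [TopologicalSpace M] [ChartedSpace (Euc n) M] [IsManifold (𝓡 n) ∞ M]

/-- The coordinates over the chart at `a` outside the zero section. -/
def puncturedDomain (n : ℕ) {M : Type*} [TopologicalSpace M] [ChartedSpace (Euc n) M] (a : M) :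
    Set (Coord n) := {z : Coord n | z.1 ∈ (extChartAt (𝓡 n) a).target ∧ z.2 ≠ 0}

theorem isOpen_puncturedDomain (a : M) : IsOpen (puncturedDomain n a) :=
  (isOpen_coordDomain a).inter (isOpen_ne.preimage continuous_snd)

/-- The radius of the sphere bundle in coordinates. -/
def sphR (h : Metric n M) (a : M) (z : Coord n) : ℝ := sphereRadius h (param a z)

/-- The radius of the cosphere bundle in coordinates. -/
def cosR (h : Metric n M) (a : M) (z : Coord n) : ℝ := cosphereRadius h (param a z)

/-- The projection onto the sphere bundle in coordinates. -/
def sphP (h : Metric n M) (a : M) (z : Coord n) : Coord n := (z.1, (sphR h a z)⁻¹ • z.2)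

/-- The projection onto the cosphere bundle in coordinates. -/
def cosP (h : Metric n M) (a : M) (z : Coord n) : Coord n :=
  (z.1, (cosR h a z)⁻¹ • z.2.1, z.2.2.1, (cosR h a z)⁻¹ * z.2.2.2)

/-- Scaling and translation in coordinates. -/
def shiftC (R : ℝ) (i : ℤ) (z : Coord n) : Coord n :=
  (z.1, R • z.2.1, z.2.2.1 + i, R * z.2.2.2)

variable (h : Metric n M) (a : M)

theorem sphR_eq (z : Coord n) :
    sphR h a z = √(normSqCoord h a z + z.2.2.1 ^ 2 + z.2.2.2 ^ 2) := rfl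

theorem cosR_eq (z : Coord n) : cosR h a z = √(normSqCoord h a z + z.2.2.2 ^ 2) := rfl

theorem sphereProj_param (z : Coord n) : sphereProj h (param a z) = param a (sphP h a z) := by
  refine Prod.ext ?_ rfl
  exact (param_smul a z.1 z.2.1 _ z.2.2).symm

theorem cosphereProj_param (z : Coord n) : cosphereProj h (param a z) = param a (cosP h a z) := by
  refine Prod.ext ?_ rfl
  exact (param_smul a z.1 z.2.1 _ z.2.2).symm

theorem scaleShift_param (R : ℝ) (i : ℤ) (z : Coord n) :
    scaleShift R i (param a z) = param a (shiftC R i z) := by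
  refine Prod.ext ?_ rfl
  exact (param_smul a z.1 z.2.1 _ z.2.2).symm

variable {h a}

theorem sphR_sq (z : Coord n) :
    sphR h a z ^ 2 = normSqCoord h a z + z.2.2.1 ^ 2 + z.2.2.2 ^ 2 := by
  rw [sphR_eq, Real.sq_sqrt]
  have := normSqCoord_nonneg h a z
  positivity

theorem cosR_sq (z : Coord n) : cosR h a z ^ 2 = normSqCoord h a z + z.2.2.2 ^ 2 := by
  rw [cosR_eq, Real.sq_sqrt]
  have := normSqCoord_nonneg h a z
  positivity

theorem sphR_nonneg (z : Coord n) : 0 ≤ sphR h a z := Real.sqrt_nonneg _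

theorem cosR_nonneg (z : Coord n) : 0 ≤ cosR h a z := Real.sqrt_nonneg _

theorem sphR_ne_zero {z : Coord n} (hz : z ∈ puncturedDomain n a) : sphR h a z ≠ 0 := by
  intro h0
  have h1 := sphR_sq (h := h) (a := a) z
  rw [h0] at h1
  have h2 := normSqCoord_nonneg h a z
  have h3 : z.2.2.1 = 0 := by nlinarith [sq_nonneg z.2.2.1, sq_nonneg z.2.2.2]
  have h4 : z.2.2.2 = 0 := by nlinarith [sq_nonneg z.2.2.1, sq_nonneg z.2.2.2]
  have h5 : normSqCoord h a z = 0 := by nlinarith [sq_nonneg z.2.2.1, sq_nonneg z.2.2.2]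
  rw [normSqCoord_eq_zero h hz.1] at h5
  exact hz.2 (Prod.ext h5 (Prod.ext h3 h4))

theorem sphR_pos {z : Coord n} (hz : z ∈ puncturedDomain n a) : 0 < sphR h a z :=
  lt_of_le_of_ne (sphR_nonneg z) (sphR_ne_zero hz).symm

theorem normSqCoord_congr {z z' : Coord n} (h1 : z.1 = z'.1) (h2 : z.2.1 = z'.2.1) :
    normSqCoord h a z = normSqCoord h a z' := by
  obtain ⟨x, ξ, t, τ⟩ := z
  obtain ⟨x', ξ', t', τ'⟩ := z'
  obtain rfl : x = x' := h1
  obtain rfl : ξ = ξ' := h2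
  rfl

theorem normSqCoord_smul' {z z' : Coord n} (c : ℝ) (h1 : z.1 = z'.1) (h2 : z.2.1 = c • z'.2.1) :
    normSqCoord h a z = c ^ 2 * normSqCoord h a z' := by
  obtain ⟨x, ξ, t⟩ := z
  obtain ⟨x', ξ', t'⟩ := z'
  obtain rfl : x = x' := h1
  obtain rfl : ξ = c • ξ' := h2
  exact normSqCoord_smul h a x ξ' c t t'

theorem sphR_smul (z : Coord n) {c : ℝ} (hc : 0 ≤ c) :
    sphR h a (z.1, c • z.2) = c * sphR h a z := by
  rw [← Real.sqrt_sq (mul_nonneg hc (sphR_nonneg z)), sphR_eq, mul_pow, sphR_sq,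
    normSqCoord_smul' (z := (z.1, c • z.2)) (z' := z) c rfl rfl]
  congr 1
  simp only [Prod.smul_fst, Prod.smul_snd, smul_eq_mul]
  ring

theorem sphP_smul (z : Coord n) {c : ℝ} (hc : 0 < c) :
    sphP h a (z.1, c • z.2) = sphP h a z := by
  refine Prod.ext rfl ?_
  change (sphR h a (z.1, c • z.2))⁻¹ • (c • z.2) = (sphR h a z)⁻¹ • z.2
  rw [sphR_smul z hc.le, smul_smul]
  congr 1
  -- Where the radius vanishes both factors are 0, the default value of the inverse.
  by_cases h0 : sphR h a z = 0
  · simp [h0]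
  · field_simp

theorem sphP_mem {z : Coord n} (hz : z ∈ puncturedDomain n a) :
    sphP h a z ∈ puncturedDomain n a :=
  ⟨hz.1, smul_ne_zero (inv_ne_zero (sphR_ne_zero hz)) hz.2⟩

theorem contDiffOn_sphR : ContDiffOn ℝ ∞ (sphR h a) (puncturedDomain n a) := by
  have h1 : ContDiffOn ℝ ∞ (fun z : Coord n => normSqCoord h a z + z.2.2.1 ^ 2 + z.2.2.2 ^ 2)
      (puncturedDomain n a) := by
    refine (((contDiffOn_normSqCoord h a).mono fun z hz => hz.1).add ?_).add ?_ <;>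
      apply ContDiff.contDiffOn <;> fun_prop
  refine h1.sqrt fun z hz => ?_
  rw [← sphR_sq]
  exact pow_ne_zero 2 (sphR_ne_zero hz)

theorem differentiableAt_sphR {z : Coord n} (hz : z ∈ puncturedDomain n a) :
    DifferentiableAt ℝ (sphR h a) z :=
  (contDiffOn_sphR.contDiffAt ((isOpen_puncturedDomain a).mem_nhds hz)).differentiableAt (by simp)

theorem differentiableAt_normSqCoord {z : Coord n} (hz : z ∈ coordDomain n a) :
    DifferentiableAt ℝ (normSqCoord h a) z :=
  ((contDiffOn_normSqCoord h a).contDiffAt ((isOpen_coordDomain a).mem_nhds hz)).differentiableAt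
    (by simp)

theorem differentiableAt_cosR {z : Coord n} (hz : z ∈ coordDomain n a) (h0 : cosR h a z ≠ 0) :
    DifferentiableAt ℝ (cosR h a) z := by
  have h1 : DifferentiableAt ℝ (fun z : Coord n => normSqCoord h a z + z.2.2.2 ^ 2) z :=
    (differentiableAt_normSqCoord hz).add (by fun_prop)
  refine h1.sqrt ?_
  rw [← cosR_sq]
  exact pow_ne_zero 2 h0

theorem differentiableAt_sphP {z : Coord n} (hz : z ∈ puncturedDomain n a) :
    DifferentiableAt ℝ (sphP h a) z :=
  differentiableAt_fst.prodMk
    (((differentiableAt_sphR hz).inv (sphR_ne_zero hz)).smul differentiableAt_snd)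

theorem differentiableAt_cosP {z : Coord n} (hz : z ∈ coordDomain n a) (h0 : cosR h a z ≠ 0) :
    DifferentiableAt ℝ (cosP h a) z := by
  have h1 : DifferentiableAt ℝ (fun z => (cosR h a z)⁻¹) z := (differentiableAt_cosR hz h0).inv h0
  exact differentiableAt_fst.prodMk ((h1.smul (by fun_prop)).prodMk
    (DifferentiableAt.prodMk (by fun_prop) (h1.mul (by fun_prop))))

theorem differentiable_shiftC (R : ℝ) (i : ℤ) : Differentiable ℝ (shiftC (n := n) R i) := by
  unfold shiftC
  fun_prop

theorem cosR_eq_zero_iff {z : Coord n} (hz : z ∈ coordDomain n a) :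
    cosR h a z = 0 ↔ z.2.1 = 0 ∧ z.2.2.2 = 0 := by
  have h1 := cosR_sq (h := h) (a := a) z
  have h2 := normSqCoord_nonneg h a z
  rw [← normSqCoord_eq_zero h hz]
  constructor
  · intro h0
    rw [h0] at h1
    constructor
    · nlinarith [sq_nonneg z.2.2.2]
    · nlinarith [sq_nonneg z.2.2.2]
  · rintro ⟨h3, h4⟩
    rw [h3, h4] at h1
    exact pow_eq_zero_iff two_ne_zero |>.mp (by simpa using h1)

theorem cosR_smul {z z' : Coord n} {c : ℝ} (hc : 0 ≤ c) (h1 : z'.1 = z.1)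
    (h2 : z'.2.1 = c • z.2.1) (h3 : z'.2.2.2 = c * z.2.2.2) : cosR h a z' = c * cosR h a z := by
  rw [← Real.sqrt_sq (mul_nonneg hc (cosR_nonneg z)), cosR_eq, mul_pow, cosR_sq,
    normSqCoord_smul' (z' := z) c h1 h2, h3]
  congr 1
  ring

theorem cosR_cosP {z : Coord n} (h0 : cosR h a z ≠ 0) : cosR h a (cosP h a z) = 1 := by
  rw [cosR_smul (z := z) (z' := cosP h a z) (c := (cosR h a z)⁻¹) (inv_nonneg.mpr (cosR_nonneg z)) rfl rfl rfl,
    inv_mul_cancel₀ h0]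

theorem cosR_shiftC {R : ℝ} (hR : 0 ≤ R) (i : ℤ) (z : Coord n) :
    cosR h a (shiftC R i z) = R * cosR h a z := cosR_smul hR rfl rfl rfl

theorem mem_punctured_of_cosR {z : Coord n} (hz : z ∈ coordDomain n a) (h0 : cosR h a z ≠ 0) :
    z ∈ puncturedDomain n a := by
  refine ⟨hz, fun h1 => h0 ?_⟩
  rw [cosR_eq_zero_iff hz, h1]
  exact ⟨rfl, rfl⟩

end Radial

/-! ### Changes of canonical coordinates -/

section Determinant

theorem det_triangular {V W : Type*} [AddCommGroup V] [Module ℝ V] [AddCommGroup W] [Module ℝ W]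
    [FiniteDimensional ℝ V] [FiniteDimensional ℝ W] (P : V →ₗ[ℝ] V) (C : V →ₗ[ℝ] W)
    (D : W →ₗ[ℝ] W) (L : V × W →ₗ[ℝ] V × W) (hL : ∀ v w, L (v, w) = (P v, C v + D w)) :
    LinearMap.det L = LinearMap.det P * LinearMap.det D := by
  let b := Module.finBasis ℝ V
  let b' := Module.finBasis ℝ W
  have h : LinearMap.toMatrix (b.prod b') (b.prod b') L =
      Matrix.fromBlocks (LinearMap.toMatrix b b P) 0 (LinearMap.toMatrix b b' C)
        (LinearMap.toMatrix b' b' D) := by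
    ext i j
    rcases i with i | i <;> rcases j with j | j <;>
      simp [LinearMap.toMatrix_apply, hL, Module.Basis.prod_apply]
  rw [← LinearMap.det_toMatrix (b.prod b'), h, Matrix.det_fromBlocks_zero₁₂,
    LinearMap.det_toMatrix, LinearMap.det_toMatrix]

theorem det_adjoint_real {V : Type*} [NormedAddCommGroup V] [InnerProductSpace ℝ V]
    [FiniteDimensional ℝ V] (A : V →L[ℝ] V) :
    LinearMap.det (ContinuousLinearMap.adjoint A : V →ₗ[ℝ] V) = LinearMap.det (A : V →ₗ[ℝ] V) := by
  let b := stdOrthonormalBasis ℝ V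
  have h := LinearMap.toMatrix_adjoint b b (A : V →ₗ[ℝ] V)
  rw [← LinearMap.det_toMatrix b.toBasis]
  have h2 : (ContinuousLinearMap.adjoint A : V →ₗ[ℝ] V) = LinearMap.adjoint (A : V →ₗ[ℝ] V) := rfl
  rw [h2, h, Matrix.det_conjTranspose, LinearMap.det_toMatrix]
  rfl

end Determinant

section Transition

variable {n : ℕ} {M : Type*} [TopologicalSpace M] [ChartedSpace (Euc n) M] [IsManifold (𝓡 n) ∞ M]

/-- The diffeomorphism `g` in the charts at `a` and `b`. -/
def chartMap (g : M ≃ₘ^∞⟮𝓡 n, 𝓡 n⟯ M) (a b : M) (y : Euc n) : Euc n :=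
  extChartAt (𝓡 n) b (g ((extChartAt (𝓡 n) a).symm y))

/-- The domain of `g` in the charts at `a` and `b`. -/
def chartMapDomain (g : M ≃ₘ^∞⟮𝓡 n, 𝓡 n⟯ M) (a b : M) : Set (Euc n) :=
  {y | y ∈ (extChartAt (𝓡 n) a).target ∧ g ((extChartAt (𝓡 n) a).symm y) ∈ (chartAt (Euc n) b).source}

/-- `∂g` in the canonical coordinates over the charts at `a` and `b`. -/
def transC (g : M ≃ₘ^∞⟮𝓡 n, 𝓡 n⟯ M) (a b : M) (z : Coord n) : Coord n :=
  (chartMap g a b z.1, ContinuousLinearMap.adjoint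
    (fderiv ℝ (chartMap g.symm b a) (chartMap g a b z.1)) z.2.1, z.2.2)

/-- The domain of `∂g` in the canonical coordinates over the charts at `a` and `b`. -/
def transDomain (g : M ≃ₘ^∞⟮𝓡 n, 𝓡 n⟯ M) (a b : M) : Set (Coord n) :=
  {z | z.1 ∈ chartMapDomain g a b}

variable {g : M ≃ₘ^∞⟮𝓡 n, 𝓡 n⟯ M} {a b : M}

theorem isOpen_chartMapDomain : IsOpen (chartMapDomain g a b) := by
  have h1 : ContinuousOn (fun y => g ((extChartAt (𝓡 n) a).symm y)) (extChartAt (𝓡 n) a).target :=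
    g.continuous.comp_continuousOn (continuousOn_extChartAt_symm a)
  exact h1.isOpen_inter_preimage (isOpen_extChartAt_target a) (isOpen_source b)

theorem isOpen_transDomain : IsOpen (transDomain g a b) :=
  isOpen_chartMapDomain.preimage continuous_fst

theorem contDiffOn_chartMap : ContDiffOn ℝ ∞ (chartMap g a b) (chartMapDomain g a b) := by
  have h1 : ContMDiffOn 𝓘(ℝ, Euc n) (𝓡 n) ∞ (fun y => g ((extChartAt (𝓡 n) a).symm y))
      (chartMapDomain g a b) :=
    g.contMDiff.comp_contMDiffOn ((contMDiffOn_extChartAt_symm a).mono fun y hy => hy.1)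
  have h2 : ContMDiffOn 𝓘(ℝ, Euc n) 𝓘(ℝ, Euc n) ∞ (chartMap g a b) (chartMapDomain g a b) :=
    (contMDiffOn_extChartAt (n := ∞) (I := 𝓡 n) (x := b)).comp h1 fun y hy => hy.2
  exact h2.contDiffOn

theorem chartMap_mem {y : Euc n} (hy : y ∈ chartMapDomain g a b) :
    chartMap g a b y ∈ chartMapDomain g.symm b a := by
  have h1 : chartMap g a b y ∈ (extChartAt (𝓡 n) b).target :=
    (extChartAt (𝓡 n) b).map_source (by rw [extChartAt_source]; exact hy.2)
  refine ⟨h1, ?_⟩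
  have h2 : (extChartAt (𝓡 n) b).symm (chartMap g a b y) = g ((extChartAt (𝓡 n) a).symm y) :=
    (extChartAt (𝓡 n) b).left_inv (by rw [extChartAt_source]; exact hy.2)
  rw [h2, g.symm_apply_apply]
  exact mem_source_symm hy.1

theorem symm_chartMap {y : Euc n} (hy : y ∈ chartMapDomain g a b) :
    (extChartAt (𝓡 n) b).symm (chartMap g a b y) = g ((extChartAt (𝓡 n) a).symm y) :=
  (extChartAt (𝓡 n) b).left_inv (by rw [extChartAt_source]; exact hy.2)

theorem chartMap_chartMap {y : Euc n} (hy : y ∈ chartMapDomain g a b) :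
    chartMap g.symm b a (chartMap g a b y) = y := by
  rw [chartMap, symm_chartMap hy, g.symm_apply_apply]
  exact (extChartAt (𝓡 n) a).right_inv hy.1

theorem differentiableAt_chartMap {y : Euc n} (hy : y ∈ chartMapDomain g a b) :
    DifferentiableAt ℝ (chartMap g a b) y :=
  (contDiffOn_chartMap.contDiffAt (isOpen_chartMapDomain.mem_nhds hy)).differentiableAt (by simp)

theorem fderiv_chartMap_comp {y : Euc n} (hy : y ∈ chartMapDomain g a b) :
    (fderiv ℝ (chartMap g.symm b a) (chartMap g a b y)).comp (fderiv ℝ (chartMap g a b) y) =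
      ContinuousLinearMap.id ℝ (Euc n) := by
  rw [← fderiv_comp y (differentiableAt_chartMap (chartMap_mem hy)) (differentiableAt_chartMap hy)]
  have h1 : (chartMap g.symm b a ∘ chartMap g a b) =ᶠ[nhds y] id := by
    filter_upwards [isOpen_chartMapDomain.mem_nhds hy] with y' hy' using chartMap_chartMap hy'
  rw [h1.fderiv_eq, fderiv_id]

theorem transC_mem {z : Coord n} (hz : z ∈ transDomain g a b) :
    transC g a b z ∈ transDomain g.symm b a := chartMap_mem hz

theorem transC_transC {z : Coord n} (hz : z ∈ transDomain g a b) :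
    transC g.symm b a (transC g a b z) = z := by
  have h1 : chartMap g.symm b a (chartMap g a b z.1) = z.1 := chartMap_chartMap hz
  refine Prod.ext h1 (Prod.ext ?_ rfl)
  change ContinuousLinearMap.adjoint (fderiv ℝ (chartMap g.symm.symm a b)
    (chartMap g.symm b a (chartMap g a b z.1))) (ContinuousLinearMap.adjoint
    (fderiv ℝ (chartMap g.symm b a) (chartMap g a b z.1)) z.2.1) = z.2.1
  rw [h1]
  have h2 := congrArg ContinuousLinearMap.adjoint (fderiv_chartMap_comp hz)
  rw [ContinuousLinearMap.adjoint_comp] at h2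
  have h3 := DFunLike.congr_fun h2 z.2.1
  rw [ContinuousLinearMap.adjoint_id] at h3
  exact h3

/-- The passage to the adjoint, as a linear map. -/
def adjointL (n : ℕ) : (Euc n →L[ℝ] Euc n) →L[ℝ] (Euc n →L[ℝ] Euc n) :=
  LinearMap.toContinuousLinearMap
    { toFun := fun B => ContinuousLinearMap.adjoint B
      map_add' := fun B B' => map_add _ B B'
      map_smul' := fun c B => by simp }

/-- The product rule for a mapping that is linear in ξ. Its derivative is block triangular with
respect to base and fiber. -/
theorem hasFDerivAt_fiberwise {P : Euc n → Euc n} {A : Euc n → (Euc n →L[ℝ] Euc n)}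
    {P' : Euc n →L[ℝ] Euc n} {A' : Euc n →L[ℝ] (Euc n →L[ℝ] Euc n)} {z : Coord n}
    (hP : HasFDerivAt P P' z.1) (hA : HasFDerivAt A A' z.1) :
    ∃ L : Coord n →L[ℝ] Coord n,
      HasFDerivAt (fun z : Coord n => ((P z.1, A z.1 z.2.1, z.2.2) : Coord n)) L z ∧
      ∀ v : Coord n, L v = (P' v.1, A'.flip z.2.1 v.1 + A z.1 v.2.1, v.2.2) := by
  have hf : HasFDerivAt (fun z : Coord n => z.1)
      (ContinuousLinearMap.fst ℝ (Euc n) (Euc n × ℝ × ℝ)) z := hasFDerivAt_fst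
  have hs : HasFDerivAt (fun z : Coord n => z.2.1)
      ((ContinuousLinearMap.fst ℝ (Euc n) (ℝ × ℝ)).comp
        (ContinuousLinearMap.snd ℝ (Euc n) (Euc n × ℝ × ℝ))) z :=
    (hasFDerivAt_fst (p := z.2)).comp z hasFDerivAt_snd
  have ht : HasFDerivAt (fun z : Coord n => z.2.2)
      ((ContinuousLinearMap.snd ℝ (Euc n) (ℝ × ℝ)).comp
        (ContinuousLinearMap.snd ℝ (Euc n) (Euc n × ℝ × ℝ))) z :=
    (hasFDerivAt_snd (p := z.2)).comp z hasFDerivAt_snd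
  have h1 : HasFDerivAt (fun z : Coord n => P z.1) _ z := hP.comp z hf
  have h2 : HasFDerivAt (fun z : Coord n => A z.1) _ z := hA.comp z hf
  have h5 := h1.prodMk ((h2.clm_apply hs).prodMk ht)
  refine ⟨_, h5, fun v => ?_⟩
  refine Prod.ext rfl (Prod.ext ?_ rfl)
  simp [add_comm]

/-- The block C contains second derivatives of the chart maps. It is left unspecified because it
does not enter the determinant. -/
theorem hasFDerivAt_transC {z : Coord n} (hz : z ∈ transDomain g a b) :
    ∃ C : Euc n →L[ℝ] Euc n, ∃ L : Coord n →L[ℝ] Coord n, HasFDerivAt (transC g a b) L z ∧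
      ∀ v : Coord n, L v = (fderiv ℝ (chartMap g a b) z.1 v.1, C v.1 +
        ContinuousLinearMap.adjoint (fderiv ℝ (chartMap g.symm b a) (chartMap g a b z.1)) v.2.1,
        v.2.2) := by
  have h1 : HasFDerivAt (chartMap g a b) (fderiv ℝ (chartMap g a b) z.1) z.1 :=
    (differentiableAt_chartMap hz).hasFDerivAt
  have hA : DifferentiableAt ℝ
      (fun y => adjointL n (fderiv ℝ (chartMap g.symm b a) (chartMap g a b y))) z.1 := by
    have h2 : DifferentiableAt ℝ (fderiv ℝ (chartMap g.symm b a)) (chartMap g a b z.1) := by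
      have h3 := contDiffOn_chartMap.contDiffAt
        ((isOpen_chartMapDomain (g := g.symm)).mem_nhds (chartMap_mem hz))
      exact (h3.fderiv_right (m := 1) (by norm_cast)).differentiableAt (by simp)
    exact (adjointL n).differentiableAt.comp z.1 (h2.comp z.1 h1.differentiableAt)
  obtain ⟨L, hL, hL2⟩ := hasFDerivAt_fiberwise h1 hA.hasFDerivAt
  exact ⟨_, L, hL, hL2⟩

theorem differentiableAt_transC {z : Coord n} (hz : z ∈ transDomain g a b) :
    DifferentiableAt ℝ (transC g a b) z := by
  obtain ⟨C, L, hL, -⟩ := hasFDerivAt_transC hz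
  exact hL.differentiableAt

/-- The diagonal blocks are the derivative of g and the adjoint of the derivative of its inverse,
whose determinants are reciprocal: lifts to the cotangent bundle preserve volume. -/
theorem det_fderiv_transC {z : Coord n} (hz : z ∈ transDomain g a b) :
    (fderiv ℝ (transC g a b) z).det = 1 := by
  obtain ⟨C, L, hL, hL2⟩ := hasFDerivAt_transC hz
  rw [hL.fderiv]
  set P := fderiv ℝ (chartMap g a b) z.1
  set A := fderiv ℝ (chartMap g.symm b a) (chartMap g a b z.1)
  have h1 := det_triangular (P : Euc n →ₗ[ℝ] Euc n) (LinearMap.prod (C : Euc n →ₗ[ℝ] Euc n) 0)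
    (LinearMap.prodMap (ContinuousLinearMap.adjoint A : Euc n →ₗ[ℝ] Euc n)
      (LinearMap.id : ℝ × ℝ →ₗ[ℝ] ℝ × ℝ)) (L : Coord n →ₗ[ℝ] Coord n) (by
    intro v w
    refine (hL2 (v, w)).trans ?_
    refine Prod.ext rfl (Prod.ext rfl ?_)
    simp)
  rw [LinearMap.det_prodMap, LinearMap.det_id, mul_one, det_adjoint_real] at h1
  have h2 : LinearMap.det ((A : Euc n →ₗ[ℝ] Euc n) ∘ₗ (P : Euc n →ₗ[ℝ] Euc n)) = 1 := by
    have h3 : A.comp P = ContinuousLinearMap.id ℝ (Euc n) := fderiv_chartMap_comp hz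
    have h4 : (A : Euc n →ₗ[ℝ] Euc n) ∘ₗ (P : Euc n →ₗ[ℝ] Euc n) = LinearMap.id := by
      ext1 v; exact DFunLike.congr_fun h3 v
    rw [h4, LinearMap.det_id]
  rw [LinearMap.det_comp] at h2
  rw [ContinuousLinearMap.det, h1, mul_comm]
  exact h2

/-- The transition of canonical coordinates represents `∂g`. -/
theorem codifferentialAmbient_param {z : Coord n} (hz : z ∈ transDomain g a b) :
    codifferentialAmbient g (param a z) = param b (transC g a b z) := by
  have hx := mem_source_symm hz.1
  set x := (extChartAt (𝓡 n) a).symm z.1 with hxdef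
  have hgx : (extChartAt (𝓡 n) b).symm (chartMap g a b z.1) = g x := symm_chartMap hz
  refine Prod.ext ?_ rfl
  have hs1 : (codifferentialAmbient g (param a z)).1 ∈ (cotTriv b).source :=
    mem_cotTriv_source b hz.2
  have hz2 : (transC g a b z).1 ∈ (extChartAt (𝓡 n) b).target := (chartMap_mem hz).1
  have hs2 : (param b (transC g a b z)).1 ∈ (cotTriv b).source :=
    mem_cotTriv_source b (mem_source_symm hz2)
  refine (cotTriv b).injOn hs1 hs2 ?_
  refine Eq.trans ?_ (cotTriv_param b _ hz2).symm
  refine (cotTriv_apply b _ hz.2).trans ?_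
  refine Prod.ext hgx.symm ?_
  ext v
  set A := fderiv ℝ (chartMap g.symm b a) (chartMap g a b z.1)
  let e := g.mfderivToContinuousLinearEquiv (by simp) x
  have he : (e : TangentSpace (𝓡 n) x →L[ℝ] TangentSpace (𝓡 n) (g x)) =
    mfderiv (𝓡 n) (𝓡 n) g x := g.mfderivToContinuousLinearEquiv_coe (by simp)
  -- The chain rule for the identity that recovers the chart at a near x from g, the chart at b, and
  -- the inverse of g in the charts.
  have key : ∀ u : TangentSpace (𝓡 n) x, A (chartDeriv b hz.2 (e u)) = chartDeriv a hx u := by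
    intro u
    have h1 : MDifferentiableAt (𝓡 n) (𝓡 n) g x := g.mdifferentiable (by simp) x
    have h2 : MDifferentiableAt (𝓡 n) 𝓘(ℝ, Euc n) (extChartAt (𝓡 n) b) (g x) :=
      mdifferentiableAt_extChartAt hz.2
    have hy : extChartAt (𝓡 n) b (g x) = chartMap g a b z.1 := rfl
    have h3 : MDifferentiableAt 𝓘(ℝ, Euc n) 𝓘(ℝ, Euc n) (chartMap g.symm b a)
        (extChartAt (𝓡 n) b (g x)) :=
      (differentiableAt_chartMap (chartMap_mem hz)).mdifferentiableAt
    have h4 : (fun x' => chartMap g.symm b a (extChartAt (𝓡 n) b (g x'))) =ᶠ[nhds x]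
        extChartAt (𝓡 n) a := by
      have h5 : ∀ᶠ x' in nhds x, g x' ∈ (chartAt (Euc n) b).source :=
        g.continuous.continuousAt.eventually ((isOpen_source b).mem_nhds hz.2)
      filter_upwards [h5] with x' hx'
      rw [chartMap, (extChartAt (𝓡 n) b).left_inv (by rw [extChartAt_source]; exact hx'),
        g.symm_apply_apply]
    have h6 : mfderiv (𝓡 n) 𝓘(ℝ, Euc n) (fun x' => extChartAt (𝓡 n) b (g x')) x =
        (mfderiv (𝓡 n) 𝓘(ℝ, Euc n) (extChartAt (𝓡 n) b) (g x)).comp (mfderiv (𝓡 n) (𝓡 n) g x) :=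
      mfderiv_comp x h2 h1
    have h7 : mfderiv (𝓡 n) 𝓘(ℝ, Euc n)
        (fun x' => chartMap g.symm b a (extChartAt (𝓡 n) b (g x'))) x =
        (mfderiv 𝓘(ℝ, Euc n) 𝓘(ℝ, Euc n) (chartMap g.symm b a) (extChartAt (𝓡 n) b (g x))).comp
          (mfderiv (𝓡 n) 𝓘(ℝ, Euc n) (fun x' => extChartAt (𝓡 n) b (g x')) x) :=
      mfderiv_comp x h3 (h2.comp x h1)
    have h8 : (mfderiv (𝓡 n) 𝓘(ℝ, Euc n)
        (fun x' => chartMap g.symm b a (extChartAt (𝓡 n) b (g x'))) x : Euc n →L[ℝ] Euc n) =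
        mfderiv (𝓡 n) 𝓘(ℝ, Euc n) (extChartAt (𝓡 n) a) x := h4.mfderiv_eq
    rw [h7, h6, mfderiv_eq_fderiv, ← he, ← coe_chartDeriv b hz.2, ← coe_chartDeriv a hx] at h8
    exact DFunLike.congr_fun h8 u
  -- The two covectors are compared on images of tangent vectors u at x, which exhaust the model
  -- space.
  obtain ⟨w, rfl⟩ := (chartDeriv b hz.2).surjective v
  obtain ⟨u, rfl⟩ := e.surjective w
  have hl : (codifferentialAmbient g (param a z)).1.2 =
      ((innerSL ℝ z.2.1).comp (chartDeriv a hx : TangentSpace (𝓡 n) x →L[ℝ] Euc n)).comp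
        (e.symm : TangentSpace (𝓡 n) (g x) →L[ℝ] TangentSpace (𝓡 n) x) := by
    rw [coe_chartDeriv a hx, ← ContinuousLinearMap.inverse_equiv, he]
    rfl
  have hr : innerSL ℝ (transC g a b z).2.1 (chartDeriv b hz.2 (e u)) =
      innerSL ℝ z.2.1 (chartDeriv a hx u) := by
    rw [← key u]
    exact ContinuousLinearMap.adjoint_inner_left A _ _
  refine Eq.trans ?_ hr.symm
  change (codifferentialAmbient g (param a z)).1.2 ((chartDeriv b hz.2).symm
    (chartDeriv b hz.2 (e u))) = _
  rw [hl]
  have h9 : (chartDeriv b hz.2).symm (chartDeriv b hz.2 (e u)) = e u :=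
    (chartDeriv b hz.2).symm_apply_apply _
  change innerSL ℝ z.2.1 (chartDeriv a hx (e.symm ((chartDeriv b hz.2).symm
    (chartDeriv b hz.2 (e u))))) = _
  rw [h9, e.symm_apply_apply]

theorem normSqCoord_transC {h : Metric n M} (hg : Preserves g h) {z : Coord n}
    (hz : z ∈ transDomain g a b) : normSqCoord h b (transC g a b z) = normSqCoord h a z := by
  have h1 : (param b (transC g a b z)).1 = codifferential g (param a z).1 :=
    (congrArg Prod.fst (codifferentialAmbient_param hz)).symm
  rw [normSqCoord, h1, covectorNormSq_codifferential h g hg]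
  rfl

end Transition

/-! ### The integrand in coordinates -/

section ProductForm

variable {n : ℕ} {M : Type*} [TopologicalSpace M] [ChartedSpace (Euc n) M] [IsManifold (𝓡 n) ∞ M]

/-- The forms `w_{ij} Td` in the canonical coordinates over the chart at `a`. -/
def prodForm (w : MatrixForm n M) (Td : BaseForm n M) (a : M) (i j : ℤ) (z : Coord n) :
    FormAlg (Coord n) :=
  coordForm a (fun q => w q i j * liftBase Td q) z

theorem coordForm_congr {a : M} {θ θ' : AmbientForm n M} {z : Coord n}
    (h : θ (param a z) = θ' (param a z)) : coordForm a θ z = coordForm a θ' z :=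
  formPullback_congr_form _ h

/-- Both sides are the pullback of θ under the base projection of F, factored in two ways. -/
theorem formPullback_liftBase {F : Ambient n M → Ambient n M} {f : M → M} {q : Ambient n M}
    (hF : MDifferentiableAt (ambientModel n) (ambientModel n) F q)
    (hf : MDifferentiableAt (𝓡 n) (𝓡 n) f q.1.1) (hFf : ∀ q, (F q).1.1 = f q.1.1)
    (θ : BaseForm n M) :
    formPullback (ambientModel n) (ambientModel n) F (liftBase θ) q =
      liftBase (formPullback (𝓡 n) (𝓡 n) f θ) q := by
  have h1 := formPullback_comp (I₃ := 𝓡 n) (mdifferentiableAt_base (F q)) hF θ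
  have h2 := formPullback_comp (I₃ := 𝓡 n) (f := fun q : Ambient n M => q.1.1) hf
    (mdifferentiableAt_base q) θ
  refine h1.symm.trans (Eq.trans ?_ h2)
  exact formPullback_congr (Filter.Eventually.of_forall hFf) θ

theorem formPullback_liftBase_of_base {F : Ambient n M → Ambient n M} {q : Ambient n M}
    (hF : MDifferentiableAt (ambientModel n) (ambientModel n) F q)
    (hFf : ∀ q, (F q).1.1 = q.1.1) (θ : BaseForm n M) :
    formPullback (ambientModel n) (ambientModel n) F (liftBase θ) q = liftBase θ q := by
  have h1 := formPullback_comp (I₃ := 𝓡 n) (mdifferentiableAt_base (F q)) hF θ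
  exact h1.symm.trans (formPullback_congr (Filter.Eventually.of_forall hFf) θ)

variable {h : Metric n M} {g : M ≃ₘ^∞⟮𝓡 n, 𝓡 n⟯ M} {Td : BaseForm n M} {w : MatrixForm n M}
  {a b : M}

/-- The radial projection covers the identity of M, so multiplication by the lifted form Td
preserves radiality. -/
theorem prodForm_radial (hw : IsInvariantSphereForm h g w) {z : Coord n}
    (hz : z ∈ puncturedDomain n a) (i j : ℤ) :
    pull (fderiv ℝ (sphP h a) z) (prodForm w Td a i j (sphP h a z)) = prodForm w Td a i j z := by
  have hF : ∀ᶠ z' in nhds z, sphereProj h (param a z') = param a (sphP h a z') :=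
    Filter.Eventually.of_forall fun z' => sphereProj_param h a z'
  rw [prodForm, ← coordForm_formPullback hz.1 (sphP_mem hz).1 hF (differentiableAt_sphP hz)]
  refine coordForm_congr ?_
  rw [formPullback_mul, hw.radial _ (sphR_ne_zero hz), formPullback_liftBase_of_base
    (mdifferentiableAt_of_coord hz.1 (sphP_mem hz).1 hF (differentiableAt_sphP hz)) fun q => rfl]

/-- The pullbacks under two mappings with the same projection to the sphere bundle agree. -/
theorem pull_prodForm_congr (hw : IsInvariantSphereForm h g w) {F G : Coord n → Coord n}
    {z : Coord n} (hF : DifferentiableAt ℝ F z) (hG : DifferentiableAt ℝ G z)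
    (hFz : F z ∈ puncturedDomain n a) (hGz : G z ∈ puncturedDomain n a)
    (hFG : ∀ᶠ z' in nhds z, sphP h a (F z') = sphP h a (G z')) (i j : ℤ) :
    pull (fderiv ℝ F z) (prodForm w Td a i j (F z)) =
      pull (fderiv ℝ G z) (prodForm w Td a i j (G z)) := by
  rw [← prodForm_radial hw hFz, ← prodForm_radial hw hGz, ← pull_comp, ← pull_comp,
    ← fderiv_fun_comp z (differentiableAt_sphP hFz) hF, ← fderiv_fun_comp z (differentiableAt_sphP hGz) hG,
    hFG.self_of_nhds]
  congr 2
  exact Filter.EventuallyEq.fderiv_eq hFG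

/-- Invariance of w moves both indices by one, while Td is invariant itself. -/
theorem prodForm_trans (hw : IsInvariantSphereForm h g w) (hTd : IsToddForm h g Td) {z : Coord n}
    (hz : z ∈ transDomain g a b) (hz0 : z.2 ≠ 0) (i j : ℤ) :
    pull (fderiv ℝ (transC g a b) z) (prodForm w Td b i j (transC g a b z)) =
      prodForm w Td a (i + 1) (j + 1) z := by
  have hF : ∀ᶠ z' in nhds z, codifferentialAmbient g (param a z') = param b (transC g a b z') := by
    filter_upwards [isOpen_transDomain.mem_nhds hz] with z' hz'
    exact codifferentialAmbient_param hz'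
  have hd := differentiableAt_transC hz
  have hm : transC g a b z ∈ coordDomain n b := (chartMap_mem hz).1
  rw [prodForm, ← coordForm_formPullback hz.1 hm hF hd]
  refine coordForm_congr ?_
  rw [formPullback_mul, hw.invariant _ (sphR_ne_zero (h := h) (a := a) ⟨hz.1, hz0⟩),
    formPullback_liftBase (f := g) (mdifferentiableAt_of_coord hz.1 hm hF hd)
      (g.mdifferentiable (by simp) _) fun q => rfl]
  have h2 : formPullback (𝓡 n) (𝓡 n) g Td = Td := funext hTd.invariant
  rw [h2]

theorem continuousOn_liftBase_coeff (hTd : IsToddForm h g Td) (a : M) {k : ℕ}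
    (v : Fin k → Coord n) :
    ContinuousOn (fun z => formEval v (coordForm a (liftBase Td) z)) (coordDomain n a) := by
  have h1 := (hTd.smooth a k (fun l => (v l).1)).continuousOn
  have h2 : ContinuousOn (fun z : Coord n => formEval (V := Euc n) (fun l => (v l).1)
      (inChart Td a z.1)) (coordDomain n a) :=
    h1.comp continuous_fst.continuousOn fun z hz => hz
  refine h2.congr fun z hz => ?_
  simp only [coordForm_liftBase a Td hz]
  exact formEval_pull (V := Coord n) (W := Euc n) _ _ _

theorem continuousOn_prodForm_coeff (hw : IsInvariantSphereForm h g w) (hTd : IsToddForm h g Td)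
    (a : M) (i j : ℤ) {m : ℕ} (u : Fin m → Coord n) :
    ContinuousOn (fun z => formEval u (prodForm w Td a i j z)) (puncturedDomain n a) := by
  obtain ⟨ι, _, k, v, hv⟩ := exists_formEval_mul (Coord n)
  obtain ⟨c, hc⟩ := hv m u
  have h1 : ∀ z, formEval u (prodForm w Td a i j z) = ∑ s, ∑ t, c s t *
      (formEval (v s) (coordForm a (fun q => w q i j) z) *
        formEval (v t) (coordForm a (liftBase Td) z)) := fun z => by
    rw [prodForm, coordForm_mul, hc]
  simp only [h1]
  refine continuousOn_finsetSum _ fun s _ => continuousOn_finsetSum _ fun t _ =>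
    continuousOn_const.mul (ContinuousOn.mul ?_ ?_)
  · exact ((hw.smooth a (k s) (v s)).1 i j).continuousOn
  · exact (continuousOn_liftBase_coeff hTd a (v t)).mono fun z hz => hz.1

/-- Of all the seminorms of w, only the one without derivatives and with the first power of 1 + |i -
j| is needed: it already makes the rows square summable. -/
theorem exists_prodForm_bound (hw : IsInvariantSphereForm h g w) (hTd : IsToddForm h g Td)
    (a : M) {K : Set (Coord n)} (hK : IsCompact K) (hKD : K ⊆ puncturedDomain n a) {m : ℕ}
    (u : Fin m → Coord n) : ∃ C : ℝ, ∀ z ∈ K, ∀ i j : ℤ,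
      ‖formEval u (prodForm w Td a i j z)‖ * (1 + |(i : ℝ) - j|) ≤ C := by
  obtain ⟨ι, _, k, v, hv⟩ := exists_formEval_mul (Coord n)
  obtain ⟨c, hc⟩ := hv m u
  have h1 : ∀ s, ∃ C : ℝ, ∀ z ∈ K, ∀ i j : ℤ,
      ‖formEval (v s) (coordForm a (fun q => w q i j) z)‖ * (1 + |(i : ℝ) - j|) ≤ C := by
    intro s
    obtain ⟨C, hC⟩ := (hw.smooth a (k s) (v s)).2 K hKD hK 0 1
    refine ⟨C, fun z hz i j => ?_⟩
    have := hC z hz i j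
    rwa [norm_iteratedFDeriv_zero, pow_one] at this
  have h2 : ∀ t, ∃ C : ℝ, ∀ z ∈ K, ‖formEval (v t) (coordForm a (liftBase Td) z)‖ ≤ C := fun t =>
    hK.exists_bound_of_continuousOn
      ((continuousOn_liftBase_coeff hTd a (v t)).mono fun z hz => (hKD hz).1)
  choose C₁ hC₁ using h1
  choose C₂ hC₂ using h2
  refine ⟨∑ s, ∑ t, ‖c s t‖ * (C₁ s * C₂ t), fun z hz i j => ?_⟩
  rw [prodForm, coordForm_mul, hc]
  have hp : 0 ≤ 1 + |(i : ℝ) - j| := by positivity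
  refine (mul_le_mul_of_nonneg_right (norm_sum_le _ _) hp).trans ?_
  rw [Finset.sum_mul]
  refine Finset.sum_le_sum fun s _ => ?_
  refine (mul_le_mul_of_nonneg_right (norm_sum_le _ _) hp).trans ?_
  rw [Finset.sum_mul]
  refine Finset.sum_le_sum fun t _ => ?_
  rw [norm_mul, norm_mul]
  have h3 := hC₁ s z hz i j
  have h4 := hC₂ t z hz
  have h5 : 0 ≤ C₁ s := le_trans (by positivity) h3
  calc ‖c s t‖ * (‖formEval (v s) (coordForm a (fun q => w q i j) z)‖ *
        ‖formEval (v t) (coordForm a (liftBase Td) z)‖) * (1 + |(i : ℝ) - j|)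
      = ‖c s t‖ * ((‖formEval (v s) (coordForm a (fun q => w q i j) z)‖ * (1 + |(i : ℝ) - j|)) *
        ‖formEval (v t) (coordForm a (liftBase Td) z)‖) := by ring
    _ ≤ ‖c s t‖ * (C₁ s * C₂ t) := by gcongr

end ProductForm

/-! ### Decay of the matrix entries -/

section Multilinear

/-- A form of degree `2n + 1` vanishes on tuples of which all but one vector come from a space of
dimension `n ≥ 1`. -/
theorem formEval_eq_zero_of_base {n : ℕ} (hn : n ≠ 0) {V : Fin (2 * n + 1) → Coord n}
    (l₀ : Fin (2 * n + 1)) (hV : ∀ l, l ≠ l₀ → (V l).2 = 0) (β : FormAlg (Coord n)) :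
    formEval V β = 0 := by
  rw [← formAlt_apply]
  refine AlternatingMap.map_linearDependent _ V fun hli => ?_
  have h1 : LinearIndependent ℝ (fun l : Fin (2 * n) => V (l₀.succAbove l)) :=
    hli.comp _ Fin.succAbove_right_injective
  have h2 : LinearIndependent ℝ (fun l : Fin (2 * n) => (V (l₀.succAbove l)).1) := by
    refine LinearIndependent.of_comp (LinearMap.inl ℝ (Euc n) (Euc n × ℝ × ℝ)) ?_
    convert h1 using 1
    ext1 l
    exact Prod.ext rfl (hV _ (Fin.succAbove_ne l₀ l)).symm
  -- There would be 2n independent vectors in dimension n.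
  have h3 := h2.fintype_card_le_finrank
  simp at h3
  omega

/-- The values of a form on vectors `X + ε Y + ε' Z`, `|ε'| = ε²`, are of order `ε²` if the terms of
lower order vanish. -/
theorem norm_formEval_le_sq {V : Type*} [NormedAddCommGroup V] [NormedSpace ℝ V] {m : ℕ}
    (v : Fin 3 → Fin m → V) (c : Fin 3 → ℝ) {ε : ℝ} (hε0 : 0 ≤ ε) (hε1 : ε ≤ 1)
    (hc : ∀ j, |c j| = ε ^ (j : ℕ)) (β : FormAlg V)
    (h0 : ∀ r : Fin m → Fin 3, ∑ l, (r l : ℕ) ≤ 1 → formEval (fun l => v (r l) l) β = 0) :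
    ‖formEval (fun l => ∑ j, c j • v j l) β‖ ≤
      ε ^ 2 * ∑ r : Fin m → Fin 3, ‖formEval (fun l => v (r l) l) β‖ := by
  -- Multilinear expansion: r selects one of the three parts of each vector, and its term has size ε
  -- to the power ∑ r l.
  have h1 : formEval (fun l => ∑ j, c j • v j l) β =
      ∑ r : Fin m → Fin 3, (∏ l, c (r l)) • formEval (fun l => v (r l) l) β := by
    have h2 := (formAlt β : V [⋀^Fin m]→ₗ[ℝ] ℂ).toMultilinearMap.map_sum
      (fun l (j : Fin 3) => c j • v j l)
    refine h2.trans (Finset.sum_congr rfl fun r _ => ?_)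
    exact (formAlt β : V [⋀^Fin m]→ₗ[ℝ] ℂ).toMultilinearMap.map_smul_univ
      (fun l => c (r l)) (fun l => v (r l) l)
  rw [h1, Finset.mul_sum]
  refine (norm_sum_le _ _).trans (Finset.sum_le_sum fun r _ => ?_)
  rw [norm_smul, Real.norm_eq_abs, Finset.abs_prod]
  simp only [hc]
  rw [Finset.prod_pow_eq_pow_sum]
  by_cases hr : ∑ l, (r l : ℕ) ≤ 1
  · rw [h0 r hr]; simp
  · exact mul_le_mul_of_nonneg_right (pow_le_pow_of_le_one hε0 hε1 (by omega)) (norm_nonneg _)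

end Multilinear

section Decay

variable {n : ℕ} {M : Type*} [TopologicalSpace M] [ChartedSpace (Euc n) M] [IsManifold (𝓡 n) ∞ M]
  {h : Metric n M} {g : M ≃ₘ^∞⟮𝓡 n, 𝓡 n⟯ M} {Td : BaseForm n M} {w : MatrixForm n M} {a : M}

theorem formEval_coordForm (θ : AmbientForm n M) (z : Coord n) {k : ℕ} (u : Fin k → Coord n) :
    formEval u (coordForm a θ z) = formEval (V := TangentSpace (ambientModel n) (param a z))
      (fun l => mfderiv 𝓘(ℝ, Coord n) (ambientModel n) (param a) z (u l)) (θ (param a z)) :=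
  formEval_pull (V := Coord n) (W := TangentSpace (ambientModel n) (param a z)) _ u _

theorem mdifferentiableAt_scaleShift (R : ℝ) (i : ℤ) {z : Coord n} (hz : z ∈ coordDomain n a) :
    MDifferentiableAt (ambientModel n) (ambientModel n) (scaleShift (M := M) R i) (param a z) :=
  mdifferentiableAt_of_coord (f := shiftC R i) hz hz
    (Filter.Eventually.of_forall fun z' => scaleShift_param a R i z')
    (differentiable_shiftC (n := n) R i z)

theorem familyForm_mul_liftBase (R : ℝ) (w : MatrixForm n M) (Td : BaseForm n M) {z : Coord n}
    (hz : z ∈ coordDomain n a) (i j : ℤ) :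
    formPullback (ambientModel n) (ambientModel n) (scaleShift R i)
        (fun q => w q i j * liftBase Td q) (param a z) =
      familyForm R w (param a z) i j * liftBase Td (param a z) := by
  rw [formPullback_mul, formPullback_liftBase_of_base (mdifferentiableAt_scaleShift R i hz)
    fun q => rfl, familyForm]

theorem coordForm_familyForm (R : ℝ) (w : MatrixForm n M) (Td : BaseForm n M) {z : Coord n}
    (hz : z ∈ coordDomain n a) (i j : ℤ) :
    coordForm a (fun q => familyForm R w q i j * liftBase Td q) z =
      pull (fderiv ℝ (shiftC R i) z) (prodForm w Td a i j (shiftC R i z)) := by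
  have h1 := coordForm_formPullback (b := a) (F := scaleShift R i) (f := shiftC R i) hz hz
    (Filter.Eventually.of_forall fun z' => scaleShift_param a R i z')
    (differentiable_shiftC (n := n) R i z) (fun q => w q i j * liftBase Td q)
  refine Eq.trans ?_ h1
  exact coordForm_congr (familyForm_mul_liftBase R w Td hz i j).symm

theorem topMatrix_param (R : ℝ) (w : MatrixForm n M) (Td : BaseForm n M) {z : Coord n}
    (hz : z ∈ coordDomain n a) (u : Fin (2 * n + 1) → Coord n) (i j : ℤ) :
    topMatrix R w Td (param a z)
      (fun l => mfderiv 𝓘(ℝ, Coord n) (ambientModel n) (param a) z (u l)) i j =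
      formEval u (pull (fderiv ℝ (shiftC R i) z) (prodForm w Td a i j (shiftC R i z))) := by
  rw [← coordForm_familyForm R w Td hz, formEval_coordForm, topMatrix]

/-- The direction of a vector at a point of the cosphere bundle over a manifold of dimension `0`. -/
theorem tau_eq_zero_of_tangent (hn : n = 0) {z : Coord n} (hz : z ∈ coordDomain n a)
    (h1 : cosR h a z = 1) {u : Coord n} (hu : fderiv ℝ (cosR h a) z u = 0) : u.2.2.2 = 0 := by
  subst hn
  -- There are no covectors ξ in dimension 0, so the radius is |τ|; comparing the differentials of
  -- the squares at radius 1 gives the claim.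
  have h2 : ∀ z' ∈ coordDomain 0 a, cosR h a z' ^ 2 = z'.2.2.2 ^ 2 := by
    intro z' hz'
    rw [cosR_sq, (normSqCoord_eq_zero h hz').mpr (Subsingleton.elim _ _), zero_add]
  have hd := differentiableAt_cosR (h := h) hz (by rw [h1]; exact one_ne_zero)
  have h3 : HasFDerivAt (fun z' => cosR h a z' ^ 2) _ z := hd.hasFDerivAt.pow 2
  have h4 : HasFDerivAt (fun z' : Coord 0 => z'.2.2.2 ^ 2) _ z :=
    (((hasFDerivAt_snd (p := z.2.2)).comp z
      ((hasFDerivAt_snd (p := z.2)).comp z (hasFDerivAt_snd (𝕜 := ℝ) (p := z)))).pow 2)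
  have h5 := h4.congr_of_eventuallyEq (f₁ := fun z' => cosR h a z' ^ 2) (by
    filter_upwards [(isOpen_coordDomain a).mem_nhds hz] with z' hz' using h2 z' hz')
  have h6 := DFunLike.congr_fun (h3.unique h5) u
  have h7 : z.2.2.2 ≠ 0 := by
    intro h0
    have := h2 z hz
    rw [h1, h0] at this
    norm_num at this
  simp [hu] at h6
  exact h6.resolve_left h7

/-- The mapping `(x, ξ, t, τ) ↦ (x, cRξ/(t+i), c, cRτ/(t+i))`; it is a positive multiple in the fibers
of `shiftC R i` if `c = ±1` is the sign of `t + i`. -/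
def poleC (R : ℝ) (i : ℤ) (c : ℝ) (z : Coord n) : Coord n :=
  (z.1, (c * R * (z.2.2.1 + i)⁻¹) • z.2.1, c, c * R * (z.2.2.1 + i)⁻¹ * z.2.2.2)

/-- The third component of the mapping is constant, so ∂/∂t enters only through the scale factor, at
order (t + i)⁻². The ξ and τ directions enter at order (t + i)⁻¹, the base directions at order 0. -/
theorem hasFDerivAt_poleC (R : ℝ) (i : ℤ) (c : ℝ) {z : Coord n} (hz : z.2.2.1 + i ≠ 0) :
    ∃ L : Coord n →L[ℝ] Coord n, HasFDerivAt (poleC R i c) L z ∧ ∀ v : Coord n, L v =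
      (v.1, (c * R * (z.2.2.1 + i)⁻¹) • v.2.1 - (c * R * ((z.2.2.1 + i) ^ 2)⁻¹ * v.2.2.1) • z.2.1, 0,
        c * R * (z.2.2.1 + i)⁻¹ * v.2.2.2 - c * R * ((z.2.2.1 + i) ^ 2)⁻¹ * v.2.2.1 * z.2.2.2) := by
  have hf : HasFDerivAt (fun z : Coord n => z.1)
      (ContinuousLinearMap.fst ℝ (Euc n) (Euc n × ℝ × ℝ)) z := hasFDerivAt_fst
  have h2 := hasFDerivAt_snd (𝕜 := ℝ) (p := z)
  have hs : HasFDerivAt (fun z : Coord n => z.2.1) _ z := (hasFDerivAt_fst (p := z.2)).comp z h2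
  have h22 : HasFDerivAt (fun z : Coord n => z.2.2) _ z := (hasFDerivAt_snd (p := z.2)).comp z h2
  have ht : HasFDerivAt (fun z : Coord n => z.2.2.1) _ z :=
    (hasFDerivAt_fst (p := z.2.2)).comp z h22
  have hτ : HasFDerivAt (fun z : Coord n => z.2.2.2) _ z :=
    (hasFDerivAt_snd (p := z.2.2)).comp z h22
  have hi : HasFDerivAt (fun z : Coord n => c * R * (z.2.2.1 + i)⁻¹) _ z :=
    (((hasDerivAt_inv hz).comp_hasFDerivAt z (ht.add_const (i : ℝ))).const_mul (c * R))
  have h5 := hf.prodMk ((hi.smul hs).prodMk ((hasFDerivAt_const c z).prodMk (hi.mul hτ)))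
  refine ⟨_, h5, fun v => ?_⟩
  refine Prod.ext rfl (Prod.ext ?_ (Prod.ext ?_ ?_))
  · simp [sub_eq_add_neg, mul_comm, mul_assoc, mul_left_comm]
  · simp
  · simp
    ring

theorem sphP_poleC {R : ℝ} {i : ℤ} {c : ℝ} {z : Coord n} (hz : 0 < c * (z.2.2.1 + i)) :
    sphP h a (poleC R i c z) = sphP h a (shiftC R i z) := by
  have hne : z.2.2.1 + (i : ℝ) ≠ 0 := fun h0 => by simp [h0] at hz
  have h1 : poleC R i c z = ((shiftC R i z).1, (c * (z.2.2.1 + i)⁻¹) • (shiftC R i z).2) := by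
    refine Prod.ext rfl (Prod.ext ?_ (Prod.ext ?_ ?_))
    · simp only [poleC, shiftC, Prod.smul_fst, smul_smul]
      congr 1; ring
    · simp only [poleC, shiftC, Prod.smul_fst, Prod.smul_snd, smul_eq_mul]
      field_simp
    · simp only [poleC, shiftC, Prod.smul_snd, smul_eq_mul]
      ring
  rw [h1]
  refine sphP_smul _ ?_
  have : c * (z.2.2.1 + i)⁻¹ = c * (z.2.2.1 + i) * ((z.2.2.1 + i)⁻¹) ^ 2 := by field_simp
  rw [this]
  positivity

theorem shiftC_mem {R : ℝ} (hR : 0 < R) (i : ℤ) {z : Coord n} (hz : z ∈ coordDomain n a)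
    (h0 : cosR h a z ≠ 0) : shiftC R i z ∈ puncturedDomain n a := by
  refine mem_punctured_of_cosR (h := h) hz ?_
  rw [cosR_shiftC hR.le]
  exact mul_ne_zero hR.ne' h0

/-- The central estimate. Rescaling to `poleC` keeps the points in one compact set for all i with |t
+ i| ≥ 1. The expansion of the differential in powers of |t + i|⁻¹ then starts at order two on
vectors tangent to the cosphere bundle. -/
theorem exists_summable_bound (hw : IsInvariantSphereForm h g w) (hTd : IsToddForm h g Td) {R : ℝ}
    (hR : 0 < R) {z : Coord n} (hz : z ∈ coordDomain n a) (h1 : cosR h a z = 1)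
    (u : Fin (2 * n + 1) → Coord n) (hu : ∀ l, fderiv ℝ (cosR h a) z (u l) = 0) :
    ∃ m : ℤ → ℝ, Summable m ∧ ∀ i j : ℤ,
      ‖formEval u (pull (fderiv ℝ (shiftC R i) z) (prodForm w Td a i j (shiftC R i z)))‖ *
        (1 + |(i : ℝ) - j|) ≤ m i := by
  have h10 : cosR h a z ≠ 0 := by rw [h1]; exact one_ne_zero
  set t := z.2.2.1
  -- A bound for each single row; it serves the finitely many i with |t + i| < 1.
  have hone : ∀ i : ℤ, ∃ C : ℝ, ∀ j : ℤ,
      ‖formEval u (pull (fderiv ℝ (shiftC R i) z) (prodForm w Td a i j (shiftC R i z)))‖ *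
        (1 + |(i : ℝ) - j|) ≤ C := by
    intro i
    obtain ⟨C, hC⟩ := exists_prodForm_bound hw hTd a (isCompact_singleton (x := shiftC R i z))
      (by simpa using shiftC_mem hR i hz h10) (fun l => fderiv ℝ (shiftC R i) z (u l))
    refine ⟨C, fun j => ?_⟩
    rw [formEval_pull]
    exact hC _ rfl i j
  choose C hC using hone
  let v : Fin 3 → Fin (2 * n + 1) → Coord n := fun j l =>
    if j = 0 then ((u l).1, 0, 0, 0)
    else if j = 1 then (0, R • (u l).2.1, 0, R * (u l).2.2.2)
    else (0, (R * (u l).2.2.1) • z.2.1, 0, R * (u l).2.2.1 * z.2.2.2)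
  have hv0 : ∀ (r : Fin (2 * n + 1) → Fin 3) (β : FormAlg (Coord n)), ∑ l, (r l : ℕ) ≤ 1 →
      formEval (fun l => v (r l) l) β = 0 := by
    intro r β hr
    obtain ⟨l₀, hl₀⟩ : ∃ l₀, ∀ l, l ≠ l₀ → r l = 0 := by
      by_cases hex : ∃ l₀, r l₀ ≠ 0
      · obtain ⟨l₀, hl₀⟩ := hex
        refine ⟨l₀, fun l hl => ?_⟩
        have h2 := Finset.add_le_sum (f := fun l => (r l : ℕ)) (s := Finset.univ)
          (fun _ _ => Nat.zero_le _) (Finset.mem_univ l) (Finset.mem_univ l₀) hl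
        have h3 : (r l₀ : ℕ) ≠ 0 := fun h => hl₀ (Fin.ext h)
        have h4 : (r l : ℕ) = 0 := by
          have h5 : (r l : ℕ) + r l₀ ≤ 1 := h2.trans hr
          omega
        exact Fin.ext h4
      · push Not at hex
        exact ⟨0, fun l _ => hex l⟩
    -- In dimension 0 the form has degree 1 and the base argument is void; instead the parts of
    -- order 0 and 1 vanish, the latter because u is tangent.
    by_cases hn : n = 0
    · have hl : ∀ l : Fin (2 * n + 1), v (r l) l = 0 := by
        intro l
        have h2 : (r l : ℕ) ≤ 1 :=
          (Finset.single_le_sum (f := fun l => (r l : ℕ)) (fun _ _ => Nat.zero_le _)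
            (Finset.mem_univ l)).trans hr
        have h3 := tau_eq_zero_of_tangent hn hz h1 (hu l)
        have hsub : Subsingleton (Euc n) := by subst hn; infer_instance
        have h4 : r l = 0 ∨ r l = 1 := by
          rcases Nat.le_one_iff_eq_zero_or_eq_one.mp h2 with h | h
          · exact Or.inl (Fin.ext h)
          · exact Or.inr (Fin.ext h)
        rcases h4 with h | h
        · simp only [v, h, if_true]
          exact Prod.ext (Subsingleton.elim _ _) rfl
        · simp only [v, h, h3, mul_zero, one_ne_zero, if_false, if_true]
          exact Prod.ext rfl (Prod.ext (Subsingleton.elim _ _) rfl)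
      rw [← formAlt_apply]
      exact AlternatingMap.map_coord_zero _ 0 (hl 0)
    · refine formEval_eq_zero_of_base hn l₀ (fun l hl => ?_) β
      simp [v, hl₀ l hl]
  -- Contains all points `poleC R i c z` with ε ≤ 1 and sign c = ±1; the limits ε = 0 are the poles,
  -- which also lie off the zero section.
  let K : Set (Coord n) := (fun p : ℝ × ℝ => ((z.1, (R * p.1) • z.2.1, p.2, R * p.1 * z.2.2.2) :
    Coord n)) '' (Icc 0 1 ×ˢ {1, -1})
  have hK : IsCompact K := by
    refine (isCompact_Icc.prod (Set.toFinite _).isCompact).image ?_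
    fun_prop
  have hKD : K ⊆ puncturedDomain n a := by
    rintro _ ⟨⟨e, c⟩, ⟨-, hc⟩, rfl⟩
    refine ⟨hz, fun h0 => ?_⟩
    have h2 : c = 0 := congrArg (fun y : Euc n × ℝ × ℝ => y.2.1) h0
    rcases hc with hc | hc
    · rw [h2] at hc; exact zero_ne_one hc
    · rw [h2] at hc; norm_num at hc
  have hb : ∀ r : Fin (2 * n + 1) → Fin 3, ∃ C : ℝ, ∀ z' ∈ K, ∀ i j : ℤ,
      ‖formEval (fun l => v (r l) l) (prodForm w Td a i j z')‖ * (1 + |(i : ℝ) - j|) ≤ C :=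
    fun r => exists_prodForm_bound hw hTd a hK hKD _
  choose B hB using hb
  have hfar : ∀ i j : ℤ, 1 ≤ |t + i| →
      ‖formEval u (pull (fderiv ℝ (shiftC R i) z) (prodForm w Td a i j (shiftC R i z)))‖ *
        (1 + |(i : ℝ) - j|) ≤ (∑ r, B r) * (1 / |(i : ℝ) + t| ^ (2 : ℝ)) := by
    intro i j hi
    have hne : t + (i : ℝ) ≠ 0 := fun h0 => by rw [h0] at hi; norm_num at hi
    obtain ⟨c, hc2, hcpos⟩ : ∃ c : ℝ, (c = 1 ∨ c = -1) ∧ c * (t + i) = |t + i| := by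
      rcases le_total 0 (t + (i : ℝ)) with h2 | h2
      · exact ⟨1, Or.inl rfl, by rw [abs_of_nonneg h2, one_mul]⟩
      · exact ⟨-1, Or.inr rfl, by rw [abs_of_nonpos h2, neg_one_mul]⟩
    have hcsq : c ^ 2 = 1 := by rcases hc2 with rfl | rfl <;> norm_num
    have hpos : 0 < c * (t + i) := by rw [hcpos]; linarith
    set ε := |t + (i : ℝ)|⁻¹ with hε
    have hε0 : 0 ≤ ε := by positivity
    have hε1 : ε ≤ 1 := inv_le_one_of_one_le₀ hi
    have hcε : c * (t + (i : ℝ))⁻¹ = ε := by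
      rw [hε, ← hcpos, mul_inv]
      congr 1
      rcases hc2 with rfl | rfl <;> norm_num
    obtain ⟨L, hL, hL2⟩ := hasFDerivAt_poleC R i c (z := z) hne
    have hpoleK : poleC R i c z ∈ K := by
      refine ⟨(ε, c), ⟨⟨hε0, hε1⟩, hc2⟩, ?_⟩
      change (_ : Coord n) = (z.1, (c * R * (t + i)⁻¹) • z.2.1, c, c * R * (t + i)⁻¹ * z.2.2.2)
      rw [show c * R * (t + (i : ℝ))⁻¹ = R * ε by rw [← hcε]; ring]
    have hev : ∀ᶠ z' : Coord n in nhds z, sphP h a (shiftC R i z') = sphP h a (poleC R i c z') := by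
      have h2 : ContinuousAt (fun z' : Coord n => c * (z'.2.2.1 + i)) z := by fun_prop
      filter_upwards [h2.eventually (lt_mem_nhds hpos)] with z' hz'
      exact (sphP_poleC hz').symm
    rw [pull_prodForm_congr hw (differentiable_shiftC R i z) hL.differentiableAt
      (shiftC_mem hR i hz h10) (hKD hpoleK) hev, hL.fderiv, formEval_pull]
    -- The last coefficient is the t-derivative of c/(t + i), as ε² = (t + i)⁻².
    let cc : Fin 3 → ℝ := fun j => if j = 0 then 1 else if j = 1 then ε else -(c * ε ^ 2)
    have hLv : ∀ l, L (u l) = ∑ k, cc k • v k l := by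
      intro l
      rw [hL2, Fin.sum_univ_three]
      have e1 : c * R * (t + (i : ℝ))⁻¹ = ε * R := by rw [← hcε]; ring
      have e2 : c * R * ((t + (i : ℝ)) ^ 2)⁻¹ = c * ε ^ 2 * R := by
        rw [← hcε, mul_pow, hcsq, one_mul, inv_pow]; ring
      have e1' : c * R * (z.2.2.1 + (i : ℝ))⁻¹ = ε * R := e1
      have e2' : c * R * ((z.2.2.1 + (i : ℝ)) ^ 2)⁻¹ = c * ε ^ 2 * R := e2
      rw [e1', e2']
      refine Prod.ext ?_ (Prod.ext ?_ (Prod.ext ?_ ?_))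
      · simp [v, cc]
      · simp [v, cc, smul_smul, sub_eq_add_neg, mul_assoc]
      · simp [v, cc]
      · simp [v, cc]
        ring
    have hcc : ∀ k, |cc k| = ε ^ (k : ℕ) := by
      intro k
      have habs : |c| = 1 := by rcases hc2 with rfl | rfl <;> norm_num
      fin_cases k
      · simp [cc]
      · simp [cc, abs_of_nonneg hε0]
      · simp [cc, abs_mul, habs]
    simp only [hLv]
    have h3 := norm_formEval_le_sq v cc hε0 hε1 hcc (prodForm w Td a i j (poleC R i c z))
      (fun r hr => hv0 r _ hr)
    have hp : 0 ≤ 1 + |(i : ℝ) - j| := by positivity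
    refine (mul_le_mul_of_nonneg_right h3 hp).trans ?_
    rw [mul_assoc, Finset.sum_mul, mul_comm (∑ r, B r)]
    have h4 : 1 / |(i : ℝ) + t| ^ (2 : ℝ) = ε ^ 2 := by
      rw [hε, add_comm, Real.rpow_two, one_div, inv_pow]
    rw [h4]
    exact mul_le_mul_of_nonneg_left (Finset.sum_le_sum fun r _ => hB r _ hpoleK i j) (by positivity)
  classical
  -- The exceptional values C i occur for finitely many i only and do not affect summability.
  refine ⟨fun i => if 1 ≤ |t + i| then (∑ r, B r) * (1 / |(i : ℝ) + t| ^ (2 : ℝ)) else C i, ?_, ?_⟩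
  · have hs : Summable fun i : ℤ => (∑ r, B r) * (1 / |(i : ℝ) + t| ^ (2 : ℝ)) :=
      ((Real.summable_one_div_int_add_rpow t 2).mpr (by norm_num)).mul_left _
    refine hs.congr_cofinite ?_
    have hfin : {i : ℤ | ¬ 1 ≤ |t + i|}.Finite := by
      refine (Set.finite_Icc ⌊-t - 1⌋ ⌈-t + 1⌉).subset fun i hi => ?_
      simp only [mem_ofPred_eq, not_le, abs_lt] at hi
      constructor
      · have : ((⌊-t - 1⌋ : ℤ) : ℝ) ≤ i := (Int.floor_le _).trans (by linarith)
        exact_mod_cast this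
      · have : (i : ℝ) ≤ ((⌈-t + 1⌉ : ℤ) : ℝ) := le_trans (by linarith) (Int.le_ceil _)
        exact_mod_cast this
    filter_upwards [hfin.compl_mem_cofinite] with i hi
    have : 1 ≤ |t + i| := by simpa using hi
    rw [if_pos this]
  · intro i j
    dsimp only
    split_ifs with hi
    · exact hfar i j hi
    · exact hC i j

end Decay

/-! ### The trace of the family at a point -/

section Pointwise

variable {n : ℕ} {M : Type*} [TopologicalSpace M] [ChartedSpace (Euc n) M] [IsManifold (𝓡 n) ∞ M]
  {h : Metric n M} {g : M ≃ₘ^∞⟮𝓡 n, 𝓡 n⟯ M} {Td : BaseForm n M} {w : MatrixForm n M} {a b : M}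

theorem exists_param_eq (q : Ambient n M) :
    ∃ (a : M) (z : Coord n), z ∈ coordDomain n a ∧ param a z = q :=
  ⟨q.1.1, coords q.1.1 q, (extChartAt (𝓡 n) q.1.1).map_source (mem_extChartAt_source q.1.1),
    param_coords _ q (mem_chart_source _ _)⟩

/-- Carries tangency to the cosphere bundle over to coordinates by the chain rule. Differentiability
of the radius on the manifold is itself deduced from the coordinates. -/
theorem fderiv_cosR_eq_zero {z : Coord n} (hz : z ∈ coordDomain n a) (h0 : cosR h a z ≠ 0)
    {u : Coord n}
    (hu : mfderiv (ambientModel n) 𝓘(ℝ, ℝ) (cosphereRadius h) (param a z)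
      (mfderiv 𝓘(ℝ, Coord n) (ambientModel n) (param a) z u) = (0 : ℝ)) :
    fderiv ℝ (cosR h a) z u = 0 := by
  have hc : MDifferentiableAt (ambientModel n) 𝓘(ℝ, Coord n) (coords a) (param a z) :=
    mdifferentiableAt_coords a _ (mem_source_param hz)
  have hcz : coords a (param a z) = z := coords_param a z hz
  have h1 : MDifferentiableAt (ambientModel n) 𝓘(ℝ, ℝ) (fun q => cosR h a (coords a q))
      (param a z) := by
    have h2 : MDifferentiableAt 𝓘(ℝ, Coord n) 𝓘(ℝ, ℝ) (cosR h a) (coords a (param a z)) := by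
      rw [hcz]; exact (differentiableAt_cosR hz h0).mdifferentiableAt
    exact h2.comp (param a z) hc
  have h3 : MDifferentiableAt (ambientModel n) 𝓘(ℝ, ℝ) (cosphereRadius h) (param a z) := by
    refine h1.congr_of_eventuallyEq ?_
    have h4 : ∀ᶠ q : Ambient n M in nhds (param a z), q.1.1 ∈ (chartAt (Euc n) a).source :=
      (mdifferentiableAt_base (param a z)).continuousAt.eventually
        ((isOpen_source a).mem_nhds (mem_source_param hz))
    filter_upwards [h4] with q hq
    rw [cosR, param_coords a q hq]
  have h5 := mfderiv_comp z h3 (mdifferentiableAt_param a z hz)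
  have h6 : mfderiv 𝓘(ℝ, Coord n) 𝓘(ℝ, ℝ) (cosphereRadius h ∘ param a) z =
    fderiv ℝ (cosR h a) z := mfderiv_eq_fderiv
  rw [← h6, h5]
  exact hu

theorem exists_isTraceClass_topMatrix (hw : IsInvariantSphereForm h g w) (hTd : IsToddForm h g Td)
    {R : ℝ} (hR : 0 < R) (q : Ambient n M) (v : Fin (2 * n + 1) → TangentSpace (ambientModel n) q)
    (hq : cosphereRadius h q = 1)
    (hv : ∀ l, mfderiv (ambientModel n) 𝓘(ℝ, ℝ) (cosphereRadius h) q (v l) = (0 : ℝ)) :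
    ∃ T : SeqSpace →ₗ[ℂ] SeqSpace, IsTraceClass T ∧ matrixOf T = topMatrix R w Td q v := by
  obtain ⟨a, z, hz, rfl⟩ := exists_param_eq q
  choose u hu using fun l => exists_mfderiv_param_eq a hz (v l)
  obtain rfl : (fun l => mfderiv 𝓘(ℝ, Coord n) (ambientModel n) (param a) z (u l)) = v := funext hu
  obtain ⟨m, hm, hb⟩ := exists_summable_bound hw hTd hR hz hq u fun l =>
    fderiv_cosR_eq_zero hz (by rw [show cosR h a z = 1 from hq]; exact one_ne_zero) (hv l)
  refine exists_isTraceClass_of_matrix _ m hm fun i j => ?_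
  rw [topMatrix_param R w Td hz]
  exact hb i j

theorem mdifferentiableAt_codifferentialAmbient (q : Ambient n M) :
    MDifferentiableAt (ambientModel n) (ambientModel n) (codifferentialAmbient g) q := by
  obtain ⟨a, z, hz, rfl⟩ := exists_param_eq q
  have hz' : z ∈ transDomain g a (g (param a z).1.1) := ⟨hz, mem_chart_source _ _⟩
  refine mdifferentiableAt_of_coord hz (chartMap_mem hz').1 ?_ (differentiableAt_transC hz')
  filter_upwards [isOpen_transDomain.mem_nhds hz'] with z' hz'
  exact codifferentialAmbient_param hz'

theorem mdifferentiable_scaleShift (R : ℝ) (i : ℤ) (q : Ambient n M) :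
    MDifferentiableAt (ambientModel n) (ambientModel n) (scaleShift (M := M) R i) q := by
  obtain ⟨a, z, hz, rfl⟩ := exists_param_eq q
  exact mdifferentiableAt_scaleShift R i hz

theorem familyForm_mul (R : ℝ) (w : MatrixForm n M) (Td : BaseForm n M) (i j : ℤ) :
    formPullback (ambientModel n) (ambientModel n) (scaleShift R i)
        (fun q => w q i j * liftBase Td q) =
      fun q => familyForm R w q i j * liftBase Td q := by
  funext q
  obtain ⟨a, z, hz, rfl⟩ := exists_param_eq q
  exact familyForm_mul_liftBase R w Td hz i j

theorem deck_eq (q : Ambient n M) : deck g q = scaleShift 1 1 (codifferentialAmbient g q) := by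
  refine Prod.ext ?_ (Prod.ext ?_ ?_)
  · exact congrArg (TotalSpace.mk (g q.1.1)) (one_smul ℝ (codifferential g q.1).2).symm
  · simp [deck, scaleShift, codifferentialAmbient]
  · simp [deck, scaleShift, codifferentialAmbient]

theorem mdifferentiableAt_deck (q : Ambient n M) :
    MDifferentiableAt (ambientModel n) (ambientModel n) (deck g) q := by
  have h1 : deck g = scaleShift (M := M) 1 1 ∘ codifferentialAmbient g := funext deck_eq
  rw [h1]
  exact (mdifferentiable_scaleShift 1 1 _).comp q (mdifferentiableAt_codifferentialAmbient q)

/-- The translation in the deck transformation raises the shift by one, and ∂g is linear in the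
fibers, so it commutes with the scaling. -/
theorem scaleShift_deck (R : ℝ) (i : ℤ) (q : Ambient n M) :
    scaleShift R i (deck g q) = codifferentialAmbient g (scaleShift R (i + 1) q) := by
  refine Prod.ext ?_ (Prod.ext ?_ rfl)
  · refine congrArg (TotalSpace.mk (g q.1.1)) ?_
    exact (ContinuousLinearMap.smul_comp _ _ _).symm
  · change q.2.1 + 1 + (i : ℝ) = q.2.1 + ((i + 1 : ℤ) : ℝ)
    push_cast
    ring

theorem formPullback_codifferentialAmbient (hw : IsInvariantSphereForm h g w)
    (hTd : IsToddForm h g Td) {q : Ambient n M} (hq : sphereRadius h q ≠ 0) (i j : ℤ) :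
    formPullback (ambientModel n) (ambientModel n) (codifferentialAmbient g)
        (fun q => w q i j * liftBase Td q) q = w q (i + 1) (j + 1) * liftBase Td q := by
  rw [formPullback_mul, hw.invariant q hq, formPullback_liftBase (f := g)
    (mdifferentiableAt_codifferentialAmbient q) (g.mdifferentiable (by simp) _) fun q => rfl]
  have h2 : formPullback (𝓡 n) (𝓡 n) g Td = Td := funext hTd.invariant
  rw [h2]

theorem formPullback_deck (hw : IsInvariantSphereForm h g w) (hTd : IsToddForm h g Td) {R : ℝ}
    {q : Ambient n M} (i j : ℤ) (hq : sphereRadius h (scaleShift R (i + 1) q) ≠ 0) :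
    formPullback (ambientModel n) (ambientModel n) (deck g)
        (fun q => familyForm R w q i j * liftBase Td q) q =
      familyForm R w q (i + 1) (j + 1) * liftBase Td q := by
  rw [← familyForm_mul, ← formPullback_comp (mdifferentiable_scaleShift R i _)
    (mdifferentiableAt_deck q), formPullback_congr
      (Filter.Eventually.of_forall fun q => scaleShift_deck (g := g) R i q),
    formPullback_comp (mdifferentiableAt_codifferentialAmbient _)
      (mdifferentiable_scaleShift R (i + 1) q)]
  refine (formPullback_congr_form _
    (w' := fun q => w q (i + 1) (j + 1) * liftBase Td q) (formPullback_codifferentialAmbient hw hTd hq i j)).trans ?_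
  exact congrFun (familyForm_mul R w Td (i + 1) (j + 1)) q

theorem sphereRadius_scaleShift_ne_zero {R : ℝ} (hR : 0 < R) (i : ℤ) {q : Ambient n M}
    (hq : cosphereRadius h q ≠ 0) : sphereRadius h (scaleShift R i q) ≠ 0 := by
  obtain ⟨a, z, hz, rfl⟩ := exists_param_eq q
  rw [scaleShift_param]
  exact sphR_ne_zero (shiftC_mem hR i hz hq)

/-- The pullback takes the k-th diagonal entry to the (k+1)-st, and a sum over ℤ is invariant under
translation. -/
theorem traceForm_deck (hw : IsInvariantSphereForm h g w) (hTd : IsToddForm h g Td) {R : ℝ}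
    (hR : 0 < R) (q : Ambient n M) (v : Fin (2 * n + 1) → TangentSpace (ambientModel n) q)
    (hq : cosphereRadius h q ≠ 0) :
    traceForm R w Td (deck g q)
        (fun l => mfderiv (ambientModel n) (ambientModel n) (deck g) q (v l)) =
      traceForm R w Td q v := by
  rw [traceForm, traceForm, matrixTrace, matrixTrace, ← (Equiv.addRight (1 : ℤ)).tsum_eq
    (fun k => topMatrix R w Td q v k k)]
  refine tsum_congr fun k => ?_
  have h1 := congrArg (formEval (V := TangentSpace (ambientModel n) q) v)
    (formPullback_deck hw hTd k k (sphereRadius_scaleShift_ne_zero hR (k + 1) hq))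
  refine Eq.trans ?_ h1
  exact (formEval_pull (V := TangentSpace (ambientModel n) q)
    (W := TangentSpace (ambientModel n) (deck g q))
    (mfderiv (ambientModel n) (ambientModel n) (deck g) q) v
    (familyForm R w (deck g q) k k * liftBase Td (deck g q))).symm

end Pointwise

/-! ### Densities in coordinates -/

section Density

variable {n : ℕ} {M : Type*} [TopologicalSpace M] [ChartedSpace (Euc n) M] [IsManifold (𝓡 n) ∞ M]
  {h : Metric n M} {g : M ≃ₘ^∞⟮𝓡 n, 𝓡 n⟯ M} {Td : BaseForm n M} {w : MatrixForm n M} {a b : M}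

/-- The coefficient of the form `ℓ ∧ α` of top degree. -/
def wedgeCoeff (ℓ : Coord n →L[ℝ] ℝ) (α : FormAlg (Coord n)) : ℂ :=
  formEval (frame n) (ExteriorAlgebra.ι ℂ (Complex.ofRealCLM.comp ℓ) * α)

theorem wedgeCoeff_eq (ℓ : Coord n →L[ℝ] ℝ) (α : FormAlg (Coord n)) :
    wedgeCoeff ℓ α = ∑ k : Fin (2 * n + 2), (-1 : ℂ) ^ (k : ℕ) * (ℓ (frame n k) : ℂ) *
      formEval (fun l => frame n (k.succAbove l)) α :=
  formEval_ι_mul (k := 2 * n + 1) (frame n) _ α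

theorem finrank_coord : Module.finrank ℝ (Coord n) = 2 * n + 2 := by
  simp [Coord]
  ring

/-- Only the component of top degree matters, so a pullback multiplies by the determinant. This
matches pullbacks of forms with the change of variables for integrals. -/
theorem wedgeCoeff_pull (A : Coord n →L[ℝ] Coord n) (ℓ : Coord n →L[ℝ] ℝ) (α : FormAlg (Coord n)) :
    wedgeCoeff (ℓ.comp A) (pull A α) = (A.det : ℂ) * wedgeCoeff ℓ α := by
  rw [wedgeCoeff, wedgeCoeff, ← formEval_pull_top finrank_coord, map_mul (pull A), pull_ι]
  rfl

/-- The density of `d|·| ∧ (w₀₀ Td)` outside the zero section. -/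
def sphDensity (h : Metric n M) (w : MatrixForm n M) (Td : BaseForm n M) (a : M) (z : Coord n) : ℂ :=
  wedgeCoeff (fderiv ℝ (sphR h a) z) (prodForm w Td a 0 0 z)

/-- The density of `dr ∧ p^* h_R^* α^i (w_{jj} Td)`, where `r` is the length and `p` the projection to
the cosphere bundle. -/
def cosDensity (h : Metric n M) (w : MatrixForm n M) (Td : BaseForm n M) (R : ℝ) (i j : ℤ) (a : M)
    (z : Coord n) : ℂ :=
  wedgeCoeff (fderiv ℝ (cosR h a) z) (pull (fderiv ℝ (fun z => shiftC R i (cosP h a z)) z)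
    (prodForm w Td a j j (shiftC R i (cosP h a z))))

theorem differentiableAt_shiftC_cosP (R : ℝ) (i : ℤ) {z : Coord n} (hz : z ∈ coordDomain n a)
    (h0 : cosR h a z ≠ 0) : DifferentiableAt ℝ (fun z => shiftC R i (cosP h a z)) z :=
  (differentiable_shiftC R i _).comp z (differentiableAt_cosP hz h0)

theorem formEval_mfderiv (f : Coord n → Ambient n M) (θ : AmbientForm n M) (z : Coord n) {k : ℕ}
    (u : Fin k → Coord n) :
    formEval (V := TangentSpace (ambientModel n) (f z))
      (fun l => mfderiv 𝓘(ℝ, Coord n) (ambientModel n) f z (u l)) (θ (f z)) =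
      formEval (V := Coord n) u (formPullback 𝓘(ℝ, Coord n) (ambientModel n) f θ z) :=
  (formEval_pull (V := Coord n) (W := TangentSpace (ambientModel n) (f z))
    (mfderiv 𝓘(ℝ, Coord n) (ambientModel n) f z) u (θ (f z))).symm

theorem formPullback_param_comp {F : Coord n → Ambient n M} {f : Coord n → Coord n} {z : Coord n}
    (hF : ∀ z', F z' = param a (f z')) (hf : DifferentiableAt ℝ f z) (hz : f z ∈ coordDomain n a)
    (θ : AmbientForm n M) : formPullback 𝓘(ℝ, Coord n) (ambientModel n) F θ z =
      pull (fderiv ℝ f z) (coordForm a θ (f z)) := by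
  rw [formPullback_congr (Filter.Eventually.of_forall hF),
    formPullback_comp (I₂ := 𝓘(ℝ, Coord n)) (mdifferentiableAt_param a _ hz) hf.mdifferentiableAt]
  exact formPullback_eq_pull_fderiv f (coordForm a θ) z

/-- Since w_{00} Td is radial, the projection in the collar density can be dropped. -/
theorem formEval_sphereProj (hw : IsInvariantSphereForm h g w) {z : Coord n}
    (hz : z ∈ puncturedDomain n a) {k : ℕ} (u : Fin k → Coord n) :
    formEval (V := TangentSpace (ambientModel n) (sphereProj h (param a z)))
      (fun l => mfderiv 𝓘(ℝ, Coord n) (ambientModel n) (fun z => sphereProj h (param a z)) z (u l))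
      (w (sphereProj h (param a z)) 0 0 * liftBase Td (sphereProj h (param a z))) =
      formEval u (prodForm w Td a 0 0 z) := by
  have h1 := formPullback_param_comp (a := a) (fun z' => sphereProj_param h a z')
    (differentiableAt_sphP hz) hz.1 (fun q => w q 0 0 * liftBase Td q)
  rw [← prodForm_radial hw hz]
  refine Eq.trans ?_ (congrArg (formEval u) h1)
  exact formEval_mfderiv (fun z => sphereProj h (param a z)) (fun q => w q 0 0 * liftBase Td q) z u

theorem formEval_cosphereProj (R : ℝ) (i j : ℤ) {z : Coord n} (hz : z ∈ coordDomain n a)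
    (h0 : cosR h a z ≠ 0) {k : ℕ} (u : Fin k → Coord n) :
    formEval (V := TangentSpace (ambientModel n) (cosphereProj h (param a z)))
      (fun l => mfderiv 𝓘(ℝ, Coord n) (ambientModel n) (fun z => cosphereProj h (param a z)) z (u l))
      (familyForm R w (cosphereProj h (param a z)) i j * liftBase Td (cosphereProj h (param a z))) =
      formEval u (pull (fderiv ℝ (fun z => shiftC R i (cosP h a z)) z)
        (prodForm w Td a i j (shiftC R i (cosP h a z)))) := by
  have hd := differentiableAt_cosP hz h0
  have h1 := formPullback_param_comp (a := a) (fun z' => cosphereProj_param h a z')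
    hd hz (fun q => familyForm R w q i j * liftBase Td q)
  rw [coordForm_familyForm R w Td (show cosP h a z ∈ coordDomain n a from hz), ← pull_comp,
    ← fderiv_fun_comp z (differentiable_shiftC R i _) hd] at h1
  refine Eq.trans ?_ (congrArg (formEval u) h1)
  exact formEval_mfderiv (fun z => cosphereProj h (param a z))
    (fun q => familyForm R w q i j * liftBase Td q) z u

/-- The transition of coordinates commutes with the projection, the scaling and the translation. -/
theorem cosR_transC (hg : Preserves g h) {z : Coord n} (hz : z ∈ transDomain g a b) :
    cosR h b (transC g a b z) = cosR h a z := by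
  rw [cosR_eq, cosR_eq, normSqCoord_transC hg hz]
  rfl

theorem shiftC_cosP_transC (hg : Preserves g h) (R : ℝ) (i : ℤ) {z : Coord n}
    (hz : z ∈ transDomain g a b) : shiftC R i (cosP h b (transC g a b z)) =
      transC g a b (shiftC R i (cosP h a z)) := by
  rw [cosP, cosR_transC hg hz]
  refine Prod.ext rfl (Prod.ext ?_ rfl)
  simp only [shiftC, transC, cosP, map_smul]

/-- The mapping ∂g has determinant 1, preserves the length and commutes with projection, scaling and
shift. Hence only the position j on the diagonal changes, not the exponent i of the shift. -/
theorem cosDensity_transC (hg : Preserves g h) (hw : IsInvariantSphereForm h g w)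
    (hTd : IsToddForm h g Td) {R : ℝ} (hR : 0 < R) (i j : ℤ) {z : Coord n}
    (hz : z ∈ transDomain g a b) (h0 : cosR h a z ≠ 0) :
    cosDensity h w Td R i j b (transC g a b z) = cosDensity h w Td R i (j + 1) a z := by
  have hT := differentiableAt_transC hz
  have hTm : transC g a b z ∈ coordDomain n b := (chartMap_mem hz).1
  have h0' : cosR h b (transC g a b z) ≠ 0 := by rwa [cosR_transC hg hz]
  have hs := differentiableAt_shiftC_cosP R i hz.1 h0
  have hs' := differentiableAt_shiftC_cosP R i hTm h0'
  have hm : shiftC R i (cosP h a z) ∈ transDomain g a b := hz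
  have hm2 : shiftC R i (cosP h a z) ∈ puncturedDomain n a :=
    shiftC_mem (h := h) hR i hz.1 (by rw [cosR_cosP h0]; exact one_ne_zero)
  have hev : ∀ᶠ z' in nhds z, z' ∈ transDomain g a b := isOpen_transDomain.mem_nhds hz
  have h1 : (fderiv ℝ (cosR h b) (transC g a b z)).comp (fderiv ℝ (transC g a b) z) =
      fderiv ℝ (cosR h a) z := by
    rw [← fderiv_fun_comp z (differentiableAt_cosR hTm h0') hT]
    refine Filter.EventuallyEq.fderiv_eq ?_
    filter_upwards [hev] with z' hz' using cosR_transC hg hz'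
  have h2 : fderiv ℝ (fun z => shiftC R i (cosP h b (transC g a b z))) z =
      fderiv ℝ (fun z => transC g a b (shiftC R i (cosP h a z))) z := by
    refine Filter.EventuallyEq.fderiv_eq ?_
    filter_upwards [hev] with z' hz' using shiftC_cosP_transC hg R i hz'
  have h3 := wedgeCoeff_pull (fderiv ℝ (transC g a b) z) (fderiv ℝ (cosR h b) (transC g a b z))
    (pull (fderiv ℝ (fun z => shiftC R i (cosP h b z)) (transC g a b z))
      (prodForm w Td b j j (shiftC R i (cosP h b (transC g a b z)))))
  rw [det_fderiv_transC hz, Complex.ofReal_one, one_mul] at h3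
  refine h3.symm.trans ?_
  rw [cosDensity, h1, ← pull_comp, ← fderiv_fun_comp z hs' hT, h2,
    fderiv_fun_comp (f := fun z => shiftC R i (cosP h a z)) z (differentiableAt_transC hm) hs,
    pull_comp, shiftC_cosP_transC hg R i hz, prodForm_trans hw hTd hm hm2.2]

/-- The values of the diagonal entries on vectors tangent to the cosphere bundle are summable. -/
theorem summable_formEval (hw : IsInvariantSphereForm h g w) (hTd : IsToddForm h g Td) {R : ℝ}
    (hR : 0 < R) {z : Coord n} (hz : z ∈ coordDomain n a) (h0 : cosR h a z ≠ 0)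
    (u : Fin (2 * n + 1) → Coord n) :
    Summable fun i : ℤ => formEval u (pull (fderiv ℝ (fun z => shiftC R i (cosP h a z)) z)
        (prodForm w Td a i i (shiftC R i (cosP h a z)))) := by
  have hd := differentiableAt_cosP hz h0
  have h1 : cosR h a (cosP h a z) = 1 := cosR_cosP h0
  have hz' : cosP h a z ∈ coordDomain n a := hz
  -- Vectors in the image of the differential of the projection are tangent to the cosphere bundle,
  -- since the length is constant 1 after projection.
  have h2 : ∀ l, fderiv ℝ (cosR h a) (cosP h a z) (fderiv ℝ (cosP h a) z (u l)) = 0 := by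
    intro l
    have h3 : (fderiv ℝ (cosR h a) (cosP h a z)).comp (fderiv ℝ (cosP h a) z) = 0 := by
      rw [← fderiv_fun_comp z (differentiableAt_cosR hz' (by rw [h1]; exact one_ne_zero)) hd]
      have h4 : ∀ᶠ z' in nhds z, cosR h a (cosP h a z') = 1 := by
        filter_upwards [(differentiableAt_cosR hz h0).continuousAt.eventually_ne h0] with z' hz'
          using cosR_cosP hz'
      rw [Filter.EventuallyEq.fderiv_eq (f := fun _ => (1 : ℝ)) h4, fderiv_fun_const]
      rfl
    exact DFunLike.congr_fun h3 (u l)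
  obtain ⟨m, hm, hb⟩ := exists_summable_bound hw hTd hR hz' h1 _ h2
  refine Summable.of_norm_bounded hm fun i => ?_
  have := hb i i
  rw [sub_self, abs_zero, add_zero, mul_one, ← formEval_pull, ← pull_comp,
    ← fderiv_fun_comp z (differentiable_shiftC R i _) hd] at this
  exact this

variable [CompactSpace M] [T2Space M]

/-- The partition of unity in coordinates. -/
def cutoff (a : M) (z : Coord n) : ℝ := chartPartition n M a ((extChartAt (𝓡 n) a).symm z.1)

theorem collarDensity_sphere (hw : IsInvariantSphereForm h g w) {z : Coord n}
    (hz : z ∈ puncturedDomain n a) :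
    collarDensity (sphereRadius h) (sphereProj h) (fun q v => formEval v (w q 0 0 * liftBase Td q))
      a z = cutoff a z • sphDensity h w Td a z := by
  rw [sphDensity, wedgeCoeff_eq, Complex.real_smul]
  refine congrArg (_ * ·) (Finset.sum_congr rfl fun k _ => ?_)
  exact congrArg (_ * ·) (formEval_sphereProj hw hz _)

theorem hasSum_collarDensity (hw : IsInvariantSphereForm h g w) (hTd : IsToddForm h g Td) {R : ℝ}
    (hR : 0 < R) {z : Coord n} (hz : z ∈ coordDomain n a) (h0 : cosR h a z ≠ 0) :
    HasSum (fun i : ℤ => cutoff a z • cosDensity h w Td R i i a z)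
      (collarDensity (cosphereRadius h) (cosphereProj h) (traceForm R w Td) a z) := by
  simp only [Complex.real_smul]
  refine HasSum.mul_left (cutoff a z : ℂ) ?_
  simp only [cosDensity, wedgeCoeff_eq]
  refine hasSum_sum fun k _ => HasSum.mul_left _ ?_
  have h1 := (summable_formEval hw hTd hR hz h0 (fun l => frame n (k.succAbove l))).hasSum
  refine (congrArg (HasSum _) ?_).mp h1
  refine tsum_congr fun i => ?_
  exact (formEval_cosphereProj R i i hz h0 _).symm

end Density

/-! ### Integrals over the cosphere bundle and the action of the isometry -/

section Invariance

open MeasureTheory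

variable {n : ℕ} {M : Type*} [TopologicalSpace M] [ChartedSpace (Euc n) M] [IsManifold (𝓡 n) ∞ M]
  {h : Metric n M} {g : M ≃ₘ^∞⟮𝓡 n, 𝓡 n⟯ M} {a b : M}

instance isAddHaarMeasure_coord (n : ℕ) : (volume : Measure (Coord n)).IsAddHaarMeasure := by
  have h1 : (volume : Measure (ℝ × ℝ)).IsAddHaarMeasure :=
    Measure.prod.instIsAddHaarMeasure volume volume
  have h2 : (volume : Measure (Euc n × ℝ × ℝ)).IsAddHaarMeasure :=
    Measure.prod.instIsAddHaarMeasure volume volume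
  exact Measure.prod.instIsAddHaarMeasure volume volume

/-- The part of the collar of the cosphere bundle with `t ∈ J`, in coordinates. -/
def cosCollar (h : Metric n M) (J : Set ℝ) (a : M) : Set (Coord n) :=
  collar (cosphereRadius h) J a

theorem cosR_ne_zero_of_mem {J : Set ℝ} {z : Coord n} (hz : z ∈ cosCollar h J a) :
    cosR h a z ≠ 0 := (lt_trans one_pos hz.2.2.1).ne'

theorem continuousOn_normSqCoord : ContinuousOn (normSqCoord h a) (coordDomain n a) :=
  (contDiffOn_normSqCoord h a).continuousOn

theorem continuousOn_cosR : ContinuousOn (cosR h a) (coordDomain n a) :=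
  (continuousOn_normSqCoord.add (by fun_prop)).sqrt

theorem continuousOn_sphR : ContinuousOn (sphR h a) (coordDomain n a) :=
  ((continuousOn_normSqCoord.add (by fun_prop)).add (by fun_prop)).sqrt

theorem measurableSet_cosCollar {J : Set ℝ} (hJ : MeasurableSet J) :
    MeasurableSet (cosCollar h J a) := by
  have h1 : MeasurableSet (coordDomain n a ∩ cosR h a ⁻¹' Ioo 1 2) :=
    (continuousOn_cosR.isOpen_inter_preimage (isOpen_coordDomain a) isOpen_Ioo).measurableSet
  have h2 : MeasurableSet {z : Coord n | z.2.2.1 ∈ J} :=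
    (by fun_prop : Measurable fun z : Coord n => z.2.2.1) hJ
  convert h1.inter h2 using 1
  ext z
  exact ⟨fun hz => ⟨⟨hz.1, hz.2.2⟩, hz.2.1⟩, fun hz => ⟨hz.1.1, hz.2, hz.1.2⟩⟩

theorem image_transC_cosCollar (hg : Preserves g h) (J : Set ℝ) (a b : M) :
    transC g a b '' (cosCollar h J a ∩ transDomain g a b) =
      cosCollar h J b ∩ transDomain g.symm b a := by
  have key : ∀ {g : M ≃ₘ^∞⟮𝓡 n, 𝓡 n⟯ M} {a b : M}, Preserves g h →
      ∀ z ∈ cosCollar h J a ∩ transDomain g a b,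
        transC g a b z ∈ cosCollar h J b ∩ transDomain g.symm b a := by
    rintro g a b hg z ⟨hz, hT⟩
    refine ⟨⟨(chartMap_mem hT).1, hz.2.1, ?_⟩, transC_mem hT⟩
    have := cosR_transC hg hT
    rw [cosR] at this
    rw [this]
    exact hz.2.2
  refine Subset.antisymm (image_subset_iff.mpr (key hg)) fun z hz => ?_
  have h1 : cosR h a (transC g.symm b a z) = cosR h b z := by
    have h2 : transC g a b (transC g.symm b a z) = z := transC_transC hz.2
    have h3 : transC g.symm b a z ∈ transDomain g a b := transC_mem hz.2
    rw [← cosR_transC hg h3, h2]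
  refine ⟨transC g.symm b a z, ⟨⟨(chartMap_mem hz.2).1, hz.1.2.1, ?_⟩, transC_mem hz.2⟩,
    transC_transC hz.2⟩
  change cosR h a (transC g.symm b a z) ∈ _
  rw [h1]
  exact hz.1.2.2

variable [CompactSpace M] [T2Space M]

theorem cutoff_nonneg (a : M) (z : Coord n) : 0 ≤ cutoff a z := (chartPartition n M).nonneg _ _

theorem mem_source_of_partition_ne_zero {x : M} (hx : chartPartition n M a x ≠ 0) :
    x ∈ (chartAt (Euc n) a).source :=
  (SmoothPartitionOfUnity.exists_isSubordinate_chartAt_source (𝓡 n) M).choose_spec a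
    (subset_tsupport _ hx)

theorem tsupport_partition_subset (a : M) :
    tsupport (chartPartition n M a) ⊆ (chartAt (Euc n) a).source :=
  (SmoothPartitionOfUnity.exists_isSubordinate_chartAt_source (𝓡 n) M).choose_spec a

variable (n M) in
theorem exists_finset_partition : ∃ A : Finset M, ∀ a ∉ A, ∀ x, chartPartition n M a x = 0 := by
  have h1 := (chartPartition n M).locallyFinite.finite_nonempty_of_compact
  refine ⟨h1.toFinset, fun a ha x => ?_⟩
  by_contra hx
  exact ha (h1.mem_toFinset.mpr ⟨x, hx⟩)

theorem sum_partition {A : Finset M} (hA : ∀ a ∉ A, ∀ x, chartPartition n M a x = 0) (x : M) :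
    ∑ a ∈ A, chartPartition n M a x = 1 := by
  refine (chartPartition n M).sum_finsupport' x (mem_univ x) fun a ha => ?_
  by_contra h0
  exact (SmoothPartitionOfUnity.mem_finsupport _ _).mp ha (hA a h0 x)

theorem cutoff_eq_zero {A : Finset M} (hA : ∀ a ∉ A, ∀ x, chartPartition n M a x = 0) (ha : a ∉ A)
    (z : Coord n) : cutoff a z = 0 := hA a ha _

theorem continuousOn_partition_comp {f : M → M} (hf : Continuous f) (a b : M) :
    ContinuousOn (fun z : Coord n => chartPartition n M a (f ((extChartAt (𝓡 n) b).symm z.1)))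
      (coordDomain n b) := by
  have h1 : ContinuousOn (fun z : Coord n => (extChartAt (𝓡 n) b).symm z.1) (coordDomain n b) :=
    (continuousOn_extChartAt_symm b).comp continuous_fst.continuousOn fun z hz => hz
  exact ((chartPartition n M a).contMDiff.continuous.comp hf).comp_continuousOn h1

theorem integrableOn_partition_smul {E : Type*} [NormedAddCommGroup E] [NormedSpace ℝ E]
    {J : Set ℝ} (hJ : MeasurableSet J) {f : M → M} (hf : Continuous f) (a b : M) {G : Coord n → E}
    (hG : IntegrableOn G (cosCollar h J b)) :
    IntegrableOn (fun z => chartPartition n M a (f ((extChartAt (𝓡 n) b).symm z.1)) • G z)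
      (cosCollar h J b) := by
  refine Integrable.bdd_smul (φ := fun z : Coord n =>
    chartPartition n M a (f ((extChartAt (𝓡 n) b).symm z.1))) hG 1 ?_ (ae_of_all _ fun z => ?_)
  · exact ((continuousOn_partition_comp hf a b).mono fun z hz => hz.1).aestronglyMeasurable
      (measurableSet_cosCollar hJ)
  · rw [Real.norm_of_nonneg ((chartPartition n M).nonneg _ _)]
    exact (chartPartition n M).le_one _ _

section Transport

variable {E : Type*} [NormedAddCommGroup E] [NormedSpace ℝ E] {J : Set ℝ} {F G : M → Coord n → E}

/-- The parts of the integrals over the overlap of two charts agree. -/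
theorem integral_transC (hg : Preserves g h) (hJ : MeasurableSet J)
    (hFG : ∀ a b, ∀ z ∈ transDomain g a b, cosR h a z ≠ 0 → G b (transC g a b z) = F a z)
    (hG : ∀ b, IntegrableOn (fun z => cutoff b z • G b z) (cosCollar h J b)) (a b : M) :
    IntegrableOn (fun z => chartPartition n M b (g ((extChartAt (𝓡 n) a).symm z.1)) •
      cutoff a z • F a z) (cosCollar h J a) ∧
    ∫ z in cosCollar h J a, chartPartition n M b (g ((extChartAt (𝓡 n) a).symm z.1)) •
      cutoff a z • F a z =
    ∫ z in cosCollar h J b, chartPartition n M a (g.symm ((extChartAt (𝓡 n) b).symm z.1)) •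
      cutoff b z • G b z := by
  set ψ : Coord n → E := fun z => chartPartition n M b (g ((extChartAt (𝓡 n) a).symm z.1)) •
      cutoff a z • F a z with hψ
  set ψ' : Coord n → E := fun z => chartPartition n M a (g.symm ((extChartAt (𝓡 n) b).symm z.1)) •
      cutoff b z • G b z with hψ'
  have hint : IntegrableOn ψ' (cosCollar h J b) :=
    integrableOn_partition_smul hJ g.symm.continuous a b (hG b)
  set C := cosCollar h J a ∩ transDomain g a b with hC
  set C' := cosCollar h J b ∩ transDomain g.symm b a with hC'
  have hCm : MeasurableSet C := (measurableSet_cosCollar hJ).inter isOpen_transDomain.measurableSet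
  have himg : transC g a b '' C = C' := image_transC_cosCollar hg J a b
  have hder : ∀ z ∈ C, HasFDerivWithinAt (transC g a b) (fderiv ℝ (transC g a b) z) C z :=
    fun z hz => (differentiableAt_transC hz.2).hasFDerivAt.hasFDerivWithinAt
  have hinj : InjOn (transC g a b) C := fun z hz z' hz' he => by
    rw [← transC_transC hz.2, he, transC_transC hz'.2]
  -- The determinant is 1, and the two cutoff functions exchange their roles under g.
  have heq : ∀ z ∈ C, |(fderiv ℝ (transC g a b) z).det| • ψ' (transC g a b z) = ψ z := by
    intro z hz
    have h1 : (extChartAt (𝓡 n) b).symm (transC g a b z).1 = g ((extChartAt (𝓡 n) a).symm z.1) :=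
      symm_chartMap hz.2
    rw [det_fderiv_transC hz.2, abs_one, one_smul, hψ', hψ]
    simp only [cutoff]
    rw [h1, g.symm_apply_apply, hFG a b z hz.2 (cosR_ne_zero_of_mem hz.1), smul_comm]
  -- Outside the overlap the cutoff of b, taken at the image point, vanishes, because it is nonzero
  -- only in the chart domain.
  have hz0 : ∀ z ∈ cosCollar h J a \ C, ψ z = 0 := by
    intro z hz
    by_contra h0
    refine hz.2 ⟨hz.1, hz.1.1, mem_source_of_partition_ne_zero fun h1 => h0 ?_⟩
    simp only [hψ]
    rw [h1, zero_smul]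
  have hz0' : ∀ z ∈ cosCollar h J b \ C', ψ' z = 0 := by
    intro z hz
    by_contra h0
    refine hz.2 ⟨hz.1, hz.1.1, mem_source_of_partition_ne_zero fun h1 => h0 ?_⟩
    simp only [hψ']
    rw [h1, zero_smul]
  have hi1 : IntegrableOn ψ C := by
    have h1 := (integrableOn_image_iff_integrableOn_abs_det_fderiv_smul volume hCm hder hinj ψ').mp
      (by rw [himg]; exact hint.mono_set inter_subset_left)
    exact h1.congr_fun heq hCm
  refine ⟨hi1.of_forall_sdiff_eq_zero (measurableSet_cosCollar hJ) hz0, ?_⟩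
  have h2 : ∫ z in cosCollar h J a, ψ z = ∫ z in C, ψ z :=
    setIntegral_eq_of_subset_of_forall_sdiff_eq_zero (measurableSet_cosCollar hJ)
      inter_subset_left hz0
  have h3 : ∫ z in cosCollar h J b, ψ' z = ∫ z in C', ψ' z :=
    setIntegral_eq_of_subset_of_forall_sdiff_eq_zero (measurableSet_cosCollar hJ)
      inter_subset_left hz0'
  rw [h2, h3, ← himg,
    integral_image_eq_integral_abs_det_fderiv_smul volume hCm hder hinj ψ']
  exact (setIntegral_congr_fun hCm heq).symm

/-- Inserting a second partition of unity, moved by g or its inverse, splits each side into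
integrals over overlaps of two charts, which agree pairwise. -/
theorem sum_integral_transC (hg : Preserves g h) (hJ : MeasurableSet J) {A : Finset M}
    (hA : ∀ a ∉ A, ∀ x, chartPartition n M a x = 0)
    (hFG : ∀ a b, ∀ z ∈ transDomain g a b, cosR h a z ≠ 0 → G b (transC g a b z) = F a z)
    (hG : ∀ b, IntegrableOn (fun z => cutoff b z • G b z) (cosCollar h J b)) :
    (∀ a, IntegrableOn (fun z => cutoff a z • F a z) (cosCollar h J a)) ∧
    ∑ a ∈ A, ∫ z in cosCollar h J a, cutoff a z • F a z =
      ∑ b ∈ A, ∫ z in cosCollar h J b, cutoff b z • G b z := by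
  have h1 := integral_transC hg hJ hFG hG
  have h2 : ∀ a, (fun z => cutoff a z • F a z) = fun z => ∑ b ∈ A,
      chartPartition n M b (g ((extChartAt (𝓡 n) a).symm z.1)) • cutoff a z • F a z := by
    intro a
    funext z
    rw [← Finset.sum_smul, sum_partition hA, one_smul]
  have h3 : ∀ b, (fun z => cutoff b z • G b z) = fun z => ∑ a ∈ A,
      chartPartition n M a (g.symm ((extChartAt (𝓡 n) b).symm z.1)) • cutoff b z • G b z := by
    intro b
    funext z
    rw [← Finset.sum_smul, sum_partition hA, one_smul]
  refine ⟨fun a => ?_, ?_⟩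
  · rw [h2]
    exact integrable_finsetSum _ fun b _ => (h1 a b).1
  · simp only [h2, h3]
    rw [Finset.sum_congr rfl fun a _ => integral_finsetSum A fun b _ => (h1 a b).1,
      Finset.sum_comm, Finset.sum_congr rfl fun b _ => Finset.sum_congr rfl fun a _ => (h1 a b).2]
    refine Finset.sum_congr rfl fun b _ => ?_
    rw [integral_finsetSum A fun a _ => integrableOn_partition_smul hJ g.symm.continuous a b (hG b)]

end Transport

end Invariance

/-! ### Independence of the position on the diagonal -/

section DiagonalShift

open MeasureTheory

variable {n : ℕ} {M : Type*} [TopologicalSpace M] [ChartedSpace (Euc n) M] [IsManifold (𝓡 n) ∞ M]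
  {h : Metric n M} {g : M ≃ₘ^∞⟮𝓡 n, 𝓡 n⟯ M} {Td : BaseForm n M} {w : MatrixForm n M} {a b : M}

theorem preserves_symm (hg : Preserves g h) : Preserves g.symm h := by
  intro x v w
  obtain ⟨y, rfl⟩ := g.surjective x
  let e := g.mfderivToContinuousLinearEquiv (by simp) y
  have he : (e : TangentSpace (𝓡 n) y →L[ℝ] TangentSpace (𝓡 n) (g y)) =
    mfderiv (𝓡 n) (𝓡 n) g y := g.mfderivToContinuousLinearEquiv_coe (by simp)
  have h1 : ∀ u : Euc n, (mfderiv (𝓡 n) (𝓡 n) g.symm (g y) (mfderiv (𝓡 n) (𝓡 n) g y u) : Euc n) =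
      u := by
    intro u
    have h2 := mfderiv_comp y (g.symm.mdifferentiable (by simp) (g y))
      (g.mdifferentiable (by simp) y)
    have h3 : (g.symm ∘ g : M → M) =ᶠ[nhds y] id :=
      Filter.Eventually.of_forall g.symm_apply_apply
    have h4 : (mfderiv (𝓡 n) (𝓡 n) (g.symm ∘ g) y : Euc n →L[ℝ] Euc n) =
      ContinuousLinearMap.id ℝ (Euc n) := h3.mfderiv_eq.trans mfderiv_id
    exact (DFunLike.congr_fun h2 u).symm.trans (DFunLike.congr_fun h4 u)
  obtain ⟨v, rfl⟩ := e.surjective v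
  obtain ⟨w, rfl⟩ := e.surjective w
  have h5 := hg y v w
  rw [← he] at h5
  have h6 : ∀ y', y' = y → ∀ v' w' : Euc n, v' = v → w' = w →
      h.inner y' v' w' = h.inner y v w := by
    rintro y' rfl v' w' rfl rfl
    rfl
  refine (h6 (g.symm (g y)) (g.symm_apply_apply y) _ _ ?_ ?_).trans h5.symm
  · exact (congrArg (mfderiv (𝓡 n) (𝓡 n) g.symm (g y)) (DFunLike.congr_fun he v)).trans (h1 v)
  · exact (congrArg (mfderiv (𝓡 n) (𝓡 n) g.symm (g y)) (DFunLike.congr_fun he w)).trans (h1 w)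

theorem cosDensity_transC_symm (hg : Preserves g h) (hw : IsInvariantSphereForm h g w)
    (hTd : IsToddForm h g Td) {R : ℝ} (hR : 0 < R) (i j : ℤ) {z : Coord n}
    (hz : z ∈ transDomain g.symm a b) (h0 : cosR h a z ≠ 0) :
    cosDensity h w Td R i (j + 1) b (transC g.symm a b z) = cosDensity h w Td R i j a z := by
  have h1 : transC g.symm a b z ∈ transDomain g b a := transC_mem hz
  have h2 := cosDensity_transC hg hw hTd hR i j h1
    (by rwa [cosR_transC (preserves_symm hg) hz])
  have h3 : transC g b a (transC g.symm a b z) = z := transC_transC hz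
  rw [← h2, h3]

variable [CompactSpace M] [T2Space M]

theorem norm_cutoff_smul (a : M) (z : Coord n) (c : ℂ) : ‖cutoff a z • c‖ = cutoff a z • ‖c‖ := by
  rw [norm_smul, Real.norm_of_nonneg (cutoff_nonneg a z), smul_eq_mul]

/-- The total integral of the summand with pullback by `α^i` does not depend on the position on the
diagonal. -/
theorem integral_cosDensity_eq (hg : Preserves g h) (hw : IsInvariantSphereForm h g w)
    (hTd : IsToddForm h g Td) {R : ℝ} (hR : 0 < R) {J : Set ℝ} (hJ : MeasurableSet J)
    {A : Finset M} (hA : ∀ a ∉ A, ∀ x, chartPartition n M a x = 0) (i : ℤ)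
    (h0 : ∀ a, IntegrableOn (fun z => cutoff a z • cosDensity h w Td R i 0 a z) (cosCollar h J a))
    (j : ℤ) :
    (∀ a, IntegrableOn (fun z => cutoff a z • cosDensity h w Td R i j a z) (cosCollar h J a)) ∧
    ∑ a ∈ A, ∫ z in cosCollar h J a, cutoff a z • cosDensity h w Td R i j a z =
      ∑ a ∈ A, ∫ z in cosCollar h J a, cutoff a z • cosDensity h w Td R i 0 a z ∧
    ∑ a ∈ A, ∫ z in cosCollar h J a, ‖cutoff a z • cosDensity h w Td R i j a z‖ =
      ∑ a ∈ A, ∫ z in cosCollar h J a, ‖cutoff a z • cosDensity h w Td R i 0 a z‖ := by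
  -- One step along the diagonal, for a general isometry g': it is applied to g going up and to its
  -- inverse going down.
  have step : ∀ (g' : M ≃ₘ^∞⟮𝓡 n, 𝓡 n⟯ M), Preserves g' h → ∀ j k : ℤ,
      (∀ a b, ∀ z ∈ transDomain g' a b, cosR h a z ≠ 0 →
        cosDensity h w Td R i j b (transC g' a b z) = cosDensity h w Td R i k a z) →
      (∀ a, IntegrableOn (fun z => cutoff a z • cosDensity h w Td R i j a z) (cosCollar h J a)) →
      (∀ a, IntegrableOn (fun z => cutoff a z • cosDensity h w Td R i k a z) (cosCollar h J a)) ∧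
      ∑ a ∈ A, ∫ z in cosCollar h J a, cutoff a z • cosDensity h w Td R i k a z =
        ∑ a ∈ A, ∫ z in cosCollar h J a, cutoff a z • cosDensity h w Td R i j a z ∧
      ∑ a ∈ A, ∫ z in cosCollar h J a, ‖cutoff a z • cosDensity h w Td R i k a z‖ =
        ∑ a ∈ A, ∫ z in cosCollar h J a, ‖cutoff a z • cosDensity h w Td R i j a z‖ := by
    intro g' hg' j k hjk hj
    have h1 := sum_integral_transC hg' hJ hA hjk hj
    refine ⟨h1.1, h1.2, ?_⟩
    simp only [norm_cutoff_smul]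
    refine (sum_integral_transC hg' hJ hA (E := ℝ)
      (F := fun a z => ‖cosDensity h w Td R i k a z‖)
      (G := fun a z => ‖cosDensity h w Td R i j a z‖) (fun a b z hz hz0 => ?_) fun b => ?_).2
    · rw [hjk a b z hz hz0]
    · have h2 : IntegrableOn (fun z => ‖cutoff b z • cosDensity h w Td R i j b z‖)
          (cosCollar h J b) := (hj b).norm
      simpa only [norm_cutoff_smul] using h2
  induction j using Int.induction_on with
  | zero => exact ⟨h0, rfl, rfl⟩
  | succ j ih =>
    obtain ⟨h1, h2, h3⟩ := step g hg j (j + 1)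
      (fun a b z hz hz0 => cosDensity_transC hg hw hTd hR i j hz hz0) ih.1
    exact ⟨h1, h2.trans ih.2.1, h3.trans ih.2.2⟩
  | pred j ih =>
    obtain ⟨h1, h2, h3⟩ := step g.symm (preserves_symm hg) (-j) (-j - 1)
      (fun a b z hz hz0 => by
        have := cosDensity_transC_symm hg hw hTd hR i (-j - 1) hz hz0
        rwa [sub_add_cancel] at this) ih.1
    exact ⟨h1, h2.trans ih.2.1, h3.trans ih.2.2⟩

end DiagonalShift

/-! ### The mapping from the cosphere bundle to the sphere bundle -/

section FiberDeterminants

theorem fderiv_eq_zero_of_const_line {V : Type*} [NormedAddCommGroup V] [NormedSpace ℝ V]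
    {f : V → ℝ} {z : V} (hf : DifferentiableAt ℝ f z) (v : V)
    (hc : ∀ᶠ s in nhds (0 : ℝ), f (z + s • v) = f z) : fderiv ℝ f z v = 0 := by
  have h1 : HasDerivAt (fun s : ℝ => f (z + s • v)) (fderiv ℝ f z v) 0 :=
    hf.hasFDerivAt.hasLineDerivAt v
  have h2 : HasDerivAt (fun s : ℝ => f (z + s • v)) 0 0 :=
    (hasDerivAt_const (0 : ℝ) (f z)).congr_of_eventuallyEq hc
  exact h1.unique h2

variable {n : ℕ}

/-- The derivative is the transvection v + (df - dt)(v) ∂/∂t, whose determinant is 1 + (df -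
dt)(∂/∂t). -/
theorem exists_fderiv_replace_t {f : Coord n → ℝ} {z : Coord n} (hf : DifferentiableAt ℝ f z) :
    ∃ L : Coord n →L[ℝ] Coord n,
      HasFDerivAt (fun z : Coord n => ((z.1, z.2.1, f z, z.2.2.2) : Coord n)) L z ∧
      L.det = fderiv ℝ f z (0, 0, 1, 0) := by
  have h1 : HasFDerivAt (fun z : Coord n => z.1) _ z := hasFDerivAt_fst (𝕜 := ℝ)
  have h2 := hasFDerivAt_snd (𝕜 := ℝ) (p := z)
  have hs : HasFDerivAt (fun z : Coord n => z.2.1) _ z := (hasFDerivAt_fst (p := z.2)).comp z h2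
  have h22 : HasFDerivAt (fun z : Coord n => z.2.2) _ z := (hasFDerivAt_snd (p := z.2)).comp z h2
  have hτ : HasFDerivAt (fun z : Coord n => z.2.2.2) _ z :=
    (hasFDerivAt_snd (p := z.2.2)).comp z h22
  refine ⟨_, h1.prodMk (hs.prodMk (hf.hasFDerivAt.prodMk hτ)), ?_⟩
  set L := (ContinuousLinearMap.fst ℝ (Euc n) (Euc n × ℝ × ℝ)).prod
    (((ContinuousLinearMap.fst ℝ (Euc n) (ℝ × ℝ)).comp
      (ContinuousLinearMap.snd ℝ (Euc n) (Euc n × ℝ × ℝ))).prod ((fderiv ℝ f z).prod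
        ((ContinuousLinearMap.snd ℝ ℝ ℝ).comp ((ContinuousLinearMap.snd ℝ (Euc n) (ℝ × ℝ)).comp
          (ContinuousLinearMap.snd ℝ (Euc n) (Euc n × ℝ × ℝ)))))) with hL
  let t : Module.Dual ℝ (Coord n) :=
    LinearMap.fst ℝ ℝ ℝ ∘ₗ LinearMap.snd ℝ (Euc n) (ℝ × ℝ) ∘ₗ LinearMap.snd ℝ (Euc n) (Euc n × ℝ × ℝ)
  have h3 : (L : Coord n →ₗ[ℝ] Coord n) =
      LinearMap.transvection ((fderiv ℝ f z : Coord n →ₗ[ℝ] ℝ) - t) (0, 0, 1, 0) := by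
    refine LinearMap.ext fun v => ?_
    rw [LinearMap.transvection.apply]
    change (v.1, v.2.1, fderiv ℝ f z v, v.2.2.2) = v + (fderiv ℝ f z v - v.2.2.1) • (0, 0, 1, 0)
    refine Prod.ext ?_ (Prod.ext ?_ (Prod.ext ?_ ?_)) <;> simp
  change L.det = _
  rw [ContinuousLinearMap.det, h3, LinearMap.transvection.det]
  change 1 + (fderiv ℝ f z (0, 0, 1, 0) - 1) = _
  ring

/-- The derivative is multiplication by c on the fiber, of dimension n + 2, after a transvection
along the radial vector. The latter has determinant 1 because c is stationary in the radial
direction. -/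
theorem exists_fderiv_fiber_smul {c : Coord n → ℝ} {z : Coord n} (hc : DifferentiableAt ℝ c z)
    (h0 : c z ≠ 0) (hz : fderiv ℝ c z (0, z.2) = 0) :
    ∃ L : Coord n →L[ℝ] Coord n,
      HasFDerivAt (fun z : Coord n => ((z.1, c z • z.2) : Coord n)) L z ∧
      L.det = c z ^ (n + 2) := by
  have h1 : HasFDerivAt (fun z : Coord n => z.1) _ z := hasFDerivAt_fst (𝕜 := ℝ)
  have h2 := hasFDerivAt_snd (𝕜 := ℝ) (p := z)
  obtain ⟨L, hL, hLv⟩ : ∃ L : Coord n →L[ℝ] Coord n,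
      HasFDerivAt (fun z : Coord n => ((z.1, c z • z.2) : Coord n)) L z ∧
      ∀ v : Coord n, L v = (v.1, c z • v.2 + fderiv ℝ c z v • z.2) :=
    ⟨_, h1.prodMk (hc.hasFDerivAt.smul h2), fun v => rfl⟩
  refine ⟨L, hL, ?_⟩
  have h3 : (L : Coord n →ₗ[ℝ] Coord n) =
      (LinearMap.prodMap (LinearMap.id : Euc n →ₗ[ℝ] Euc n)
        (c z • (LinearMap.id : (Euc n × ℝ × ℝ) →ₗ[ℝ] (Euc n × ℝ × ℝ)))) ∘ₗ
      LinearMap.transvection ((c z)⁻¹ • (fderiv ℝ c z : Coord n →ₗ[ℝ] ℝ)) (0, z.2) := by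
    refine LinearMap.ext fun v => ?_
    rw [LinearMap.comp_apply, LinearMap.transvection.apply]
    refine (hLv v).trans ?_
    change _ = ((v + ((c z)⁻¹ * fderiv ℝ c z v) • ((0, z.2) : Coord n)).1,
      c z • (v + ((c z)⁻¹ * fderiv ℝ c z v) • ((0, z.2) : Coord n)).2)
    refine Prod.ext ?_ ?_
    · simp
    · simp only [Prod.snd_add, Prod.smul_snd, smul_add, smul_smul, mul_inv_cancel_left₀ h0]
  rw [ContinuousLinearMap.det, h3, LinearMap.det_comp, LinearMap.transvection.det,
    LinearMap.det_prodMap, LinearMap.det_id, LinearMap.det_smul, LinearMap.det_id]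
  have h4 : ((c z)⁻¹ • (fderiv ℝ c z : Coord n →ₗ[ℝ] ℝ)) (0, z.2) = 0 := by
    rw [LinearMap.smul_apply]
    exact (congrArg ((c z)⁻¹ • ·) hz).trans (smul_zero _)
  rw [h4]
  simp

end FiberDeterminants

/-! ### The mapping between the two collars, its Jacobian and its image -/

section SphereMap

variable {n : ℕ} {M : Type*} [TopologicalSpace M] [ChartedSpace (Euc n) M] [IsManifold (𝓡 n) ∞ M]

/-- The mapping `(x, ξ, t, τ) ↦ (x, ξ, r (t + i) / R, τ)`, where `r` is the length of `(ξ, τ)`. -/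
def stretchC (h : Metric n M) (a : M) (R : ℝ) (i : ℤ) (z : Coord n) : Coord n :=
  (z.1, z.2.1, cosR h a z * (z.2.2.1 + i) / R, z.2.2.2)

/-- The rescaling in the fibers that transforms the length of `(ξ, τ)` to that of `(ξ, t, τ)`. -/
def fiberC (h : Metric n M) (a : M) (z : Coord n) : Coord n :=
  (z.1, (cosR h a z / sphR h a z) • z.2)

/-- The mapping of the cosphere bundle to the sphere bundle which is induced by scaling and
translation, extended to the cone such that it transforms the length of `(ξ, τ)` to that of
`(ξ, t, τ)`. -/
def sphereMap (h : Metric n M) (a : M) (R : ℝ) (i : ℤ) (z : Coord n) : Coord n :=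
  fiberC h a (stretchC h a R i z)

/-- The part of the collar of the sphere bundle which corresponds to `0 ≤ t < 1`. -/
def sphSector (h : Metric n M) (R : ℝ) (i : ℤ) (a : M) : Set (Coord n) :=
  {y | y ∈ coordDomain n a ∧ cosR h a y ≠ 0 ∧ sphR h a y ∈ Ioo 1 2 ∧
    R * y.2.2.1 / cosR h a y ∈ Ico (i : ℝ) (i + 1)}

variable {h : Metric n M} {g : M ≃ₘ^∞⟮𝓡 n, 𝓡 n⟯ M} {Td : BaseForm n M} {w : MatrixForm n M} {a : M}
  {R : ℝ} {i : ℤ} {z : Coord n}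

theorem cosR_congr {z z' : Coord n} (h1 : z.1 = z'.1) (h2 : z.2.1 = z'.2.1)
    (h3 : z.2.2.2 = z'.2.2.2) : cosR h a z = cosR h a z' := by
  rw [cosR_eq, cosR_eq, normSqCoord_congr h1 h2, h3]

theorem cosR_stretchC : cosR h a (stretchC h a R i z) = cosR h a z := cosR_congr rfl rfl rfl

theorem stretchC_mem (hz : z ∈ coordDomain n a) (h0 : cosR h a z ≠ 0) :
    stretchC h a R i z ∈ puncturedDomain n a :=
  mem_punctured_of_cosR (h := h) hz (by rwa [cosR_stretchC])

theorem cosR_div_sphR_pos (hz : z ∈ coordDomain n a) (h0 : cosR h a z ≠ 0) :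
    0 < cosR h a z / sphR h a z :=
  div_pos (lt_of_le_of_ne (cosR_nonneg z) h0.symm) (sphR_pos (mem_punctured_of_cosR hz h0))

theorem sphR_fiberC (hz : z ∈ coordDomain n a) (h0 : cosR h a z ≠ 0) :
    sphR h a (fiberC h a z) = cosR h a z := by
  rw [fiberC, sphR_smul z (cosR_div_sphR_pos hz h0).le]
  exact div_mul_cancel₀ _ (sphR_ne_zero (mem_punctured_of_cosR hz h0))

theorem sphR_sphereMap (hz : z ∈ coordDomain n a) (h0 : cosR h a z ≠ 0) :
    sphR h a (sphereMap h a R i z) = cosR h a z := by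
  rw [sphereMap, sphR_fiberC (z := stretchC h a R i z) hz (by rwa [cosR_stretchC]), cosR_stretchC]

theorem stretchC_eq (hR : 0 < R) (h0 : cosR h a z ≠ 0) : stretchC h a R i z =
    ((shiftC R i (cosP h a z)).1, (cosR h a z / R) • (shiftC R i (cosP h a z)).2) := by
  refine Prod.ext rfl (Prod.ext ?_ (Prod.ext ?_ ?_))
  · simp only [stretchC, shiftC, cosP, Prod.smul_fst, smul_smul]
    rw [show cosR h a z / R * (R * (cosR h a z)⁻¹) = 1 by field_simp, one_smul]
  · simp only [stretchC, shiftC, cosP, Prod.smul_fst, Prod.smul_snd, smul_eq_mul]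
    ring
  · simp only [stretchC, shiftC, cosP, Prod.smul_snd, smul_eq_mul]
    field_simp

/-- The two points differ by a positive factor in the fiber, so radial forms have the same pullback
under both mappings. -/
theorem sphP_sphereMap (hR : 0 < R) (hz : z ∈ coordDomain n a) (h0 : cosR h a z ≠ 0) :
    sphP h a (sphereMap h a R i z) = sphP h a (shiftC R i (cosP h a z)) := by
  have hz' : stretchC h a R i z ∈ coordDomain n a := hz
  rw [sphereMap, fiberC, sphP_smul _ (cosR_div_sphR_pos hz' (by rwa [cosR_stretchC])),
    stretchC_eq hR h0, sphP_smul _ (div_pos (lt_of_le_of_ne (cosR_nonneg z) h0.symm) hR)]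

theorem sphereMap_mem (hz : z ∈ coordDomain n a) (h0 : cosR h a z ≠ 0) :
    sphereMap h a R i z ∈ puncturedDomain n a := by
  have hz' : stretchC h a R i z ∈ coordDomain n a := hz
  exact ⟨hz, smul_ne_zero (cosR_div_sphR_pos hz' (by rwa [cosR_stretchC])).ne'
    (stretchC_mem (h := h) hz h0).2⟩

/-- The length of (ξ, τ) does not depend on t, so the determinant is the t-derivative r/R of the new
third component. -/
theorem hasFDerivAt_stretchC (hz : z ∈ coordDomain n a) (h0 : cosR h a z ≠ 0) :
    ∃ L : Coord n →L[ℝ] Coord n, HasFDerivAt (stretchC h a R i) L z ∧ L.det = cosR h a z / R := by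
  have hd := differentiableAt_cosR hz h0
  have ht : DifferentiableAt ℝ (fun z : Coord n => (z.2.2.1 + i) / R) z := by fun_prop
  have h1 : DifferentiableAt ℝ (fun z : Coord n => cosR h a z * ((z.2.2.1 + i) / R)) z := hd.mul ht
  obtain ⟨L, hL, hdet⟩ := exists_fderiv_replace_t h1
  refine ⟨L, ?_, hdet.trans ?_⟩
  · refine hL.congr_of_eventuallyEq (Filter.Eventually.of_forall fun z' => ?_)
    simp only [stretchC, mul_div_assoc]
  · have h2 : fderiv ℝ (cosR h a) z (0, 0, 1, 0) = 0 :=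
      fderiv_eq_zero_of_const_line hd _ (Filter.Eventually.of_forall fun s =>
        cosR_congr (by simp) (by simp) (by simp))
    have h3 : HasLineDerivAt ℝ (fun z : Coord n => (z.2.2.1 + i) / R) R⁻¹ z (0, 0, 1, 0) := by
      have h4 : HasDerivAt (fun s : ℝ => (z.2.2.1 + s + i) / R) (1 / R) 0 :=
        (((hasDerivAt_id (0 : ℝ)).const_add _).add_const _).div_const R
      rw [one_div] at h4
      refine h4.congr_of_eventuallyEq (Filter.Eventually.of_forall fun s => ?_)
      simp
    have h5 : fderiv ℝ (fun z : Coord n => (z.2.2.1 + i) / R) z (0, 0, 1, 0) = R⁻¹ :=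
      (ht.hasFDerivAt.hasLineDerivAt _).unique h3
    rw [fderiv_fun_mul hd ht]
    simp only [add_apply, smul_apply, smul_eq_mul, h2, h5]
    rw [mul_zero, add_zero, div_eq_mul_inv]

/-- The quotient of the two radii is homogeneous of degree 0 in the fiber, hence stationary in the
radial direction. -/
theorem hasFDerivAt_fiberC (hz : z ∈ coordDomain n a) (h0 : cosR h a z ≠ 0) :
    ∃ L : Coord n →L[ℝ] Coord n, HasFDerivAt (fiberC h a) L z ∧
      L.det = (cosR h a z / sphR h a z) ^ (n + 2) := by
  have hp := mem_punctured_of_cosR hz h0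
  have hd : DifferentiableAt ℝ (fun z => cosR h a z / sphR h a z) z := by
    simp only [div_eq_mul_inv]
    exact (differentiableAt_cosR hz h0).mul ((differentiableAt_sphR hp).inv (sphR_ne_zero hp))
  refine exists_fderiv_fiber_smul hd (cosR_div_sphR_pos hz h0).ne'
    (fderiv_eq_zero_of_const_line hd _ ?_)
  filter_upwards [lt_mem_nhds (show (-1 : ℝ) < 0 by norm_num)] with s hs
  have hs' : 0 < 1 + s := by linarith
  have h1 : z + s • ((0, z.2) : Coord n) = (z.1, (1 + s) • z.2) := by
    refine Prod.ext (by simp) ?_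
    simp [add_smul]
  rw [h1, sphR_smul z hs'.le, cosR_smul (z := z) (z' := (z.1, (1 + s) • z.2)) hs'.le rfl rfl rfl]
  exact mul_div_mul_left _ _ hs'.ne'

theorem hasFDerivAt_sphereMap (hR : 0 < R) (hz : z ∈ coordDomain n a) (h0 : cosR h a z ≠ 0) :
    ∃ L : Coord n →L[ℝ] Coord n, HasFDerivAt (sphereMap h a R i) L z ∧ 0 < L.det := by
  have hz' : stretchC h a R i z ∈ coordDomain n a := hz
  have h0' : cosR h a (stretchC h a R i z) ≠ 0 := by rwa [cosR_stretchC]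
  obtain ⟨L, hL, hLd⟩ := hasFDerivAt_stretchC (R := R) (i := i) hz h0
  obtain ⟨L', hL', hLd'⟩ := hasFDerivAt_fiberC hz' h0'
  refine ⟨L'.comp L, hL'.comp z hL, ?_⟩
  have h1 : (L'.comp L).det = L'.det * L.det := LinearMap.det_comp _ _
  rw [h1, hLd, hLd']
  exact mul_pos (pow_pos (cosR_div_sphR_pos hz' h0') _)
    (div_pos (lt_of_le_of_ne (cosR_nonneg z) h0.symm) hR)

/-- The density on the cosphere bundle is the pullback of the density on the sphere bundle. -/
theorem cosDensity_eq (hw : IsInvariantSphereForm h g w) (hR : 0 < R) (hz : z ∈ coordDomain n a)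
    (h0 : cosR h a z ≠ 0) : cosDensity h w Td R i 0 a z =
      |(fderiv ℝ (sphereMap h a R i) z).det| • sphDensity h w Td a (sphereMap h a R i z) := by
  obtain ⟨L, hL, hLd⟩ := hasFDerivAt_sphereMap (i := i) hR hz h0
  have hd := hL.differentiableAt
  have hmem := sphereMap_mem (R := R) (i := i) hz h0
  have hev : ∀ᶠ z' in nhds z, z' ∈ coordDomain n a ∧ cosR h a z' ≠ 0 :=
    Filter.Eventually.and ((isOpen_coordDomain a).mem_nhds hz)
      ((differentiableAt_cosR hz h0).continuousAt.eventually_ne h0)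
  have hm2 : shiftC R i (cosP h a z) ∈ puncturedDomain n a :=
    shiftC_mem (h := h) hR i hz (by rw [cosR_cosP h0]; exact one_ne_zero)
  have h1 : fderiv ℝ (cosR h a) z = (fderiv ℝ (sphR h a) (sphereMap h a R i z)).comp L := by
    rw [← hL.fderiv, ← fderiv_fun_comp z (differentiableAt_sphR hmem) hd]
    refine Filter.EventuallyEq.fderiv_eq ?_
    filter_upwards [hev] with z' hz' using (sphR_sphereMap hz'.1 hz'.2).symm
  -- The scaled shift of the projected point may be replaced by `sphereMap`, which also transports
  -- the radius; this turns the density into a genuine pullback.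
  have h2 := pull_prodForm_congr (Td := Td) hw (differentiableAt_shiftC_cosP R i hz h0) hd hm2 hmem
    (by filter_upwards [hev] with z' hz' using (sphP_sphereMap hR hz'.1 hz'.2).symm) 0 0
  rw [hL.fderiv, abs_of_pos hLd, Complex.real_smul, sphDensity, ← wedgeCoeff_pull, cosDensity, h2,
    h1, hL.fderiv]

/-- The inverse of `sphereMap`. -/
def sphereMapInv (h : Metric n M) (a : M) (R : ℝ) (i : ℤ) (y : Coord n) : Coord n :=
  (y.1, (sphR h a y / cosR h a y) • y.2.1, R * y.2.2.1 / cosR h a y - i,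
    sphR h a y / cosR h a y * y.2.2.2)

theorem cosR_sphereMap (hz : z ∈ coordDomain n a) (h0 : cosR h a z ≠ 0) :
    cosR h a (sphereMap h a R i z) =
      cosR h a z / sphR h a (stretchC h a R i z) * cosR h a z := by
  have hz' : stretchC h a R i z ∈ coordDomain n a := hz
  have h0' : cosR h a (stretchC h a R i z) ≠ 0 := by rwa [cosR_stretchC]
  rw [cosR_smul (z := stretchC h a R i z) (z' := sphereMap h a R i z)
    (cosR_div_sphR_pos hz' h0').le rfl rfl rfl, cosR_stretchC]

theorem sphereMapInv_sphereMap (hR : 0 < R) (hz : z ∈ coordDomain n a) (h0 : cosR h a z ≠ 0) :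
    sphereMapInv h a R i (sphereMap h a R i z) = z := by
  have hs : sphR h a (stretchC h a R i z) ≠ 0 := sphR_ne_zero (stretchC_mem hz h0)
  rw [sphereMapInv, sphR_sphereMap hz h0, cosR_sphereMap hz h0, sphereMap, fiberC, cosR_stretchC]
  refine Prod.ext rfl (Prod.ext ?_ (Prod.ext ?_ ?_))
  · simp only [stretchC, Prod.smul_fst, smul_smul]
    rw [show ∀ s r : ℝ, s ≠ 0 → r ≠ 0 → r / (r / s * r) * (r / s) = 1 from fun s r hs hr => by
      field_simp]
    · exact one_smul _ _
    · exact hs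
    · exact h0
  · simp only [stretchC, Prod.smul_fst, Prod.smul_snd, smul_eq_mul] at hs ⊢
    field_simp
    ring
  · simp only [stretchC, Prod.smul_snd, smul_eq_mul] at hs ⊢
    field_simp

theorem sphereMapInv_mem {y : Coord n} (hy : y ∈ sphSector h R i a) :
    cosR h a (sphereMapInv h a R i y) = sphR h a y := by
  rw [cosR_smul (z := y) (z' := sphereMapInv h a R i y)
    (div_nonneg (sphR_nonneg y) (cosR_nonneg y)) rfl rfl rfl]
  exact div_mul_cancel₀ _ hy.2.1

theorem sphereMap_sphereMapInv (hR : 0 < R) {y : Coord n} (hy : y ∈ sphSector h R i a) :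
    sphereMap h a R i (sphereMapInv h a R i y) = y := by
  have hs : sphR h a y ≠ 0 := (lt_trans one_pos hy.2.2.1.1).ne'
  have hc := hy.2.1
  have hk : 0 < sphR h a y / cosR h a y :=
    div_pos (lt_trans one_pos hy.2.2.1.1) (lt_of_le_of_ne (cosR_nonneg y) hc.symm)
  have h1 : stretchC h a R i (sphereMapInv h a R i y) = (y.1, (sphR h a y / cosR h a y) • y.2) := by
    rw [stretchC, sphereMapInv_mem hy]
    refine Prod.ext rfl (Prod.ext rfl (Prod.ext ?_ rfl))
    simp only [sphereMapInv, Prod.smul_fst, Prod.smul_snd, smul_eq_mul]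
    field_simp
    ring
  rw [sphereMap, fiberC, cosR_stretchC, sphereMapInv_mem hy, h1, sphR_smul y hk.le]
  refine Prod.ext rfl ?_
  simp only [smul_smul]
  rw [show sphR h a y / (sphR h a y / cosR h a y * sphR h a y) * (sphR h a y / cosR h a y) = 1 by
    field_simp, one_smul]

/-- At the image point, R t divided by the length of (ξ, τ) equals the original t + i. Thus 0 ≤ t <
1 becomes the condition of the sector, and the two radii correspond. -/
theorem image_sphereMap (hR : 0 < R) :
    sphereMap h a R i '' cosCollar h (Ico 0 1) a = sphSector h R i a := by
  refine Subset.antisymm ?_ fun y hy => ?_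
  · rintro _ ⟨z, hz, rfl⟩
    have h0 := cosR_ne_zero_of_mem hz
    have hc := cosR_sphereMap (R := R) (i := i) hz.1 h0
    have hs := sphR_pos (h := h) (stretchC_mem (R := R) (i := i) hz.1 h0)
    have hc0 : cosR h a z / sphR h a (stretchC h a R i z) * cosR h a z ≠ 0 :=
      mul_ne_zero (div_ne_zero h0 hs.ne') h0
    refine ⟨hz.1, by rwa [hc], ?_, ?_⟩
    · rw [sphR_sphereMap hz.1 h0]; exact hz.2.2
    · have h1 : R * (sphereMap h a R i z).2.2.1 / cosR h a (sphereMap h a R i z) = z.2.2.1 + i := by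
        have := congrArg (fun z : Coord n => z.2.2.1 + i)
          (sphereMapInv_sphereMap (i := i) hR hz.1 h0)
        simp only [sphereMapInv, sub_add_cancel] at this
        exact this
      rw [h1]
      have := hz.2.1
      exact ⟨by linarith [this.1], by linarith [this.2]⟩
  · refine ⟨sphereMapInv h a R i y, ⟨hy.1, ?_, ?_⟩, sphereMap_sphereMapInv hR hy⟩
    · have := hy.2.2.2
      change R * y.2.2.1 / cosR h a y - i ∈ Ico (0 : ℝ) 1
      exact ⟨by linarith [this.1], by linarith [this.2]⟩
    · change cosR h a (sphereMapInv h a R i y) ∈ _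
      rw [sphereMapInv_mem hy]
      exact hy.2.2.1

end SphereMap

/-! ### Integrals over the sphere bundle -/

section SphereIntegral

open MeasureTheory

variable {n : ℕ} {M : Type*} [TopologicalSpace M] [ChartedSpace (Euc n) M] [IsManifold (𝓡 n) ∞ M]
  {h : Metric n M} {g : M ≃ₘ^∞⟮𝓡 n, 𝓡 n⟯ M} {Td : BaseForm n M} {w : MatrixForm n M} {a : M}

/-- The collar of the sphere bundle, in coordinates. -/
def sphCollar (h : Metric n M) (a : M) : Set (Coord n) := collar (sphereRadius h) univ a

theorem mem_sphCollar {z : Coord n} :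
    z ∈ sphCollar h a ↔ z ∈ coordDomain n a ∧ sphR h a z ∈ Ioo 1 2 :=
  ⟨fun hz => ⟨hz.1, hz.2.2⟩, fun hz => ⟨hz.1, trivial, hz.2⟩⟩

theorem mem_punctured_of_sphR {z : Coord n} (hz : z ∈ coordDomain n a) (h0 : sphR h a z ≠ 0) :
    z ∈ puncturedDomain n a := by
  refine ⟨hz, fun h1 => h0 ?_⟩
  have h2 := sphR_sq (h := h) (a := a) z
  rw [(normSqCoord_eq_zero h hz).mpr (by rw [h1]; rfl), h1] at h2
  exact pow_eq_zero_iff two_ne_zero |>.mp (by simpa using h2)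

theorem mem_punctured_of_mem_sphCollar {z : Coord n} (hz : z ∈ sphCollar h a) :
    z ∈ puncturedDomain n a :=
  mem_punctured_of_sphR hz.1 (lt_trans one_pos (mem_sphCollar.mp hz).2.1).ne'

theorem measurableSet_sphCollar : MeasurableSet (sphCollar h a) := by
  have h1 : IsOpen (coordDomain n a ∩ sphR h a ⁻¹' Ioo 1 2) :=
    continuousOn_sphR.isOpen_inter_preimage (isOpen_coordDomain a) isOpen_Ioo
  convert h1.measurableSet using 1
  ext z
  exact mem_sphCollar

theorem continuousOn_sphDensity (hw : IsInvariantSphereForm h g w) (hTd : IsToddForm h g Td) :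
    ContinuousOn (sphDensity h w Td a) (puncturedDomain n a) := by
  unfold sphDensity
  simp only [wedgeCoeff_eq]
  have h1 : ContinuousOn (fderiv ℝ (sphR h a)) (puncturedDomain n a) :=
    contDiffOn_sphR.continuousOn_fderiv_of_isOpen (isOpen_puncturedDomain a) (by simp)
  refine continuousOn_finsetSum _ fun k _ => ContinuousOn.mul (continuousOn_const.mul ?_) ?_
  · exact Complex.continuous_ofReal.comp_continuousOn (h1.clm_apply continuousOn_const)
  · exact continuousOn_prodForm_coeff hw hTd a 0 0 _

/-- The part of the closed collar over a compact set is contained in a compact set. -/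
theorem exists_compact_collar {K : Set (Euc n)} (hK : IsCompact K)
    (hKt : K ⊆ (extChartAt (𝓡 n) a).target) : ∃ K' : Set (Coord n), IsCompact K' ∧
      K' ⊆ puncturedDomain n a ∧ ∀ z ∈ sphCollar h a, z.1 ∈ K → z ∈ K' := by
  let S : Set (Coord n) := K ×ˢ Metric.sphere 0 1
  have hS : IsCompact S := hK.prod (isCompact_sphere 0 1)
  have hSp : S ⊆ puncturedDomain n a := fun z hz =>
    ⟨hKt hz.1, fun h0 => by simpa [h0] using hz.2⟩
  -- The collar is parametrized by a unit vector of the coordinate norm in the fiber and the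
  -- Riemannian radius in [1, 2], both ranging over compact sets.
  let f : Coord n × ℝ → Coord n := fun p => (p.1.1, (p.2 * (sphR h a p.1)⁻¹) • p.1.2)
  have hf : ContinuousOn f (S ×ˢ Icc 1 2) := by
    have h1 : ContinuousOn (fun p : Coord n × ℝ => (sphR h a p.1)⁻¹) (S ×ˢ Icc 1 2) :=
      (continuousOn_sphR.comp continuous_fst.continuousOn fun p hp => (hSp hp.1).1).inv₀
        fun p hp => sphR_ne_zero (hSp hp.1)
    exact (by fun_prop : Continuous fun p : Coord n × ℝ => p.1.1).continuousOn.prodMk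
      ((continuous_snd.continuousOn.mul h1).smul
        (by fun_prop : Continuous fun p : Coord n × ℝ => p.1.2).continuousOn)
  refine ⟨f '' (S ×ˢ Icc 1 2), (hS.prod isCompact_Icc).image_of_continuousOn hf, ?_, ?_⟩
  · rintro _ ⟨p, hp, rfl⟩
    exact ⟨(hSp hp.1).1, smul_ne_zero (mul_ne_zero (lt_of_lt_of_le one_pos hp.2.1).ne'
      (inv_ne_zero (sphR_ne_zero (hSp hp.1)))) (hSp hp.1).2⟩
  · intro z hz hzK
    have hp := mem_punctured_of_mem_sphCollar hz
    have hn : 0 < ‖z.2‖ := norm_pos_iff.mpr hp.2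
    have hs := sphR_ne_zero (h := h) hp
    refine ⟨((z.1, ‖z.2‖⁻¹ • z.2), sphR h a z), ⟨⟨hzK, ?_⟩, ?_⟩, ?_⟩
    · simp [norm_smul, hn.ne']
    · exact ⟨(mem_sphCollar.mp hz).2.1.le, (mem_sphCollar.mp hz).2.2.le⟩
    · refine Prod.ext rfl ?_
      simp only [f]
      rw [sphR_smul z (inv_nonneg.mpr hn.le), smul_smul]
      convert one_smul ℝ z.2 using 2
      field_simp

/-- The sector of a point is the integer part of R t / |(ξ, τ)|, so the sectors are disjoint. Only
points with ξ = 0 and τ = 0 are missed, and these form a null set. -/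
theorem hasSum_of_sectors {E : Type*} [NormedAddCommGroup E] [NormedSpace ℝ E] {f : Coord n → E}
    {R : ℝ} (hR : 0 < R) (hf : IntegrableOn f (sphCollar h a)) :
    HasSum (fun i : ℤ => ∫ z in sphSector h R i a, f z) (∫ z in sphCollar h a, f z) := by
  -- The sector is an injective differentiable image of a measurable set.
  have hm : ∀ i : ℤ, MeasurableSet (sphSector h R i a) := by
    intro i
    rw [← image_sphereMap hR]
    have hC : MeasurableSet (cosCollar h (Ico 0 1) a) := measurableSet_cosCollar measurableSet_Ico
    refine measurable_image_of_fderivWithin hC (f' := fderiv ℝ (sphereMap h a R i))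
      (fun z hz => ?_) fun z hz z' hz' he => ?_
    · obtain ⟨L, hL, -⟩ := hasFDerivAt_sphereMap (i := i) hR hz.1 (cosR_ne_zero_of_mem hz)
      exact hL.differentiableAt.hasFDerivAt.hasFDerivWithinAt
    · rw [← sphereMapInv_sphereMap (i := i) hR hz.1 (cosR_ne_zero_of_mem hz), he,
        sphereMapInv_sphereMap hR hz'.1 (cosR_ne_zero_of_mem hz')]
  have hd : Pairwise (Function.onFun Disjoint fun i : ℤ => sphSector h R i a) := by
    intro i j hij
    refine Set.disjoint_left.mpr fun z hz hz' => hij ?_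
    rw [← Int.floor_eq_iff.mpr hz.2.2.2, ← Int.floor_eq_iff.mpr hz'.2.2.2]
  have hsub : ⋃ i : ℤ, sphSector h R i a ⊆ sphCollar h a :=
    iUnion_subset fun i z hz => mem_sphCollar.mpr ⟨hz.1, hz.2.2.1⟩
  have hae : (⋃ i : ℤ, sphSector h R i a : Set (Coord n)) =ᵐ[volume] sphCollar h a := by
    refine hsub.eventuallyLE.antisymm ?_
    rw [ae_le_set]
    -- It is enough to enclose the missed points in the hyperplane τ = 0.
    let τ : Coord n →ₗ[ℝ] ℝ :=
      LinearMap.snd ℝ ℝ ℝ ∘ₗ LinearMap.snd ℝ (Euc n) (ℝ × ℝ) ∘ₗ LinearMap.snd ℝ (Euc n) (Euc n × ℝ × ℝ)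
    have hker : volume (LinearMap.ker τ : Set (Coord n)) = 0 := by
      refine Measure.addHaar_submodule _ _ fun h0 => ?_
      have h1 : τ (0, 0, 0, 1) = 0 := by
        rw [← LinearMap.mem_ker, h0]
        trivial
      exact one_ne_zero h1
    refine measure_mono_null (fun z hz => ?_) hker
    by_contra hz0
    refine hz.2 (mem_iUnion.mpr ⟨⌊R * z.2.2.1 / cosR h a z⌋, hz.1.1, fun hc => hz0 ?_,
      (mem_sphCollar.mp hz.1).2, Int.floor_le _, Int.lt_floor_add_one _⟩)
    exact ((cosR_eq_zero_iff hz.1.1).mp hc).2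
  rw [← setIntegral_congr_set hae]
  exact hasSum_integral_iUnion hm hd (hf.mono_set hsub)

variable [CompactSpace M] [T2Space M]

/-- The cutoff has compact support in the chart domain, so the integrand is supported over a compact
set of base points. The closed collar there is compact and off the zero section, where the density
is continuous. -/
theorem integrableOn_sphDensity (hw : IsInvariantSphereForm h g w) (hTd : IsToddForm h g Td)
    (a : M) : IntegrableOn (fun z => cutoff a z • sphDensity h w Td a z) (sphCollar h a) := by
  have hsrc : tsupport (chartPartition n M a) ⊆ (extChartAt (𝓡 n) a).source := by
    rw [extChartAt_source]; exact tsupport_partition_subset a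
  have hK : IsCompact (extChartAt (𝓡 n) a '' tsupport (chartPartition n M a)) :=
    (isClosed_tsupport _).isCompact.image_of_continuousOn
      ((continuousOn_extChartAt a).mono hsrc)
  have hKt : extChartAt (𝓡 n) a '' tsupport (chartPartition n M a) ⊆ (extChartAt (𝓡 n) a).target := by
    rintro _ ⟨x, hx, rfl⟩
    exact (extChartAt (𝓡 n) a).map_source (hsrc hx)
  obtain ⟨K', hK', hKp, hmem⟩ := exists_compact_collar (h := h) hK hKt
  have hc : ContinuousOn (fun z => cutoff a z • sphDensity h w Td a z) K' := by
    have h1 : ContinuousOn (cutoff (n := n) a) K' :=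
      (continuousOn_partition_comp continuous_id a a).mono fun z hz => (hKp hz).1
    exact h1.smul ((continuousOn_sphDensity hw hTd).mono hKp)
  have h1 : IntegrableOn (fun z => cutoff a z • sphDensity h w Td a z) (K' ∩ sphCollar h a) :=
    (hc.integrableOn_compact hK').mono_set inter_subset_left
  refine h1.of_forall_sdiff_eq_zero measurableSet_sphCollar fun z hz => ?_
  have h2 : cutoff a z = 0 := by
    by_contra h0
    refine hz.2 ⟨hmem z hz.1 ?_, hz.1⟩
    exact ⟨(extChartAt (𝓡 n) a).symm z.1, subset_tsupport _ h0,
      (extChartAt (𝓡 n) a).right_inv hz.1.1⟩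
  rw [h2, zero_smul]

/-- The change of variables by `sphereMap`. -/
theorem integral_sphereMap (hw : IsInvariantSphereForm h g w) (hTd : IsToddForm h g Td) {R : ℝ}
    (hR : 0 < R) (i : ℤ) (a : M) :
    IntegrableOn (fun z => cutoff a z • cosDensity h w Td R i 0 a z) (cosCollar h (Ico 0 1) a) ∧
    ∫ z in cosCollar h (Ico 0 1) a, cutoff a z • cosDensity h w Td R i 0 a z =
      ∫ z in sphSector h R i a, cutoff a z • sphDensity h w Td a z ∧
    ∫ z in cosCollar h (Ico 0 1) a, ‖cutoff a z • cosDensity h w Td R i 0 a z‖ =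
      ∫ z in sphSector h R i a, ‖cutoff a z • sphDensity h w Td a z‖ := by
  have hC : MeasurableSet (cosCollar h (Ico 0 1) a) := measurableSet_cosCollar measurableSet_Ico
  have hder : ∀ z ∈ cosCollar h (Ico 0 1) a, HasFDerivWithinAt (sphereMap h a R i)
      (fderiv ℝ (sphereMap h a R i) z) (cosCollar h (Ico 0 1) a) z := by
    intro z hz
    obtain ⟨L, hL, -⟩ := hasFDerivAt_sphereMap (i := i) hR hz.1 (cosR_ne_zero_of_mem hz)
    exact hL.differentiableAt.hasFDerivAt.hasFDerivWithinAt
  have hinj : InjOn (sphereMap h a R i) (cosCollar h (Ico 0 1) a) := fun z hz z' hz' he => by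
    rw [← sphereMapInv_sphereMap (i := i) hR hz.1 (cosR_ne_zero_of_mem hz), he,
      sphereMapInv_sphereMap hR hz'.1 (cosR_ne_zero_of_mem hz')]
  -- The cutoff depends only on the base point, which the mapping fixes.
  have hpt : ∀ z ∈ cosCollar h (Ico 0 1) a, |(fderiv ℝ (sphereMap h a R i) z).det| •
      (cutoff a (sphereMap h a R i z) • sphDensity h w Td a (sphereMap h a R i z)) =
      cutoff a z • cosDensity h w Td R i 0 a z := by
    intro z hz
    rw [cosDensity_eq hw hR hz.1 (cosR_ne_zero_of_mem hz), smul_comm]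
    rfl
  have himg := image_sphereMap (h := h) (a := a) (i := i) hR
  have hsub : sphSector h R i a ⊆ sphCollar h a := fun z hz => mem_sphCollar.mpr ⟨hz.1, hz.2.2.1⟩
  refine ⟨?_, ?_, ?_⟩
  · have h1 := (integrableOn_image_iff_integrableOn_abs_det_fderiv_smul volume hC hder hinj
      (fun z => cutoff a z • sphDensity h w Td a z)).mp
      (by rw [himg]; exact (integrableOn_sphDensity hw hTd a).mono_set hsub)
    exact h1.congr_fun hpt hC
  · rw [← himg, integral_image_eq_integral_abs_det_fderiv_smul volume hC hder hinj]
    exact (setIntegral_congr_fun hC hpt).symm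
  · rw [← himg, integral_image_eq_integral_abs_det_fderiv_smul volume hC hder hinj]
    refine (setIntegral_congr_fun hC fun z hz => ?_).symm
    have h1 := congrArg norm (hpt z hz)
    rw [norm_smul, Real.norm_of_nonneg (abs_nonneg _)] at h1
    exact h1

end SphereIntegral

/-! ### Summation over the diagonal and conclusion -/

section Main

open MeasureTheory

/-- Measurability passes to the limit of the finite sums, and the norm of the limit is dominated by
the sum of the norms, integrated termwise. -/
theorem integrable_of_hasSum {α ι E : Type*} [MeasurableSpace α] {μ : Measure α} [Countable ι]
    [NormedAddCommGroup E] {F : ι → α → E} {f : α → E} (hF : ∀ i, Integrable (F i) μ)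
    (hs : Summable fun i => ∫ x, ‖F i x‖ ∂μ) (hf : ∀ᵐ x ∂μ, HasSum (fun i => F i x) (f x)) :
    Integrable f μ := by
  refine ⟨aestronglyMeasurable_of_tendsto_ae (Filter.atTop : Filter (Finset ι))
    (f := fun s x => ∑ i ∈ s, F i x) (fun s => ?_) hf, ?_⟩
  · exact Finset.aestronglyMeasurable_fun_sum s fun i _ => (hF i).1
  · have h1 : ∫⁻ x, ‖f x‖ₑ ∂μ ≤ ∑' i, ∫⁻ x, ‖F i x‖ₑ ∂μ := by
      rw [← lintegral_tsum fun i => (hF i).1.enorm]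
      refine lintegral_mono_ae ?_
      filter_upwards [hf] with x hx
      rw [← hx.tsum_eq]
      exact enorm_tsum_le_tsum_enorm
    refine lt_of_le_of_lt h1 ?_
    have h2 : ∀ i, ∫⁻ x, ‖F i x‖ₑ ∂μ = ENNReal.ofReal (∫ x, ‖F i x‖ ∂μ) := fun i =>
      (ofReal_integral_norm_eq_lintegral_enorm (hF i)).symm
    simp only [h2]
    exact hs.tsum_ofReal_lt_top

variable {n : ℕ} {M : Type*} [TopologicalSpace M] [ChartedSpace (Euc n) M] [IsManifold (𝓡 n) ∞ M]
  [CompactSpace M] [T2Space M]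
  {h : Metric n M} {g : M ≃ₘ^∞⟮𝓡 n, 𝓡 n⟯ M} {Td : BaseForm n M} {w : MatrixForm n M}

theorem mappingTorusIntegral_traceForm (hg : Preserves g h) (hw : IsInvariantSphereForm h g w)
    (hTd : IsToddForm h g Td) {R : ℝ} (hR : 0 < R) :
    MappingTorusIntegrable h (traceForm R w Td) ∧
      mappingTorusIntegral h (traceForm R w Td) = cycleTrace h Td w := by
  obtain ⟨A, hA⟩ := exists_finset_partition n M
  have hC : ∀ a : M, MeasurableSet (cosCollar h (Ico 0 1) a) := fun a =>
    measurableSet_cosCollar measurableSet_Ico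
  -- The entry at position i is traded for the one at position 0, with the shift exponent i kept.
  have hdiag := fun i : ℤ => integral_cosDensity_eq hg hw hTd hR measurableSet_Ico hA i
    (fun a => (integral_sphereMap hw hTd hR i a).1) i
  have hsph := fun a : M => integrableOn_sphDensity hw hTd a
  have hnorm : ∀ a : M, Summable fun i : ℤ =>
      ∫ z in cosCollar h (Ico 0 1) a, ‖cutoff a z • cosDensity h w Td R i i a z‖ := by
    intro a
    by_cases ha : a ∈ A
    -- Only the total over all charts can be moved along the diagonal, not the share of one chart;
    -- the share is therefore bounded by the total, which is a sum of sector integrals.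
    · have h1 : Summable fun i : ℤ => ∑ b ∈ A,
          ∫ z in sphSector h R i b, ‖cutoff b z • sphDensity h w Td b z‖ :=
        summable_sum fun b _ => (hasSum_of_sectors hR (hsph b).norm).summable
      refine h1.of_nonneg_of_le (fun i => integral_nonneg fun z => norm_nonneg _) fun i => ?_
      rw [← Finset.sum_congr rfl fun b _ => (integral_sphereMap hw hTd hR i b).2.2,
        ← (hdiag i).2.2]
      exact Finset.single_le_sum (f := fun b =>
        ∫ z in cosCollar h (Ico 0 1) b, ‖cutoff b z • cosDensity h w Td R i i b z‖)
        (fun b _ => integral_nonneg fun z => norm_nonneg _) ha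
    · simp only [cutoff_eq_zero hA ha, zero_smul, norm_zero, integral_zero]
      exact summable_zero
  have hpt : ∀ a, ∀ z ∈ cosCollar h (Ico 0 1) a,
      HasSum (fun i : ℤ => cutoff a z • cosDensity h w Td R i i a z)
        (collarDensity (cosphereRadius h) (cosphereProj h) (traceForm R w Td) a z) := fun a z hz =>
    hasSum_collarDensity hw hTd hR hz.1 (cosR_ne_zero_of_mem hz)
  have hsum : ∀ a, HasSum
      (fun i : ℤ => ∫ z in cosCollar h (Ico 0 1) a, cutoff a z • cosDensity h w Td R i i a z)
      (∫ z in cosCollar h (Ico 0 1) a,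
        collarDensity (cosphereRadius h) (cosphereProj h) (traceForm R w Td) a z) := by
    intro a
    have h1 := hasSum_integral_of_summable_integral_norm (fun i => (hdiag i).1 a) (hnorm a)
    rwa [setIntegral_congr_fun (hC a) fun z hz => (hpt a z hz).tsum_eq] at h1
  refine ⟨fun a => integrable_of_hasSum (fun i => (hdiag i).1 a) (hnorm a)
    ((ae_restrict_iff' (hC a)).mpr (ae_of_all _ (hpt a))), ?_⟩
  have hfin : ∀ (ρ : Ambient n M → ℝ) (p : Ambient n M → Ambient n M) (J : Set ℝ)
      (η : HypersurfaceForm n M), hypersurfaceIntegral ρ p J η =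
        ∑ a ∈ A, ∫ z in collar ρ J a, collarDensity ρ p η a z := by
    intro ρ p J η
    refine finsum_eq_sum_of_support_subset _ fun a ha => ?_
    by_contra haA
    refine ha ?_
    have h1 : ∀ z, collarDensity ρ p η a z = 0 := fun z => by
      rw [collarDensity, hA a haA, Complex.ofReal_zero, zero_mul]
    simp only [h1, integral_zero]
  rw [mappingTorusIntegral, cycleTrace, sphereIntegral, hfin, hfin]
  have h1 := hasSum_sum fun a (_ : a ∈ A) => hsum a
  have h2 : HasSum (fun i : ℤ => ∑ a ∈ A, ∫ z in sphSector h R i a,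
      cutoff a z • sphDensity h w Td a z)
      (∑ a ∈ A, ∫ z in sphCollar h a, cutoff a z • sphDensity h w Td a z) :=
    hasSum_sum fun a _ => hasSum_of_sectors hR (hsph a)
  -- The two series have the same terms: diagonal independence first, then the change of variables
  -- chart by chart.
  have h3 := h1.unique (h2.congr_fun fun i => by
    rw [(hdiag i).2.1]
    exact Finset.sum_congr rfl fun a _ => (integral_sphereMap hw hTd hR i a).2.1)
  refine h3.trans (Finset.sum_congr rfl fun a _ => ?_)
  exact (setIntegral_congr_fun measurableSet_sphCollar fun z hz =>
    collarDensity_sphere hw (mem_punctured_of_mem_sphCollar hz)).symm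

end Main

end ShiftIndex

end

theorem lemma3p4 {n : ℕ} {M : Type*} [TopologicalSpace M] [ChartedSpace (Euc n) M]
    [IsManifold (𝓡 n) ∞ M] [CompactSpace M] [T2Space M]
    (h : ShiftIndex.Metric n M) (g : M ≃ₘ^∞⟮𝓡 n, 𝓡 n⟯ M) (hg : Preserves g h)
    (Td : BaseForm n M) (hTd : IsToddForm h g Td) :
    (∀ (m : ℝ) (a : ℝ → SeqSpace →ₗ[ℂ] SeqSpace), m < -1 → IsFamilyOfOrder m a →
      (∀ R : ℝ, 1 ≤ R → IsTraceClass (a R)) ∧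
      ∃ C : ℝ, ∀ R : ℝ, 1 ≤ R → ‖opTrace (a R)‖ ≤ C * R ^ (m + 1)) ∧
    (∀ w : MatrixForm n M, IsInvariantSphereForm h g w → ∀ R : ℝ, 1 ≤ R →
      -- the top degree component of `w_R Td` on `S*(M × ℝ)` takes values in trace class operators
      (∀ (q : Ambient n M) (v : Fin (2 * n + 1) → TangentSpace (ambientModel n) q),
        cosphereRadius h q = 1 →
        (∀ l, mfderiv (ambientModel n) 𝓘(ℝ, ℝ) (cosphereRadius h) q (v l) = (0 : ℝ)) →
        ∃ T : SeqSpace →ₗ[ℂ] SeqSpace, IsTraceClass T ∧ matrixOf T = topMatrix R w Td q v) ∧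
      -- its trace is invariant under the action of `ℤ`, so it is a form on `S*M_ℤ`
      (∀ (q : Ambient n M) (v : Fin (2 * n + 1) → TangentSpace (ambientModel n) q),
        cosphereRadius h q = 1 →
        traceForm R w Td (deck g q)
            (fun l => mfderiv (ambientModel n) (ambientModel n) (deck g) q (v l)) =
          traceForm R w Td q v) ∧
      -- the integral over `S*M_ℤ` exists and is equal to `τ(w)`
      MappingTorusIntegrable h (traceForm R w Td) ∧
      mappingTorusIntegral h (traceForm R w Td) = cycleTrace h Td w) := by
  refine ⟨fun m a hm ha => isTraceClass_and_opTrace_le a hm ha, fun w hw R hR => ?_⟩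
  have hR' : 0 < R := lt_of_lt_of_le one_pos hR
  exact ⟨fun q v hq hv => exists_isTraceClass_topMatrix hw hTd hR' q v hq hv,
    fun q v hq => traceForm_deck hw hTd hR' q v (by rw [hq]; exact one_ne_zero),
    mappingTorusIntegral_traceForm hg hw hTd hR'⟩
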